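/- **Setting.** Let $\mathcal I=\{\mathtt j_1,\dots,\mathtt j_n\}\subset\mathbb Z$ consist of $n\ge 0$ distinct integers, $\kappa:=\max_l|\mathtt j_l|$ ($\kappa:=0$ if $n=0$), let $a\ge 0$, $p>1/2$, $\langle j\rangle:=\max\{1,|j|\}$, and $\|z\|_{a,p}^2:=\sum_{j\in\mathbb Z\setminus\mathcal I}|z_j|^2e^{2a|j|}\langle j\rangle^{2p}$. For $0<s,r<1$ let $D(r)$ be the set of $(y,z,\bar z)$ with $y\in\mathbb C^n$, $|y|_1<r^2$, and complex sequences $z=z^+$, $\bar z=z^-$ (independent variables, indexed by $\mathbb Z\setminus\mathcal I$) with $\|z\|_{a,p}<r$, $\|\bar z\|_{a,p}<r$, and let $D(s,r)$ be the set of $(x,y,z,\bar z)$ with $x\in\mathbb C^n$, $|\mathrm{Im}\,x_h|<s$ for all $h$, and $(y,z,\bar z)\in D(r)$. Let $\mathcal O\subset\mathbb R^n$ be a set of parameters. Functions $f$ on $D(s,r)\times\mathcal O$ are sums of absolutely convergent series $f=\sum f_{k,i,\alpha,\beta}(\xi)\,e^{\mathrm i k\cdot x}y^iz^\alpha\bar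 z^\beta$ over $k\in\mathbb Z^n$, $i\in\mathbb N^n$ and finitely supported $\alpha,\beta$ (the coefficients are unique). For a vector field $X=(X^{(x)},X^{(y)},X^{(z)},X^{(\bar z)})$ whose components are series of this kind, $\|X\|_{s,r}$ is the supremum over $\xi\in\mathcal O$ and $(y,z,\bar z)\in D(r)$ of $$\tfrac1s|u^{(x)}|_\infty+\tfrac1{r^2}|u^{(y)}|_1+\tfrac1r\|u^{(z)}\|_{a,p}+\tfrac1r\|u^{(\bar z)}\|_{a,p},$$ where each entry of $u$ is obtained from the corresponding component of $X$ by replacing every term $c\,e^{\mathrm i k\cdot x}y^iz^\alpha\bar z^\beta$ by $|c|\,e^{|k|_1s}|y^i||z^\alpha||\bar z^\beta|$. Put $X_f:=(\partial_yf,-\partial_xf,-\mathrm i\partial_{\bar z}f,\mathrm i\partial_zf)$. $\mathcal H_{s,r}$ is the space of $f$ with $\|X_f\|_{s,r}<\infty$, and $\mathcal H^{\rm null}_{s,r}$ its subspace of functions satisfying momentum conservation: $f_{k,i,\alpha,\beta}=0$ unless $\pi(k,\alpha,\beta):=\sum_l\mathtt j_lk_l+\sum_jj(\alpha_j-\beta_j)=0$.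 The Poisson bracket is $$\{f,g\}=\partial_xf\cdot\partial_yg-\partial_xg\cdot\partial_yf+\mathrm i\sum_{\sigma=\pm,\,j}\sigma\,\partial_{z_j^\sigma}f\,\partial_{z_j^{-\sigma}}g .$$ **Quasi-Töplitz functions.** Let $0<b<L<1$, and let $N_0\ge1$ be an integer and $\theta,\mu$ be reals with $$1<\theta,\mu<6,\qquad 12N_0^{L-1}+2\kappa N_0^{b-1}<1 .$$ For integers $N\ge N_0$: a monomial is $(N,\mu)$-low momentum if $\sum_j|j|(\alpha_j+\beta_j)<\mu N^L$ and $|k|_1<N^b$; $\mathcal L_{s,r}(N,\mu,h)$ is the set of functions in $\mathcal H_{s,r}$ all of whose monomials are $(N,\mu)$-low momentum with $\pi(k,\alpha,\beta)+h=0$; $\Pi_{N,\theta,\mu}$ is the projection on the monomials of zero momentum that are products of an $(N,\mu)$-low momentum monomial and of $z_m^\sigma z_{m'}^{\sigma'}$ with $m,m'\in\mathbb Z\setminus\mathcal I$, $|m|,|m'|>\theta N$, $\sigma,\sigma'=\pm$. The set $\mathcal T_{s,r}(N,\theta,\mu)$ of Töplitz functions consists of the $f\in\mathcal H^{\rm null}_{s,r}$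 of the form $$f=\sum_{|m|,|m'|>\theta N,\ \sigma,\sigma'=\pm}f^{\sigma,\sigma'}\big(\mathrm{sign}(m),\sigma m+\sigma'm'\big)\,z_m^\sigma z_{m'}^{\sigma'},\qquad f^{\sigma,\sigma'}(\varsigma,h)\in\mathcal L_{s,r}(N,\mu,h)\quad(\varsigma=\pm,\ h\in\mathbb Z).$$ A function $f\in\mathcal H^{\rm null}_{s,r}$ is $(N_0,\theta,\mu)$-quasi-Töplitz, written $f\in\mathcal Q^T_{s,r}(N_0,\theta,\mu)$, if $$\|f\|^T_{s,r,N_0,\theta,\mu}:=\sup_{N\ge N_0}\ \inf_{\tilde f\in\mathcal T_{s,r}(N,\theta,\mu)}\max\big\{\|X_f\|_{s,r},\ \|X_{\tilde f}\|_{s,r},\ \|X_{\hat f}\|_{s,r}\big\}<\infty,\qquad\hat f:=N(\Pi_{N,\theta,\mu}f-\tilde f).$$ **Proposition 3.1 (Poisson bracket).** For every $n$ there is a constant $C(n)\ge1$, depending only on $n$, such that the following holds. In the setting above, let $f^{(1)},f^{(2)}\in\mathcal Q^T_{s,r}(N_0,\theta,\mu)$, and let $N_1\ge N_0$ (an integer),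 $1<\mu_1\le\mu$, $\theta\le\theta_1<6$, $s/2\le s_1<s$, $r/2\le r_1<r$ satisfy $$\kappa N_1^{b-L}<\mu-\mu_1,\quad \mu N_1^{L-1}+\kappa N_1^{b-1}<\theta_1-\theta,\quad 2N_1e^{-N_1^b\frac{s-s_1}2}<1,\quad b(s-s_1)N_1^b>2 .$$ Then the series defining $\{f^{(1)},f^{(2)}\}$ converges absolutely on $D(s_1,r_1)$, $\{f^{(1)},f^{(2)}\}\in\mathcal Q^T_{s_1,r_1}(N_1,\theta_1,\mu_1)$, and $$\|\{f^{(1)},f^{(2)}\}\|^T_{s_1,r_1,N_1,\theta_1,\mu_1}\le C(n)\,\delta^{-1}\,\|f^{(1)}\|^T_{s,r,N_0,\theta,\mu}\,\|f^{(2)}\|^T_{s,r,N_0,\theta,\mu},\qquad\delta:=\min\Big\{1-\frac{s_1}s,\,1-\frac{r_1}r\Big\}.$$ -/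

import Mathlib

open scoped ENNReal BigOperators

noncomputable section

namespace QuasiToplitz

/-- The normal sites `ℤ \ 𝓘`, where the tangential sites `𝓘 = {js 0, …, js (n-1)}` are listed
without repetition by `js`. -/
abbrev Site {n : ℕ} (js : Fin n ↪ ℤ) : Type := {m : ℤ // m ∉ Set.range js}

/-- Multi-indices `(k, i, α, β)`. Signs `σ = ±` are elements of `ℤˣ = {1, -1}`; the pair `(α, β)`
is stored as `γ` with `γ 1 = α` and `γ (-1) = β`. -/
@[ext] structure Idx {n : ℕ} (js : Fin n ↪ ℤ) where
  k : Fin n → ℤ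
  i : Fin n → ℕ
  γ : ℤˣ → Site js →₀ ℕ

/-- Points `(x, y, z, z̄)`; `z 1` is `z = z⁺` and `z (-1)` is `z̄ = z⁻` (independent variables). -/
@[ext] structure Point {n : ℕ} (js : Fin n ↪ ℤ) where
  x : Fin n → ℂ
  y : Fin n → ℂ
  z : ℤˣ → Site js → ℂ

/-- Formal Taylor-Fourier series, given by their coefficients `f_{k,i,α,β}`. -/
abbrev Series {n : ℕ} (js : Fin n ↪ ℤ) : Type := Idx js → ℂ

/-- `κ = max_l |j_l|` (which is `0` if there are no tangential sites). -/
def kappa {n : ℕ} (js : Fin n ↪ ℤ) : ℕ := Finset.univ.sup fun l => (js l).natAbs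

section Domain

variable {n : ℕ} {js : Fin n ↪ ℤ}

/-- The weighted norm `(∑_j u_j² e^{2a|j|} ⟨j⟩^{2p})^{1/2}` of a sequence of moduli, with
`⟨j⟩ = max {1, |j|}`; it is `∞` exactly when the sequence is not in the weighted `ℓ²` space. -/
def wNorm (a p : ℝ) (u : Site js → ℝ≥0∞) : ℝ≥0∞ :=
  (∑' j : Site js, u j ^ 2 *
    ENNReal.ofReal (Real.exp (2 * a * |((j : ℤ) : ℝ)|) * (max 1 |((j : ℤ) : ℝ)|) ^ (2 * p))) ^
      (1 / 2 : ℝ)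

/-- `(y, z, z̄) ∈ D(r)`: `|y|₁ < r²`, `‖z‖_{a,p} < r`, `‖z̄‖_{a,p} < r`. -/
def ActionBall (a p r : ℝ) (y : Fin n → ℂ) (z : ℤˣ → Site js → ℂ) : Prop :=
  ∑ h, ‖y h‖ < r ^ 2 ∧ ∀ σ, wNorm a p (fun j => ‖z σ j‖ₑ) < ENNReal.ofReal r

/-- The toroidal domain `D(s, r)`. -/
def domain (js : Fin n ↪ ℤ) (a p s r : ℝ) : Set (Point js) :=
  {v | (∀ h, |(v.x h).im| < s) ∧ ActionBall a p r v.y v.z}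

/-- The monomial `e^{i k·x} y^i z^α z̄^β`. -/
def Idx.monomial (q : Idx js) (v : Point js) : ℂ :=
  Complex.exp (Complex.I * ∑ h, (q.k h : ℂ) * v.x h) * (∏ h, v.y h ^ q.i h) *
    ∏ σ, (q.γ σ).prod fun j e => v.z σ j ^ e

/-- `F` is on `D(s, r)` the sum of the absolutely convergent Taylor-Fourier series with
coefficients `f`. -/
def HasExpansion (a p s r : ℝ) (F : Point js → ℂ) (f : Series js) : Prop :=
  ∀ v ∈ domain js a p s r, HasSum (fun q => f q * q.monomial v) (F v)

/-- The complex partial derivatives of a function, along the coordinate directions. -/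
def partialX (F : Point js → ℂ) (h : Fin n) (v : Point js) : ℂ :=
  deriv (fun t => F { v with x := Function.update v.x h t }) (v.x h)

def partialY (F : Point js → ℂ) (h : Fin n) (v : Point js) : ℂ :=
  deriv (fun t => F { v with y := Function.update v.y h t }) (v.y h)

def partialZ (F : Point js → ℂ) (σ : ℤˣ) (j : Site js) (v : Point js) : ℂ :=
  deriv (fun t => F { v with z := Function.update v.z σ (Function.update (v.z σ) j t) }) (v.z σ j)

/-- The terms `σ ∂_{z_j^σ} F ∂_{z_j^{-σ}} G` of the infinite part of the Poisson bracket. -/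
def bracketTerm (F G : Point js → ℂ) (v : Point js) (c : ℤˣ × Site js) : ℂ :=
  ((c.1 : ℤ) : ℂ) * partialZ F c.1 c.2 v * partialZ G (-c.1) c.2 v

/-- The Poisson bracket
`∂_x F · ∂_y G - ∂_x G · ∂_y F + i ∑_{σ, j} σ ∂_{z_j^σ} F ∂_{z_j^{-σ}} G`. -/
def poissonBracket (F G : Point js → ℂ) (v : Point js) : ℂ :=
  ∑ h, (partialX F h v * partialY G h v - partialX G h v * partialY F h v) +
    Complex.I * ∑' c : ℤˣ × Site js, bracketTerm F G v c

end Domain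

section Majorant

variable {n : ℕ} {js : Fin n ↪ ℤ}

/-- The multi-index of the single variable `z_j^σ`. -/
def unitZ (σ : ℤˣ) (j : Site js) : ℤˣ → Site js →₀ ℕ := Pi.single σ (Finsupp.single j 1)

/-- The term-by-term partial derivatives of a Taylor-Fourier series. -/
def Series.dX (f : Series js) (h : Fin n) : Series js := fun q => Complex.I * (q.k h : ℂ) * f q

def Series.dY (f : Series js) (h : Fin n) : Series js :=
  fun q => ((q.i h : ℂ) + 1) * f { q with i := q.i + Pi.single h 1 }

def Series.dZ (f : Series js) (σ : ℤˣ) (j : Site js) : Series js :=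
  fun q => ((q.γ σ j : ℂ) + 1) * f { q with γ := q.γ + unitZ σ j }

/-- Formal vector fields, one Taylor-Fourier series for each component. -/
structure VectorField {n : ℕ} (js : Fin n ↪ ℤ) where
  x : Fin n → Series js
  y : Fin n → Series js
  z : ℤˣ → Site js → Series js

/-- The Hamiltonian vector field `X_f = (∂_y f, -∂_x f, -i ∂_{z̄} f, i ∂_z f)`. -/
def hamVF (f : Series js) : VectorField js where
  x h := f.dY h
  y h := fun q => -f.dX h q
  z σ j := fun q => -((σ : ℤ) : ℂ) * Complex.I * f.dZ (-σ) j q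

/-- `∑_q |c_q| e^{|k|s} |y^i| |z^α| |z̄^β|`. -/
def majorantSum (s : ℝ) (c : Series js) (y : Fin n → ℂ) (z : ℤˣ → Site js → ℂ) : ℝ≥0∞ :=
  ∑' q : Idx js, ‖c q‖ₑ * ENNReal.ofReal (Real.exp ((∑ h, |(q.k h : ℝ)|) * s)) *
    (∏ h, ‖y h‖ₑ ^ q.i h) * ∏ σ, (q.γ σ).prod fun j e => ‖z σ j‖ₑ ^ e

/-- The majorant norm `‖X‖_{s,r}` of a formal vector field: the supremum over `D(r)` of the
`(s, r)`-weighted norm `|x|_∞ / s + |y|₁ / r² + ‖z‖_{a,p} / r + ‖z̄‖_{a,p} / r` of the vector of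
majorant sums of the components. -/
def VectorField.majorantNorm (a p s r : ℝ) (X : VectorField js) : ℝ≥0∞ :=
  ⨆ (y : Fin n → ℂ) (z : ℤˣ → Site js → ℂ) (_ : ActionBall a p r y z),
    (⨆ h, majorantSum s (X.x h) y z) / ENNReal.ofReal s +
    (∑ h, majorantSum s (X.y h) y z) / ENNReal.ofReal (r ^ 2) +
    ∑ σ, wNorm a p (fun j => majorantSum s (X.z σ j) y z) / ENNReal.ofReal r

/-- The momentum `π(k, α, β) = ∑_l j_l k_l + ∑_j j (α_j - β_j)` of a monomial. -/
def Idx.momentum (q : Idx js) : ℤ :=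
  ∑ l, js l * q.k l + ∑ σ : ℤˣ, (σ : ℤ) * (q.γ σ).sum fun j e => (j : ℤ) * (e : ℤ)

/-- The monomial is `(N, μ)`-low momentum:
`∑_j |j| (α_j + β_j) < μ N^L` and `|k| < N^b`. -/
def Idx.IsLow (L b : ℝ) (N : ℕ) (μ : ℝ) (q : Idx js) : Prop :=
  ∑ σ : ℤˣ, ((q.γ σ).sum fun j e => |((j : ℤ) : ℝ)| * (e : ℝ)) < μ * (N : ℝ) ^ L ∧
    ∑ h, |(q.k h : ℝ)| < (N : ℝ) ^ b

/-- The monomial is `(N, θ, μ)`-bilinear: it has zero momentum and is the product of an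
`(N, μ)`-low momentum monomial and of `z_m^σ z_{m'}^{σ'}` with `|m|, |m'| > θ N`. -/
def Idx.IsBilinear (L b : ℝ) (N : ℕ) (θ μ : ℝ) (q : Idx js) : Prop :=
  q.momentum = 0 ∧ ∃ (σ σ' : ℤˣ) (m m' : Site js) (γ₀ : ℤˣ → Site js →₀ ℕ),
    θ * N < |((m : ℤ) : ℝ)| ∧ θ * N < |((m' : ℤ) : ℝ)| ∧
      q.γ = γ₀ + unitZ σ m + unitZ σ' m' ∧ Idx.IsLow L b N μ { q with γ := γ₀ }

end Majorant

section Spaces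

variable {n : ℕ} {js : Fin n ↪ ℤ} {𝒪 : Set (Fin n → ℝ)}

/-- `‖X_f‖_{s,r} = sup_{ξ ∈ 𝒪} ‖X_{f(ξ)}‖_{s,r}` for a series depending on parameters. -/
def hamNorm (a p s r : ℝ) (f : 𝒪 → Series js) : ℝ≥0∞ :=
  ⨆ ξ, (hamVF (f ξ)).majorantNorm a p s r

/-- M-regularity, i.e. membership in `𝓗_{s,r}`. -/
def IsMRegular (a p s r : ℝ) (f : 𝒪 → Series js) : Prop := hamNorm a p s r f < ∞

/-- Momentum conservation: only monomials of zero momentum occur. -/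
def IsNull (f : 𝒪 → Series js) : Prop := ∀ ξ q, f ξ q ≠ 0 → q.momentum = 0

/-- The space `𝓛_{s,r}(N, μ, h)`. -/
def IsLowMomentum (a p L b s r : ℝ) (N : ℕ) (μ : ℝ) (h : ℤ) (g : 𝒪 → Series js) : Prop :=
  IsMRegular a p s r g ∧ ∀ ξ q, g ξ q ≠ 0 → q.IsLow L b N μ ∧ q.momentum + h = 0

/-- The projection `Π_{N,θ,μ}` on the `(N, θ, μ)`-bilinear monomials. -/
def bilinearProj (L b : ℝ) (N : ℕ) (θ μ : ℝ) (f : 𝒪 → Series js) : 𝒪 → Series js :=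
  fun ξ => Set.indicator {q | q.IsBilinear L b N θ μ} (f ξ)

/-- The product of a series with the variable `z_j^σ`. -/
def mulZ (σ : ℤˣ) (j : Site js) (g : Series js) : Series js :=
  fun q => if q.γ σ j = 0 then 0 else g { q with γ := q.γ - unitZ σ j }

/-- The formal series `∑_{|m|,|m'| > θ N, σ, σ'} g^{σ,σ'}_{m,m'} z_m^σ z_{m'}^{σ'}`. Its coefficient
at `q` only involves the finitely many sites that occur in `q`, since the other products contain no
monomial `q`. -/
def bilinearSeries (N : ℕ) (θ : ℝ) (g : ℤˣ → ℤˣ → Site js → Site js → Series js) : Series js :=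
  fun q => ∑ σ, ∑ σ', ∑ m ∈ (q.γ σ).support, ∑ m' ∈ (q.γ σ').support,
    if θ * N < |((m : ℤ) : ℝ)| ∧ θ * N < |((m' : ℤ) : ℝ)| then
      mulZ σ m (mulZ σ' m' (g σ σ' m m')) q else 0

/-- The sign of a (nonzero) integer. -/
def sgn (m : ℤ) : ℤˣ := if 0 < m then 1 else -1

/-- The space `𝓣_{s,r}(N, θ, μ)` of Töplitz functions: bilinear functions whose coefficients
`f^{σ,σ'}_{m,m'} = φ^{σ,σ'}(sign m, σ m + σ' m')` depend only on the sign of `m` and on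
`σ m + σ' m'`, with `φ^{σ,σ'}(ς, h) ∈ 𝓛_{s,r}(N, μ, h)`. -/
def IsToplitz (a p L b s r : ℝ) (N : ℕ) (θ μ : ℝ) (f : 𝒪 → Series js) : Prop :=
  IsMRegular a p s r f ∧ IsNull f ∧
    ∃ φ : ℤˣ → ℤˣ → ℤˣ → ℤ → 𝒪 → Series js,
      (∀ σ σ' ς h, IsLowMomentum a p L b s r N μ h (φ σ σ' ς h)) ∧
      ∀ ξ, f ξ = bilinearSeries N θ fun σ σ' m m' =>
        φ σ σ' (sgn m) ((σ : ℤ) * (m : ℤ) + (σ' : ℤ) * (m' : ℤ)) ξ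

/-- The Töplitz defect `f̂ = N (Π_{N,θ,μ} f - f̃)`. -/
def defect (L b : ℝ) (N : ℕ) (θ μ : ℝ) (f g : 𝒪 → Series js) : 𝒪 → Series js :=
  fun ξ q => (N : ℂ) * (bilinearProj L b N θ μ f ξ q - g ξ q)

/-- The quasi-Töplitz semi-norm of a (parameter dependent) Taylor-Fourier series. -/
def qtNorm (a p L b s r : ℝ) (N₀ : ℕ) (θ μ : ℝ) (f : 𝒪 → Series js) : ℝ≥0∞ :=
  ⨆ (N : ℕ) (_ : N₀ ≤ N), ⨅ (g : 𝒪 → Series js) (_ : IsToplitz a p L b s r N θ μ g),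
    max (hamNorm a p s r f)
      (max (hamNorm a p s r g) (hamNorm a p s r (defect L b N θ μ f g)))

/-- `F ∈ 𝓠^T_{s,r}(N₀, θ, μ)`: the function `F` on `D(s, r) × 𝒪` is (the sum of) an M-regular
Taylor-Fourier series with momentum conservation and finite quasi-Töplitz semi-norm. -/
def IsQuasiToplitz (a p L b s r : ℝ) (N₀ : ℕ) (θ μ : ℝ) (F : 𝒪 → Point js → ℂ) : Prop :=
  ∃ f : 𝒪 → Series js, (∀ ξ, HasExpansion a p s r (F ξ) (f ξ)) ∧
    IsMRegular a p s r f ∧ IsNull f ∧ qtNorm a p L b s r N₀ θ μ f < ∞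

/-- The semi-norm `‖F‖^T_{s,r,N₀,θ,μ}` of a function on `D(s, r) × 𝒪`: the semi-norm of its
Taylor-Fourier series. The expansion being unique, the infimum has at most one term. -/
def quasiToplitzNorm (a p L b s r : ℝ) (N₀ : ℕ) (θ μ : ℝ) (F : 𝒪 → Point js → ℂ) : ℝ≥0∞ :=
  ⨅ (f : 𝒪 → Series js) (_ : ∀ ξ, HasExpansion a p s r (F ξ) (f ξ)), qtNorm a p L b s r N₀ θ μ f

end Spaces

end QuasiToplitz

end

/-!
All norms depend only on the moduli of coefficients, so they are studied for families
`P : Idx js → ℝ≥0∞`: `mNorm P` is the supremum of the majorant of the Hamiltonian vector field, and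
`majorantNorm_hamVF` identifies it with `‖X_f‖` for `P = |f|`.

*Bracket estimate.* As the series have nonnegative coefficients, all Taylor coefficients are
nonnegative, and `ε · DX_P · U ≤ X_P(· + ε U)`. With `U = X_Q`, and `ε` so small that the shifted
point stays in the larger domain, this bounds `X_{{P, Q}} = DX_P · X_Q - DX_Q · X_P` by `8 / δ`
times the product of the norms (`mNorm_majBracket_le`), with no Cauchy estimate. The constant
obtained in the end is absolute. The function `{f, g}` is the sum of the series `bracket f g`
(`hasExpansion_poissonBracket`), and expansions are unique (`HasExpansion.unique`).

*Töplitz functions.* Up to regularity at the boundary of the ball, a series of bilinear monomials is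
Töplitz if and only if its coefficients are invariant when the two high sites `m`, `m'` move with
`sign m` and `σ m + σ' m'` fixed (`IsToplitz.shiftInvariant`, `isToplitz_of_shiftInvariant`). The
coefficients of `{f, g}` at a bilinear monomial split into four sums, according to the factors that
contain the two high variables. If both lie in one factor, conservation of momentum in the other
forces the contracted variable to be low (`der_shift_eq`). If each factor contains one, the
contracted variable is high and determined by its sign and by conservation of momentum, and moves
along with `m`, `m'` (`tsum_bracketCoef_mixed`). So brackets of shift invariant series of zero
momentum and low frequency are shift invariant (`bracket_shiftInvariant`); the conditions on `μ₁`,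
`θ₁` give room for the momentum exchanged.

*Quasi-Töplitz functions.* Given a Töplitz approximation `f̃` of `f` at scale `N`, let `f°` be
`f - Π f + f̃`, with the frequencies `|k| ≥ N^b` removed. Then `N (f - f°)` is the defect `f̂` on low
frequencies and `N f` on high ones, and the latter has norm at most that of `f` on a thinner strip,
since `2 N e^{-N^b (s - s₁) / 2} < 1` (`mNorm_approximant_le`). The projection of `{f°, g°}` is a
Töplitz approximation of `{f, g}`, with defect the projection of
`{N (f - f°), g} + {f°, N (g - g°)}`, so the bracket estimate concludes (`qtNorm_bracket_le_of_lt`).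
-/

noncomputable section

namespace QuasiToplitz

variable {n : ℕ} {js : Fin n ↪ ℤ}

/-! ### Multi-indices and series with nonnegative coefficients -/

/-- The coordinates `y_h` and `z_j^σ` of the phase space, other than the angles. -/
abbrev Coord {n : ℕ} (js : Fin n ↪ ℤ) : Type := Fin n ⊕ (ℤˣ × Site js)

/-- All coordinates `x_h`, `y_h`, `z_j^σ` of the phase space. -/
abbrev Var {n : ℕ} (js : Fin n ↪ ℤ) : Type := Fin n ⊕ Coord js

instance : Add (Idx js) := ⟨fun p q => ⟨p.k + q.k, p.i + q.i, p.γ + q.γ⟩⟩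
instance : Zero (Idx js) := ⟨⟨0, 0, 0⟩⟩

@[simp] lemma Idx.add_k (p q : Idx js) : (p + q).k = p.k + q.k := rfl
@[simp] lemma Idx.add_i (p q : Idx js) : (p + q).i = p.i + q.i := rfl
@[simp] lemma Idx.add_γ (p q : Idx js) : (p + q).γ = p.γ + q.γ := rfl
@[simp] lemma Idx.zero_k : (0 : Idx js).k = 0 := rfl
@[simp] lemma Idx.zero_i : (0 : Idx js).i = 0 := rfl
@[simp] lemma Idx.zero_γ : (0 : Idx js).γ = 0 := rfl

instance : AddCommMonoid (Idx js) where
  add_assoc p q t := Idx.ext (add_assoc _ _ _) (add_assoc _ _ _) (add_assoc _ _ _)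
  zero_add p := Idx.ext (zero_add _) (zero_add _) (zero_add _)
  add_zero p := Idx.ext (add_zero _) (add_zero _) (add_zero _)
  add_comm p q := Idx.ext (add_comm _ _) (add_comm _ _) (add_comm _ _)
  nsmul := nsmulRec

instance : IsRightCancelAdd (Idx js) where
  add_right_cancel a p q h := by
    have h : p + a = q + a := h
    refine Idx.ext ?_ ?_ ?_
    · exact add_right_cancel (congrArg Idx.k h)
    · exact add_right_cancel (congrArg Idx.i h)
    · exact add_right_cancel (congrArg Idx.γ h)

/-- The exponents of `y` and `z` in a monomial, as one multi-index. -/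
def Idx.expo (q : Idx js) : Coord js →₀ ℕ :=
  (Finsupp.equivFunOnFinite.symm q.i).sumElim (Finsupp.equivFunOnFinite.symm q.γ).uncurry

@[simp] lemma Idx.expo_inl (q : Idx js) (h : Fin n) : q.expo (Sum.inl h) = q.i h := rfl
@[simp] lemma Idx.expo_inr (q : Idx js) (c : ℤˣ × Site js) :
    q.expo (Sum.inr c) = q.γ c.1 c.2 := rfl

@[simp] lemma Idx.expo_add (p q : Idx js) : (p + q).expo = p.expo + q.expo := by
  ext (h | c) <;> simp

lemma Idx.expo_ext {p q : Idx js} (hk : p.k = q.k) (he : p.expo = q.expo) : p = q := by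
  refine Idx.ext hk ?_ ?_
  · funext h
    exact DFunLike.congr_fun he (Sum.inl h)
  · funext σ
    ext j
    exact DFunLike.congr_fun he (Sum.inr (σ, j))

/-- The multi-index of the monomial consisting of one coordinate; it is `0` for the angles. -/
def unit : Var js → Idx js
  | Sum.inl _ => 0
  | Sum.inr (Sum.inl h) => ⟨0, Pi.single h 1, 0⟩
  | Sum.inr (Sum.inr c) => ⟨0, 0, unitZ c.1 c.2⟩

@[simp] lemma unit_inl (h : Fin n) : unit (js := js) (Sum.inl h) = 0 := rfl

@[simp] lemma unit_k (v : Var js) : (unit v).k = 0 := by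
  rcases v with h | h | c <;> rfl

@[simp] lemma expo_unit (c : Coord js) : (unit (Sum.inr c)).expo = Finsupp.single c 1 := by
  rcases c with h | ⟨σ, j⟩
  · ext (h' | c')
    · simp [unit, Finsupp.single_apply, Pi.single_apply, eq_comm]
    · simp [unit]
  · ext (h' | ⟨σ', j'⟩)
    · simp [unit]
    · by_cases hσ : σ' = σ
      · subst hσ
        simp [unit, unitZ, Finsupp.single_apply]
      · simp [unit, unitZ, hσ]

/-- A coordinate that occurs in a monomial can be divided out. -/
lemma exists_add_unit {q : Idx js} {c : Coord js} (h : q.expo c ≠ 0) :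
    ∃ p, p + unit (Sum.inr c) = q := by
  rcases c with l | ⟨σ, j⟩
  · refine ⟨⟨q.k, q.i - Pi.single l 1, q.γ⟩, ?_⟩
    refine Idx.ext (by simp) ?_ (by simp [unit])
    simp only [Idx.expo_inl] at h
    funext l'
    by_cases hl : l' = l
    · subst hl
      simp [unit]; omega
    · simp [unit, hl]
  · refine ⟨⟨q.k, q.i, q.γ - unitZ σ j⟩, ?_⟩
    refine Idx.ext (by simp) (by simp [unit]) ?_
    simp only [Idx.expo_inr] at h
    funext σ'
    ext j'
    by_cases hl : σ' = σ
    · subst hl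
      by_cases hj : j' = j
      · subst hj
        simp [unit, unitZ]; omega
      · simp [unit, unitZ, Ne.symm hj]
    · simp [unit, unitZ, hl]

/-- The factor that `∂_v` produces: `|k_h|` for an angle, the raised exponent otherwise. -/
def derCoef : Var js → Idx js → ℕ
  | Sum.inl h, q => (q.k h).natAbs
  | Sum.inr c, q => q.expo c + 1

lemma derCoef_mul_comm (v w : Var js) (q : Idx js) :
    derCoef v q * derCoef w (q + unit v) = derCoef w q * derCoef v (q + unit w) := by
  rcases v with h | c <;> rcases w with h' | c'
  · simp [derCoef, mul_comm]
  · simp [derCoef, mul_comm]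
  · simp [derCoef, mul_comm]
  · by_cases hc : c = c'
    · subst hc; rfl
    · simp [derCoef, hc, Ne.symm hc, mul_comm]

lemma derCoef_le_add (v : Var js) (q p : Idx js) (hp : p.k = 0) :
    derCoef v q ≤ derCoef v (q + p) := by
  rcases v with h | c
  · simp [derCoef, hp]
  · simp [derCoef]

/-- `e^{|k|s} X^i`, the size of a monomial. -/
def wt (s : ℝ) (X : Coord js → ℝ≥0∞) (q : Idx js) : ℝ≥0∞ :=
  ENNReal.ofReal (Real.exp ((∑ h, |(q.k h : ℝ)|) * s)) * q.expo.prod fun c e => X c ^ e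

/-- The value of a series with nonnegative coefficients `P`, where `e^{i k·x}` is replaced by
`e^{|k|s}`. -/
def mSum (s : ℝ) (P : Idx js → ℝ≥0∞) (X : Coord js → ℝ≥0∞) : ℝ≥0∞ := ∑' q, P q * wt s X q

/-- The majorant of the partial derivative `∂_v`. -/
def dM (v : Var js) (P : Idx js → ℝ≥0∞) : Idx js → ℝ≥0∞ := fun q => derCoef v q * P (q + unit v)

lemma dM_comm (v w : Var js) (P : Idx js → ℝ≥0∞) : dM v (dM w P) = dM w (dM v P) := by
  funext q
  simp only [dM, ← mul_assoc, ← Nat.cast_mul, derCoef_mul_comm v w q, add_right_comm q]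

/-- The derivative `∂_v` of the size of a monomial, the transpose of `dM v`. -/
def dwt (v : Var js) (s : ℝ) (X : Coord js → ℝ≥0∞) (q : Idx js) : ℝ≥0∞ :=
  match v with
  | Sum.inl h => (q.k h).natAbs * wt s X q
  | Sum.inr c => q.expo c * (ENNReal.ofReal (Real.exp ((∑ h, |(q.k h : ℝ)|) * s)) *
      (q.expo - Finsupp.single c 1).prod fun c e => X c ^ e)

/-- Summation by parts: the derivative may act on the monomials instead of on the coefficients. -/
lemma mSum_dM (v : Var js) (s : ℝ) (P : Idx js → ℝ≥0∞) (X : Coord js → ℝ≥0∞) :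
    mSum s (dM v P) X = ∑' q, P q * dwt v s X q := by
  rcases v with h | c
  · refine tsum_congr fun q => ?_
    simp only [dM, dwt, derCoef, unit_inl, add_zero]
    ring
  · rw [← Function.Injective.tsum_eq (g := fun q : Idx js => q + unit (Sum.inr c))
      (add_left_injective _)]
    · refine tsum_congr fun q => ?_
      simp only [dM, dwt, derCoef, wt, Idx.expo_add, expo_unit, Idx.add_k, unit_k, add_zero,
        add_tsub_cancel_right, Finsupp.add_apply, Finsupp.single_eq_same]
      ring
    · intro q hq
      refine exists_add_unit fun h0 => hq ?_
      simp [dwt, h0]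

lemma exp_add_le_mul (s : ℝ) (hs : 0 ≤ s) (k l : Fin n → ℤ) :
    ENNReal.ofReal (Real.exp ((∑ h, |((k + l) h : ℝ)|) * s)) ≤
      ENNReal.ofReal (Real.exp ((∑ h, |(k h : ℝ)|) * s)) *
        ENNReal.ofReal (Real.exp ((∑ h, |(l h : ℝ)|) * s)) := by
  rw [← ENNReal.ofReal_mul (Real.exp_pos _).le, ← Real.exp_add, ← add_mul,
    ← Finset.sum_add_distrib]
  refine ENNReal.ofReal_le_ofReal (Real.exp_le_exp.2 (mul_le_mul_of_nonneg_right
    (Finset.sum_le_sum fun h _ => ?_) hs))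
  push_cast [Pi.add_apply]
  exact abs_add_le _ _

lemma prod_pow_add (X : Coord js → ℝ≥0∞) (a b : Coord js →₀ ℕ) :
    (a + b).prod (fun c e => X c ^ e) = a.prod (fun c e => X c ^ e) * b.prod fun c e => X c ^ e :=
  Finsupp.prod_add_index' (fun _ => pow_zero _) fun _ _ _ => pow_add _ _ _

lemma wt_add_le (s : ℝ) (hs : 0 ≤ s) (X : Coord js → ℝ≥0∞) (p q : Idx js) :
    wt s X (p + q) ≤ wt s X p * wt s X q := by
  simp only [wt, Idx.expo_add, prod_pow_add, Idx.add_k]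
  calc _ ≤ _ := mul_le_mul_left (exp_add_le_mul s hs p.k q.k) _
    _ = _ := by ring

lemma wt_add_of_k_eq_zero (s : ℝ) (X : Coord js → ℝ≥0∞) (p q : Idx js) (hq : q.k = 0) :
    wt s X (p + q) = wt s X p * q.expo.prod fun c e => X c ^ e := by
  simp only [wt, Idx.expo_add, prod_pow_add, Idx.add_k, hq, add_zero, mul_assoc]

lemma natCast_mul_prod_sub (X : Coord js → ℝ≥0∞) (a b : Coord js →₀ ℕ) (c : Coord js) :
    (a c : ℝ≥0∞) * (a + b - Finsupp.single c 1).prod (fun c e => X c ^ e) =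
      a c * (a - Finsupp.single c 1).prod (fun c e => X c ^ e) * b.prod fun c e => X c ^ e := by
  rcases Nat.eq_zero_or_pos (a c) with h | h
  · simp [h]
  · rw [mul_assoc, ← prod_pow_add]
    congr 2
    have : Finsupp.single c 1 ≤ a := Finsupp.single_le_iff.2 h
    exact tsub_add_eq_add_tsub this |>.symm

/-- Leibniz rule, with an inequality because of `|k + l| ≤ |k| + |l|`. -/
lemma dwt_add_le (v : Var js) (s : ℝ) (hs : 0 ≤ s) (X : Coord js → ℝ≥0∞) (p q : Idx js) :
    dwt v s X (p + q) ≤ dwt v s X p * wt s X q + wt s X p * dwt v s X q := by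
  rcases v with h | c
  · simp only [dwt]
    calc (((p + q).k h).natAbs : ℝ≥0∞) * wt s X (p + q)
        ≤ ((p.k h).natAbs + (q.k h).natAbs) * (wt s X p * wt s X q) := by
          refine mul_le_mul' ?_ (wt_add_le s hs X p q)
          exact_mod_cast Int.natAbs_add_le _ _
      _ = _ := by ring
  · simp only [dwt, wt, Idx.expo_add, Idx.add_k, Finsupp.add_apply, Nat.cast_add]
    set E := fun a : Coord js →₀ ℕ => a.prod (fun c e => X c ^ e)
    have h1 := natCast_mul_prod_sub X p.expo q.expo c
    have h2 := natCast_mul_prod_sub X q.expo p.expo c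
    rw [add_comm q.expo] at h2
    have h3 := exp_add_le_mul s hs p.k q.k
    set Ep := ENNReal.ofReal (Real.exp ((∑ h, |(p.k h : ℝ)|) * s))
    set Eq := ENNReal.ofReal (Real.exp ((∑ h, |(q.k h : ℝ)|) * s))
    set T := (p.expo + q.expo - Finsupp.single c 1).prod fun c e => X c ^ e
    calc _ ≤ ((p.expo c : ℝ≥0∞) + q.expo c) * ((Ep * Eq) * T) := by gcongr
      _ = Ep * Eq * (p.expo c * T) + Ep * Eq * (q.expo c * T) := by ring
      _ = _ := by rw [h1, h2]; ring

/-- Bernoulli's inequality, homogeneous and in `[0, ∞]`. -/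
lemma pow_add_mul_le_add_pow (x u : ℝ≥0∞) (m : ℕ) :
    x ^ m + m * x ^ (m - 1) * u ≤ (x + u) ^ m := by
  induction m with
  | zero => simp
  | succ m ih =>
    have h : (m : ℝ≥0∞) * x ^ (m - 1) * x = m * x ^ m := by
      rcases m with _ | m
      · simp
      · rw [Nat.add_sub_cancel, mul_assoc, ← pow_succ]
    calc x ^ (m + 1) + ((m + 1 : ℕ) : ℝ≥0∞) * x ^ (m + 1 - 1) * u
        = x ^ m * x + x ^ m * u + m * x ^ m * u := by
          rw [Nat.add_sub_cancel]; push_cast; ring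
      _ = x ^ m * x + x ^ m * u + (m * x ^ (m - 1) * x) * u := by rw [h]
      _ ≤ x ^ m * x + x ^ m * u + (m * x ^ (m - 1) * x) * u + m * x ^ (m - 1) * u * u :=
          le_self_add
      _ = (x ^ m + m * x ^ (m - 1) * u) * (x + u) := by ring
      _ ≤ (x + u) ^ m * (x + u) := by gcongr
      _ = _ := by ring

/-- The terms of order zero and one in the expansion of a product. -/
lemma prod_add_sum_le_prod {ι : Type*} [DecidableEq ι] (S : Finset ι) (A B C : ι → ℝ≥0∞)
    (h : ∀ c ∈ S, A c + B c ≤ C c) :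
    ∏ c ∈ S, A c + ∑ c ∈ S, B c * ∏ d ∈ S.erase c, A d ≤ ∏ c ∈ S, C c := by
  induction S using Finset.induction_on with
  | empty => simp
  | insert x S hx ih =>
    have ih := ih fun c hc => h c (Finset.mem_insert_of_mem hc)
    have hx' := h x (Finset.mem_insert_self _ _)
    rw [Finset.prod_insert hx, Finset.prod_insert hx, Finset.sum_insert hx,
      Finset.erase_insert hx]
    have : ∀ c ∈ S, B c * ∏ d ∈ (insert x S).erase c, A d =
        A x * (B c * ∏ d ∈ S.erase c, A d) := by
      intro c hc
      have hne : x ≠ c := fun e => hx (e ▸ hc)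
      rw [Finset.erase_insert_of_ne hne, Finset.prod_insert (by simp [hx])]
      ring
    rw [Finset.sum_congr rfl this, ← Finset.mul_sum]
    calc _ ≤ A x * ∏ c ∈ S, A c + (B x * ∏ c ∈ S, A c + A x * ∑ c ∈ S, B c * ∏ d ∈ S.erase c, A d)
          + B x * ∑ c ∈ S, B c * ∏ d ∈ S.erase c, A d := le_self_add
      _ = (A x + B x) * (∏ c ∈ S, A c + ∑ c ∈ S, B c * ∏ d ∈ S.erase c, A d) := by ring
      _ ≤ _ := by gcongr

/-- First-order Taylor expansion of `X^a`, without the angles. -/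
lemma prod_pow_add_tsum_le (X U : Coord js → ℝ≥0∞) (a : Coord js →₀ ℕ) :
    a.prod (fun c e => X c ^ e) + ∑' c, a c * (a - Finsupp.single c 1).prod (fun c e => X c ^ e) *
      U c ≤ a.prod fun c e => (X c + U c) ^ e := by
  classical
  have key : ∑' c, a c * (a - Finsupp.single c 1).prod (fun c e => X c ^ e) * U c =
      ∑ c ∈ a.support, (a c * X c ^ (a c - 1) * U c) * ∏ d ∈ a.support.erase c, X d ^ a d := by
    rw [tsum_eq_sum (s := a.support) (fun c hc => by simp [Finsupp.notMem_support_iff.1 hc])]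
    refine Finset.sum_congr rfl fun c hc => ?_
    rw [Finsupp.prod_of_support_subset (s := a.support) _ (Finsupp.support_mono tsub_le_self) _
      (fun _ _ => pow_zero _), ← Finset.mul_prod_erase _ _ hc]
    have : ∏ x ∈ a.support.erase c, X x ^ ((a - Finsupp.single c 1 : Coord js →₀ ℕ) x) =
        ∏ d ∈ a.support.erase c, X d ^ a d := by
      refine Finset.prod_congr rfl fun d hd => ?_
      simp [(Finset.ne_of_mem_erase hd).symm]
    rw [this]
    simp only [Finsupp.tsub_apply, Finsupp.single_eq_same]
    ring
  rw [key]
  exact prod_add_sum_le_prod a.support _ _ _ fun c _ => pow_add_mul_le_add_pow _ _ _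

/-- First-order Taylor expansion of a monomial with nonnegative increments. -/
lemma tsum_dwt_mul_le {s t : ℝ} (X : Coord js → ℝ≥0∞) (U : Var js → ℝ≥0∞) (q : Idx js)
    (hst : t ≤ s) (hU : ∀ h, U (Sum.inl h) ≤ ENNReal.ofReal (s - t)) :
    ∑' v, dwt v t X q * U v ≤ wt s (fun c => X c + U (Sum.inr c)) q := by
  rw [Summable.tsum_sum ENNReal.summable ENNReal.summable]
  set E := ENNReal.ofReal (Real.exp ((∑ h, |(q.k h : ℝ)|) * t)) with hE
  set Z := q.expo.prod fun c e => X c ^ e with hZ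
  set Λ := ∑' c, q.expo c * (q.expo - Finsupp.single c 1).prod (fun c e => X c ^ e) *
      U (Sum.inr c) with hΛ
  have h1 := prod_pow_add_tsum_le X (fun c => U (Sum.inr c)) q.expo
  have hx : ∑' h : Fin n, dwt (Sum.inl h) t X q * U (Sum.inl h) ≤
      ENNReal.ofReal ((∑ h, |(q.k h : ℝ)|) * (s - t)) * (E * Z) := by
    rw [tsum_fintype, Finset.sum_mul, ENNReal.ofReal_sum_of_nonneg
      (fun _ _ => mul_nonneg (abs_nonneg _) (by linarith)), Finset.sum_mul]
    refine Finset.sum_le_sum fun h _ => ?_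
    rw [ENNReal.ofReal_mul (abs_nonneg _)]
    have : ENNReal.ofReal |(q.k h : ℝ)| = ((q.k h).natAbs : ℝ≥0∞) := by
      rw [← Int.cast_abs, Int.abs_eq_natAbs, Int.cast_natCast, ENNReal.ofReal_natCast]
    rw [this]
    calc dwt (Sum.inl h) t X q * U (Sum.inl h) = (q.k h).natAbs * U (Sum.inl h) * (E * Z) := by
          simp only [dwt, wt]; ring
      _ ≤ _ := by gcongr; exact hU h
  have hy : ∑' c : Coord js, dwt (Sum.inr c) t X q * U (Sum.inr c) = E * Λ := by
    rw [hΛ, ← ENNReal.tsum_mul_left]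
    refine tsum_congr fun c => ?_
    simp only [dwt]
    ring
  have hexp : E + ENNReal.ofReal ((∑ h, |(q.k h : ℝ)|) * (s - t)) * E ≤
      ENNReal.ofReal (Real.exp ((∑ h, |(q.k h : ℝ)|) * s)) := by
    have hK : 0 ≤ (∑ h, |(q.k h : ℝ)|) * (s - t) :=
      mul_nonneg (Finset.sum_nonneg fun _ _ => abs_nonneg _) (by linarith)
    rw [hE, ← ENNReal.ofReal_mul hK,
      ← ENNReal.ofReal_add (Real.exp_pos _).le (mul_nonneg hK (Real.exp_pos _).le)]
    refine ENNReal.ofReal_le_ofReal ?_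
    set K := ∑ h, |(q.k h : ℝ)|
    have h3 := Real.add_one_le_exp (K * (s - t))
    calc Real.exp (K * t) + K * (s - t) * Real.exp (K * t)
        = (K * (s - t) + 1) * Real.exp (K * t) := by ring
      _ ≤ Real.exp (K * (s - t)) * Real.exp (K * t) := by gcongr
      _ = Real.exp (K * s) := by rw [← Real.exp_add]; ring_nf
  rw [hy]
  set κ := ENNReal.ofReal ((∑ h, |(q.k h : ℝ)|) * (s - t))
  calc _ ≤ κ * (E * Z) + E * Λ := by gcongr
    _ ≤ κ * (E * Z) + E * Λ + (E * Z + κ * E * Λ) := le_self_add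
    _ = (E + κ * E) * (Z + Λ) := by ring
    _ ≤ _ := mul_le_mul' hexp h1

/-- First-order Taylor expansion of a series with nonnegative coefficients: no Cauchy estimate is
needed to bound the derivative in the direction `U`. -/
lemma tsum_mSum_dM_mul_le {s t : ℝ} (P : Idx js → ℝ≥0∞) (X : Coord js → ℝ≥0∞)
    (U : Var js → ℝ≥0∞) (hst : t ≤ s) (hU : ∀ h, U (Sum.inl h) ≤ ENNReal.ofReal (s - t)) :
    ∑' v, mSum t (dM v P) X * U v ≤ mSum s P fun c => X c + U (Sum.inr c) := by
  simp only [mSum_dM, ← ENNReal.tsum_mul_right]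
  rw [ENNReal.tsum_comm]
  refine ENNReal.tsum_le_tsum fun q => ?_
  simp only [mul_assoc, ENNReal.tsum_mul_left]
  exact mul_le_mul' le_rfl (tsum_dwt_mul_le X U q hst hU)

/-- The pairs of multi-indices with sum `q`. -/
abbrev Fib (q : Idx js) : Type := {p : Idx js × Idx js // p.1 + p.2 = q}

/-- The product of two series with coefficients in `[0, ∞]`. -/
def conv (P Q : Idx js → ℝ≥0∞) : Idx js → ℝ≥0∞ := fun q => ∑' p : Fib q, P p.1.1 * Q p.1.2

lemma tsum_Fib (f : Idx js × Idx js → ℝ≥0∞) :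
    ∑' q, ∑' p : Fib q, f p.1 = ∑' p, f p :=
  ENNReal.tsum_fiberwise f fun p => p.1 + p.2

lemma tsum_conv_mul (P Q F : Idx js → ℝ≥0∞) :
    ∑' q, conv P Q q * F q = ∑' p, ∑' q, P p * Q q * F (p + q) := by
  rw [← ENNReal.tsum_prod (f := fun p q => P p * Q q * F (p + q)),
    ← tsum_Fib (fun x : Idx js × Idx js => P x.1 * Q x.2 * F (x.1 + x.2))]
  refine tsum_congr fun q => ?_
  rw [conv, ← ENNReal.tsum_mul_right]
  exact tsum_congr fun p => by rw [p.2]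

lemma tsum_tsum_mul_mul (P Q F G : Idx js → ℝ≥0∞) :
    ∑' p, ∑' q, P p * Q q * (F p * G q) = (∑' p, P p * F p) * ∑' q, Q q * G q := by
  rw [← ENNReal.tsum_mul_right]
  refine tsum_congr fun p => ?_
  rw [← ENNReal.tsum_mul_left]
  exact tsum_congr fun q => by ring

/-- Products of majorants; only an inequality, since `|k|` is subadditive but not additive. -/
lemma mSum_conv_le (s : ℝ) (hs : 0 ≤ s) (P Q : Idx js → ℝ≥0∞) (X : Coord js → ℝ≥0∞) :
    mSum s (conv P Q) X ≤ mSum s P X * mSum s Q X := by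
  rw [mSum, tsum_conv_mul, mSum, mSum, ← tsum_tsum_mul_mul]
  exact ENNReal.tsum_le_tsum fun p => ENNReal.tsum_le_tsum fun q =>
    mul_le_mul' le_rfl (wt_add_le s hs X p q)

/-- The Leibniz rule. -/
lemma mSum_dM_conv_le (v : Var js) (s : ℝ) (hs : 0 ≤ s) (P Q : Idx js → ℝ≥0∞)
    (X : Coord js → ℝ≥0∞) :
    mSum s (dM v (conv P Q)) X ≤
      mSum s (dM v P) X * mSum s Q X + mSum s P X * mSum s (dM v Q) X := by
  rw [mSum_dM, mSum_dM, mSum_dM, tsum_conv_mul, mSum, mSum, ← tsum_tsum_mul_mul,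
    ← tsum_tsum_mul_mul, ← ENNReal.tsum_add]
  refine ENNReal.tsum_le_tsum fun p => ?_
  rw [← ENNReal.tsum_add]
  refine ENNReal.tsum_le_tsum fun q => ?_
  rw [← mul_add]
  exact mul_le_mul' le_rfl (dwt_add_le v s hs X p q)

lemma mSum_mono {s t : ℝ} {P Q : Idx js → ℝ≥0∞} {X Y : Coord js → ℝ≥0∞} (hst : s ≤ t)
    (hPQ : P ≤ Q) (hXY : X ≤ Y) : mSum s P X ≤ mSum t Q Y := by
  refine ENNReal.tsum_le_tsum fun q => mul_le_mul' (hPQ q) (mul_le_mul' ?_ ?_)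
  · exact ENNReal.ofReal_le_ofReal (Real.exp_le_exp.2 (mul_le_mul_of_nonneg_left hst
      (Finset.sum_nonneg fun _ _ => abs_nonneg _)))
  · exact Finset.prod_le_prod' fun c _ => pow_le_pow_left' (hXY c) _

lemma dM_mono (v : Var js) {P Q : Idx js → ℝ≥0∞} (h : P ≤ Q) : dM v P ≤ dM v Q :=
  fun _ => mul_le_mul' le_rfl (h _)

lemma dM_add (v : Var js) (P Q : Idx js → ℝ≥0∞) : dM v (P + Q) = dM v P + dM v Q := by
  funext q; simp [dM, mul_add]

lemma mSum_add (s : ℝ) (P Q : Idx js → ℝ≥0∞) (X : Coord js → ℝ≥0∞) :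
    mSum s (P + Q) X = mSum s P X + mSum s Q X := by
  simp [mSum, add_mul, ENNReal.tsum_add]

lemma mSum_const_mul (s : ℝ) (κ : ℝ≥0∞) (P : Idx js → ℝ≥0∞) (X : Coord js → ℝ≥0∞) :
    mSum s (fun q => κ * P q) X = κ * mSum s P X := by
  simp [mSum, mul_assoc, ENNReal.tsum_mul_left]

lemma dM_const_mul (v : Var js) (κ : ℝ≥0∞) (P : Idx js → ℝ≥0∞) :
    dM v (fun q => κ * P q) = fun q => κ * dM v P q := by
  funext q; simp only [dM]; ring

lemma dM_tsum {ι : Type*} (v : Var js) (P : ι → Idx js → ℝ≥0∞) :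
    dM v (fun q => ∑' i, P i q) = fun q => ∑' i, dM v (P i) q := by
  funext q; simp [dM, ENNReal.tsum_mul_left]

lemma mSum_tsum {ι : Type*} (s : ℝ) (P : ι → Idx js → ℝ≥0∞) (X : Coord js → ℝ≥0∞) :
    mSum s (fun q => ∑' i, P i q) X = ∑' i, mSum s (P i) X := by
  simp only [mSum, ← ENNReal.tsum_mul_right]
  exact ENNReal.tsum_comm

/-! ### The vector field norm and the bracket estimate -/

lemma wNorm_mono {a p : ℝ} {u v : Site js → ℝ≥0∞} (h : u ≤ v) : wNorm a p u ≤ wNorm a p v := by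
  unfold wNorm
  gcongr with j
  exact h j

lemma wNorm_const_mul (a p : ℝ) (κ : ℝ≥0∞) (u : Site js → ℝ≥0∞) :
    wNorm a p (fun j => κ * u j) = κ * wNorm a p u := by
  unfold wNorm
  simp only [mul_pow, mul_assoc, ENNReal.tsum_mul_left]
  rw [ENNReal.mul_rpow_of_nonneg _ _ (by norm_num), ← ENNReal.rpow_natCast, ← ENNReal.rpow_mul]
  norm_num

/-- Minkowski's inequality. -/
lemma wNorm_add_le (a p : ℝ) (u v : Site js → ℝ≥0∞) :
    wNorm a p (fun j => u j + v j) ≤ wNorm a p u + wNorm a p v := by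
  set W : Site js → ℝ≥0∞ := fun j => ENNReal.ofReal
    (Real.exp (2 * a * |((j : ℤ) : ℝ)|) * (max 1 |((j : ℤ) : ℝ)|) ^ (2 * p)) ^ (1 / 2 : ℝ) with hW
  have key : ∀ u : Site js → ℝ≥0∞, wNorm a p u =
      (∫⁻ j, (u j * W j) ^ (2 : ℝ) ∂MeasureTheory.Measure.count) ^ (1 / (2 : ℝ)) := by
    intro u
    rw [MeasureTheory.lintegral_count]
    unfold wNorm
    congr 1
    refine tsum_congr fun j => ?_
    rw [ENNReal.mul_rpow_of_nonneg _ _ (by norm_num), hW, ← ENNReal.rpow_mul]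
    norm_num
  have h := ENNReal.lintegral_Lp_add_le (p := 2) (μ := MeasureTheory.Measure.count)
    (f := fun j => u j * W j) (g := fun j => v j * W j) (measurable_of_countable _).aemeasurable
    (measurable_of_countable _).aemeasurable (by norm_num)
  rw [key, key, key]
  simpa only [Pi.add_apply, ← add_mul] using h

/-- `D(r)` in terms of the moduli of the coordinates. -/
def ball (a p r : ℝ) (X : Coord js → ℝ≥0∞) : Prop :=
  ∑ h, X (Sum.inl h) < ENNReal.ofReal (r ^ 2) ∧
    ∀ σ, wNorm a p (fun j => X (Sum.inr (σ, j))) < ENNReal.ofReal r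

lemma ball_mono {a p r₁ r : ℝ} (h₁ : 0 ≤ r₁) (h : r₁ ≤ r) {X Y : Coord js → ℝ≥0∞} (hXY : X ≤ Y)
    (hY : ball a p r₁ Y) : ball a p r X := by
  refine ⟨(Finset.sum_le_sum fun i _ => hXY (Sum.inl i)).trans_lt (hY.1.trans_le ?_), fun σ =>
    (wNorm_mono fun j => hXY _).trans_lt ((hY.2 σ).trans_le ?_)⟩ <;> gcongr

/-- The `(s, r)`-weighted norm of a vector of moduli. -/
def vecNorm (a p s r : ℝ) (U : Var js → ℝ≥0∞) : ℝ≥0∞ :=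
  (⨆ h, U (Sum.inl h)) / ENNReal.ofReal s +
    (∑ h, U (Sum.inr (Sum.inl h))) / ENNReal.ofReal (r ^ 2) +
    ∑ σ, wNorm a p (fun j => U (Sum.inr (Sum.inr (σ, j)))) / ENNReal.ofReal r

lemma vecNorm_mono {a p s r : ℝ} {U V : Var js → ℝ≥0∞} (h : U ≤ V) :
    vecNorm a p s r U ≤ vecNorm a p s r V := by
  unfold vecNorm
  gcongr with l l _ σ
  · exact h (Sum.inl l)
  · exact h (Sum.inr (Sum.inl l))
  · exact wNorm_mono fun j => h (Sum.inr (Sum.inr (σ, j)))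

lemma vecNorm_add_le (a p s r : ℝ) (U V : Var js → ℝ≥0∞) :
    vecNorm a p s r (fun v => U v + V v) ≤ vecNorm a p s r U + vecNorm a p s r V := by
  unfold vecNorm
  calc _ ≤ ((⨆ h, U (Sum.inl h)) + ⨆ h, V (Sum.inl h)) / ENNReal.ofReal s +
        (∑ h, U (Sum.inr (Sum.inl h)) + ∑ h, V (Sum.inr (Sum.inl h))) / ENNReal.ofReal (r ^ 2) +
        ∑ σ, (wNorm a p (fun j => U (Sum.inr (Sum.inr (σ, j)))) +
          wNorm a p (fun j => V (Sum.inr (Sum.inr (σ, j))))) / ENNReal.ofReal r := by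
        gcongr
        · exact iSup_le fun h => add_le_add (le_iSup (fun h => U (Sum.inl h)) h)
            (le_iSup (fun h => V (Sum.inl h)) h)
        · rw [Finset.sum_add_distrib]
        · exact wNorm_add_le _ _ _ _
    _ = _ := by
        simp only [ENNReal.add_div, Finset.sum_add_distrib]
        ring

lemma vecNorm_const_mul (a p s r : ℝ) (κ : ℝ≥0∞) (U : Var js → ℝ≥0∞) :
    vecNorm a p s r (fun v => κ * U v) = κ * vecNorm a p s r U := by
  unfold vecNorm
  simp only [wNorm_const_mul, mul_add, Finset.mul_sum, mul_div_assoc, ← ENNReal.mul_iSup]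
  rw [← Finset.mul_sum, mul_div_assoc]

lemma div_ofReal_le {s t K : ℝ} (hs : 0 < s) (ht : 0 < t) (h : s ≤ K * t) (x : ℝ≥0∞) :
    x / ENNReal.ofReal t ≤ ENNReal.ofReal K * (x / ENNReal.ofReal s) := by
  have hK : 0 ≤ K := by
    by_contra hK
    nlinarith
  rw [div_eq_mul_inv, div_eq_mul_inv, ← ENNReal.ofReal_inv_of_pos ht,
    ← ENNReal.ofReal_inv_of_pos hs, mul_left_comm, ← ENNReal.ofReal_mul hK]
  gcongr
  rw [inv_eq_one_div, ← div_eq_mul_inv, div_le_div_iff₀ ht hs]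
  linarith

lemma vecNorm_le_mul {a p s r s₁ r₁ K : ℝ} (hs : 0 < s) (hr : 0 < r) (hs₁ : 0 < s₁) (hr₁ : 0 < r₁)
    (h1 : s ≤ K * s₁) (h2 : r ≤ K * r₁) (h3 : r ^ 2 ≤ K * r₁ ^ 2) (U : Var js → ℝ≥0∞) :
    vecNorm a p s₁ r₁ U ≤ ENNReal.ofReal K * vecNorm a p s r U := by
  unfold vecNorm
  rw [mul_add, mul_add, Finset.mul_sum]
  refine add_le_add (add_le_add ?_ ?_) (Finset.sum_le_sum fun σ _ => ?_)
  · exact div_ofReal_le hs hs₁ h1 _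
  · exact div_ofReal_le (by positivity) (by positivity) h3 _
  · exact div_ofReal_le hr hr₁ h2 _

/-- The canonically conjugate coordinate: `x_h ↔ y_h`, `z_j^σ ↔ z_j^{-σ}`. -/
def conjV : Var js → Var js
  | Sum.inl h => Sum.inr (Sum.inl h)
  | Sum.inr (Sum.inl h) => Sum.inl h
  | Sum.inr (Sum.inr c) => Sum.inr (Sum.inr (-c.1, c.2))

@[simp] lemma conjV_conjV (v : Var js) : conjV (conjV v) = v := by
  rcases v with h | h | c <;> simp [conjV]

/-- `conjV` as a permutation. -/
def conjEquiv : Var js ≃ Var js := ⟨conjV, conjV, conjV_conjV, conjV_conjV⟩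

/-- The majorant of the Hamiltonian vector field of a series. -/
def majVF (s : ℝ) (P : Idx js → ℝ≥0∞) (X : Coord js → ℝ≥0∞) (v : Var js) : ℝ≥0∞ :=
  mSum s (dM (conjV v) P) X

/-- The norm `‖X_f‖_{s,r}` as a function of the moduli `P` of the coefficients of `f`. -/
def mNorm (a p s r : ℝ) (P : Idx js → ℝ≥0∞) : ℝ≥0∞ :=
  ⨆ (X : Coord js → ℝ≥0∞) (_ : ball a p r X), vecNorm a p s r (majVF s P X)

lemma le_mNorm {a p s r : ℝ} (P : Idx js → ℝ≥0∞) {X : Coord js → ℝ≥0∞} (hX : ball a p r X) :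
    vecNorm a p s r (majVF s P X) ≤ mNorm a p s r P := le_iSup₂_of_le X hX le_rfl

lemma majVF_mono {s t : ℝ} {P Q : Idx js → ℝ≥0∞} {X : Coord js → ℝ≥0∞} (hst : s ≤ t)
    (h : P ≤ Q) : majVF s P X ≤ majVF t Q X :=
  fun v => mSum_mono hst (dM_mono (conjV v) h) le_rfl

lemma mNorm_mono {a p s r : ℝ} {P Q : Idx js → ℝ≥0∞} (h : P ≤ Q) :
    mNorm a p s r P ≤ mNorm a p s r Q :=
  iSup₂_mono fun _ _ => vecNorm_mono (majVF_mono le_rfl h)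

lemma mNorm_add_le (a p s r : ℝ) (P Q : Idx js → ℝ≥0∞) :
    mNorm a p s r (P + Q) ≤ mNorm a p s r P + mNorm a p s r Q := by
  refine iSup₂_le fun X hX => ?_
  have : majVF s (P + Q) X = fun v => majVF s P X v + majVF s Q X v := by
    funext v; simp [majVF, dM_add, mSum_add]
  rw [this]
  exact (vecNorm_add_le _ _ _ _ _ _).trans (add_le_add (le_mNorm P hX) (le_mNorm Q hX))

lemma mNorm_const_mul_le (a p s r : ℝ) (κ : ℝ≥0∞) (P : Idx js → ℝ≥0∞) :
    mNorm a p s r (fun q => κ * P q) ≤ κ * mNorm a p s r P := by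
  refine iSup₂_le fun X hX => ?_
  have : majVF s (fun q => κ * P q) X = fun v => κ * majVF s P X v := by
    funext v; simp [majVF, dM_const_mul, mSum_const_mul]
  rw [this, vecNorm_const_mul]
  exact mul_le_mul' le_rfl (le_mNorm P hX)

lemma mNorm_le_mul {a p s r s₁ r₁ K : ℝ} (hs : 0 < s) (hs₁ : 0 < s₁) (hr₁ : 0 < r₁)
    (hss : s₁ ≤ s) (hrr : r₁ ≤ r)
    (h1 : s ≤ K * s₁) (h2 : r ≤ K * r₁) (h3 : r ^ 2 ≤ K * r₁ ^ 2) (P : Idx js → ℝ≥0∞) :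
    mNorm a p s₁ r₁ P ≤ ENNReal.ofReal K * mNorm a p s r P := by
  refine iSup₂_le fun X hX => ?_
  refine (vecNorm_le_mul hs (hr₁.trans_le hrr) hs₁ hr₁ h1 h2 h3 _).trans
    (mul_le_mul' le_rfl ?_)
  exact (vecNorm_mono (majVF_mono hss le_rfl)).trans (le_mNorm P (ball_mono hr₁.le hrr le_rfl hX))

/-- The majorant of the Poisson bracket. -/
def majBracket (P Q : Idx js → ℝ≥0∞) : Idx js → ℝ≥0∞ :=
  fun q => ∑' v, conv (dM v P) (dM (conjV v) Q) q

/-- The majorant form of `X_{{f,g}} = DX_f · X_g - DX_g · X_f`. -/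
lemma majVF_majBracket_le {s : ℝ} (hs : 0 ≤ s) (P Q : Idx js → ℝ≥0∞) (X : Coord js → ℝ≥0∞)
    (w : Var js) :
    majVF s (majBracket P Q) X w ≤
      ∑' v, mSum s (dM v (dM (conjV w) P)) X * majVF s Q X v +
        ∑' v, mSum s (dM v (dM (conjV w) Q)) X * majVF s P X v := by
  unfold majVF majBracket
  rw [dM_tsum, mSum_tsum]
  have h2 : ∑' v, mSum s (dM v (dM (conjV w) Q)) X * mSum s (dM (conjV v) P) X =
      ∑' v, mSum s (dM v P) X * mSum s (dM (conjV w) (dM (conjV v) Q)) X := by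
    rw [← Equiv.tsum_eq conjEquiv]
    refine tsum_congr fun v => ?_
    change mSum s (dM (conjV v) (dM (conjV w) Q)) X * mSum s (dM (conjV (conjV v)) P) X = _
    rw [conjV_conjV, dM_comm, mul_comm]
  rw [h2, ← ENNReal.tsum_add]
  refine ENNReal.tsum_le_tsum fun v => ?_
  rw [dM_comm v (conjV w) P]
  exact mSum_dM_conv_le _ _ hs _ _ _

lemma le_of_div_ofReal_le {x A : ℝ≥0∞} {s : ℝ} (hs : 0 < s) (h : x / ENNReal.ofReal s ≤ A) :
    x ≤ A * ENNReal.ofReal s :=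
  (ENNReal.div_le_iff (by simpa using hs) ENNReal.ofReal_ne_top).1 h

/-- The domain `D(s₁, r₁)`, moved by `ε U`, stays in `D(s, r)` if `ε ‖U‖ ≤ δ`. -/
lemma ball_add_mul {a p s r s₁ r₁ δ : ℝ} {A ε : ℝ≥0∞} (hs : 0 < s) (hr : 0 < r)
    (hr₁ : 0 < r₁) (hδ : 0 ≤ δ)
    (h1 : s₁ + s * δ ≤ s) (h2 : r₁ + r * δ ≤ r) {X : Coord js → ℝ≥0∞} {U : Var js → ℝ≥0∞}
    (hX : ball a p r₁ X) (hU : vecNorm a p s r U ≤ A) (hε : ε * A ≤ ENNReal.ofReal δ) :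
    (∀ h, ε * U (Sum.inl h) ≤ ENNReal.ofReal (s - s₁)) ∧
      ball a p r fun c => X c + ε * U (Sum.inr c) := by
  have bound : ∀ {x : ℝ≥0∞} {t d : ℝ}, 0 < t → x / ENNReal.ofReal t ≤ A → t * δ ≤ d →
      ε * x ≤ ENNReal.ofReal d := by
    intro x t d ht hx hd
    calc ε * x ≤ ε * (A * ENNReal.ofReal t) := mul_le_mul' le_rfl (le_of_div_ofReal_le ht hx)
      _ = ε * A * ENNReal.ofReal t := by ring
      _ ≤ ENNReal.ofReal δ * ENNReal.ofReal t := by gcongr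
      _ = ENNReal.ofReal (δ * t) := (ENNReal.ofReal_mul hδ).symm
      _ ≤ _ := ENNReal.ofReal_le_ofReal (by linarith)
  have hrd : 0 ≤ r * δ := mul_nonneg hr.le hδ
  unfold vecNorm at hU
  refine ⟨fun h => ?_, ?_, fun σ => ?_⟩
  · refine bound hs (le_trans ?_ hU) (by linarith)
    refine le_add_right (le_add_right ?_)
    gcongr
    exact le_iSup (fun h => U (Sum.inl h)) h
  · rw [Finset.sum_add_distrib, ← Finset.mul_sum]
    have hy := bound (x := ∑ h, U (Sum.inr (Sum.inl h))) (t := r ^ 2) (d := r ^ 2 - r₁ ^ 2)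
      (by positivity) (le_trans (le_add_right le_add_self) hU) (by nlinarith)
    calc _ < ENNReal.ofReal (r₁ ^ 2) + ENNReal.ofReal (r ^ 2 - r₁ ^ 2) :=
          ENNReal.add_lt_add_of_lt_of_le (hy.trans_lt ENNReal.ofReal_lt_top).ne hX.1 hy
      _ = _ := by
          rw [← ENNReal.ofReal_add (by positivity) (by nlinarith)]; ring_nf
  · have hz := bound (x := wNorm a p fun j => U (Sum.inr (Sum.inr (σ, j)))) (t := r)
      (d := r - r₁) hr (le_trans (le_trans (Finset.single_le_sum (f := fun σ =>
        wNorm a p (fun j => U (Sum.inr (Sum.inr (σ, j)))) / ENNReal.ofReal r)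
        (fun _ _ => zero_le) (Finset.mem_univ σ)) le_add_self) hU) (by linarith)
    rw [← wNorm_const_mul] at hz
    calc _ ≤ _ := wNorm_add_le _ _ _ _
      _ < ENNReal.ofReal r₁ + ENNReal.ofReal (r - r₁) :=
          ENNReal.add_lt_add_of_lt_of_le (hz.trans_lt ENNReal.ofReal_lt_top).ne (hX.2 σ) hz
      _ = _ := by rw [← ENNReal.ofReal_add hr₁.le (by linarith)]; ring_nf

/-- The bracket estimate. With nonnegative coefficients, `ε DX_P · U ≤ X_P(· + ε U)`, which replaces
the Cauchy estimate. -/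
lemma mNorm_majBracket_le {a p s r s₁ r₁ δ : ℝ} {A B : ℝ≥0∞} (hs : 0 < s) (hr : 0 < r)
    (hs₁ : 0 < s₁) (hr₁ : 0 < r₁) (hδ : 0 < δ)
    (h1 : s₁ + s * δ ≤ s) (h2 : r₁ + r * δ ≤ r) (h3 : s ≤ 2 * s₁) (h4 : r ≤ 2 * r₁)
    {P Q : Idx js → ℝ≥0∞} (hA : A ≠ 0) (hA' : A ≠ ∞) (hB : B ≠ 0) (hB' : B ≠ ∞)
    (hP : mNorm a p s r P ≤ A) (hQ : mNorm a p s r Q ≤ B) :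
    mNorm a p s₁ r₁ (majBracket P Q) ≤ ENNReal.ofReal (8 * δ⁻¹) * A * B := by
  refine iSup₂_le fun X hX => ?_
  have hss : s₁ ≤ s := by nlinarith
  have hrr : r₁ ≤ r := by nlinarith
  have hδ0 : ENNReal.ofReal δ ≠ 0 := by simpa using hδ
  have main : ∀ {P Q : Idx js → ℝ≥0∞} {A B : ℝ≥0∞}, B ≠ 0 → B ≠ ∞ → mNorm a p s r P ≤ A →
      mNorm a p s r Q ≤ B →
      vecNorm a p s r (fun w => ∑' v, mSum s₁ (dM v (dM (conjV w) P)) X * majVF s₁ Q X v) ≤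
        ENNReal.ofReal δ⁻¹ * A * B := by
    intro P Q A B hB hB' hP hQ
    set ε := ENNReal.ofReal δ / B with hε
    have hε0 : ε ≠ 0 := (ENNReal.div_pos hδ0 hB').ne'
    have hε' : ε ≠ ∞ := ENNReal.div_ne_top ENNReal.ofReal_ne_top hB
    have hU : vecNorm a p s r (majVF s₁ Q X) ≤ B :=
      ((vecNorm_mono (majVF_mono hss le_rfl)).trans
        (le_mNorm Q (ball_mono hr₁.le hrr le_rfl hX))).trans hQ
    obtain ⟨hx, hb⟩ := ball_add_mul hs hr hr₁ hδ.le h1 h2 hX hU (ε := ε)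
      (by rw [hε, ENNReal.div_mul_cancel hB hB'])
    have hle : (fun w => ∑' v, mSum s₁ (dM v (dM (conjV w) P)) X * majVF s₁ Q X v) ≤
        fun w => ε⁻¹ * majVF s P (fun c => X c + ε * majVF s₁ Q X (Sum.inr c)) w := by
      intro w
      have h := tsum_mSum_dM_mul_le (dM (conjV w) P) X (fun v => ε * majVF s₁ Q X v) hss hx
      simp only [mul_left_comm _ ε, ENNReal.tsum_mul_left] at h
      calc _ = ε⁻¹ * (ε * ∑' v, mSum s₁ (dM v (dM (conjV w) P)) X * majVF s₁ Q X v) := by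
            rw [← mul_assoc, ENNReal.inv_mul_cancel hε0 hε', one_mul]
        _ ≤ _ := mul_le_mul' le_rfl h
    refine (vecNorm_mono hle).trans ?_
    rw [vecNorm_const_mul]
    have hinv : ε⁻¹ = ENNReal.ofReal δ⁻¹ * B := by
      rw [hε, ENNReal.inv_div (Or.inl hB') (Or.inl hB), ENNReal.ofReal_inv_of_pos hδ,
        div_eq_mul_inv, mul_comm]
    calc _ ≤ ε⁻¹ * A := mul_le_mul' le_rfl ((le_mNorm P hb).trans hP)
      _ = _ := by rw [hinv]; ring
  calc vecNorm a p s₁ r₁ (majVF s₁ (majBracket P Q) X)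
      ≤ ENNReal.ofReal 4 * vecNorm a p s r (majVF s₁ (majBracket P Q) X) :=
        vecNorm_le_mul hs hr hs₁ hr₁ (by linarith) (by linarith) (by nlinarith) _
    _ ≤ ENNReal.ofReal 4 * (ENNReal.ofReal δ⁻¹ * A * B + ENNReal.ofReal δ⁻¹ * B * A) := by
        gcongr
        refine (vecNorm_mono fun w => majVF_majBracket_le hs₁.le P Q X w).trans ?_
        exact (vecNorm_add_le _ _ _ _ _ _).trans (add_le_add (main hB hB' hP hQ)
          (main hA hA' hQ hP))
    _ = ENNReal.ofReal (8 * δ⁻¹) * A * B := by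
        rw [ENNReal.ofReal_mul (by norm_num), show (8 : ℝ) = 4 * 2 by norm_num,
          ENNReal.ofReal_mul (by norm_num), ENNReal.ofReal_ofNat 2]
        ring

/-! ### The Poisson bracket of series -/

lemma Idx.expo_prod {M : Type*} [CommMonoid M] (q : Idx js) (X : Coord js → M) :
    q.expo.prod (fun c e => X c ^ e) = (∏ h, X (Sum.inl h) ^ q.i h) *
      ∏ σ, (q.γ σ).prod fun j e => X (Sum.inr (σ, j)) ^ e := by
  rw [Idx.expo, Finsupp.prod_sumElim]
  congr 1
  · exact Finsupp.prod_fintype _ _ fun _ => pow_zero _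
  · have h := Finsupp.sum_uncurry_index (N := Additive M) (Finsupp.equivFunOnFinite.symm q.γ)
      (fun c e => Additive.ofMul (X (Sum.inr c) ^ e))
    have h' : (Finsupp.equivFunOnFinite.symm q.γ).sum
        (fun σ (f : Site js →₀ ℕ) => f.sum fun j e => Additive.ofMul (X (Sum.inr (σ, j)) ^ e)) =
        ∑ σ, (q.γ σ).sum fun j e => Additive.ofMul (X (Sum.inr (σ, j)) ^ e) :=
      Finsupp.sum_fintype _ _ fun _ => Finsupp.sum_zero_index
    exact h.trans h'

/-- The moduli of the coefficients of a series. -/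
def maj (f : Series js) : Idx js → ℝ≥0∞ := fun q => ‖f q‖ₑ

/-- The moduli of the coordinates of a point. -/
def modulus (y : Fin n → ℂ) (z : ℤˣ → Site js → ℂ) : Coord js → ℝ≥0∞ :=
  Sum.elim (fun h => ‖y h‖ₑ) fun c => ‖z c.1 c.2‖ₑ

lemma majorantSum_eq (s : ℝ) (f : Series js) (y : Fin n → ℂ) (z : ℤˣ → Site js → ℂ) :
    majorantSum s f y z = mSum s (maj f) (modulus y z) := by
  refine tsum_congr fun q => ?_
  rw [wt, Idx.expo_prod]
  simp only [maj, modulus, Sum.elim_inl, Sum.elim_inr]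
  ring

lemma actionBall_iff {a p r : ℝ} {y : Fin n → ℂ} {z : ℤˣ → Site js → ℂ} :
    ActionBall a p r y z ↔ ball a p r (modulus y z) := by
  unfold ActionBall ball
  simp only [modulus, Sum.elim_inl, Sum.elim_inr]
  refine and_congr_left fun _ => ?_
  have : ∑ h, ‖y h‖ₑ = ENNReal.ofReal (∑ h, ‖y h‖) := by
    rw [ENNReal.ofReal_sum_of_nonneg fun _ _ => norm_nonneg _]
    simp
  rw [this, ENNReal.ofReal_lt_ofReal_iff_of_nonneg (Finset.sum_nonneg fun _ _ => norm_nonneg _)]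

/-- The factor that the derivative `∂_v` produces. -/
def cCoef : Var js → Idx js → ℂ
  | Sum.inl h, q => Complex.I * (q.k h : ℂ)
  | Sum.inr c, q => (q.expo c : ℂ) + 1

/-- The term by term derivative `∂_v` of a series. -/
def der (v : Var js) (f : Series js) : Series js := fun q => cCoef v q * f (q + unit v)

lemma enorm_cCoef (v : Var js) (q : Idx js) : ‖cCoef v q‖ₑ = derCoef v q := by
  rcases v with h | c
  · simp only [cCoef, derCoef, enorm_mul]
    rw [← ofReal_norm, ← ofReal_norm, Complex.norm_I, Complex.norm_intCast, ENNReal.ofReal_one,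
      one_mul, ← Int.cast_abs, Int.abs_eq_natAbs, Int.cast_natCast, ENNReal.ofReal_natCast]
  · simp only [cCoef, derCoef]
    rw [← Nat.cast_one, ← Nat.cast_add, ← ofReal_norm, Complex.norm_natCast,
      ENNReal.ofReal_natCast]

lemma maj_der (v : Var js) (f : Series js) : maj (der v f) = dM v (maj f) := by
  funext q; simp [maj, der, dM, enorm_cCoef]

lemma dX_eq (f : Series js) (h : Fin n) : f.dX h = der (Sum.inl h) f := by
  funext q; simp [Series.dX, der, cCoef]

lemma dY_eq (f : Series js) (h : Fin n) : f.dY h = der (Sum.inr (Sum.inl h)) f := by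
  funext q
  simp only [Series.dY, der, cCoef, Idx.expo_inl]
  congr 2
  exact Idx.ext (by simp) (by simp [unit]) (by simp [unit])

lemma dZ_eq (f : Series js) (σ : ℤˣ) (j : Site js) :
    f.dZ σ j = der (Sum.inr (Sum.inr (σ, j))) f := by
  funext q
  simp only [Series.dZ, der, cCoef, Idx.expo_inr]
  congr 2
  exact Idx.ext (by simp) (by simp [unit]) (by simp [unit])

lemma enorm_unit (σ : ℤˣ) : ‖((σ : ℤ) : ℂ)‖ₑ = 1 := by
  rcases Int.units_eq_one_or σ with h | h <;> simp [h]

lemma enorm_I : ‖Complex.I‖ₑ = 1 := by rw [← ofReal_norm]; simp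

lemma wNorm_apply_ne_top {a p : ℝ} {u : Site js → ℝ≥0∞} (hu : wNorm a p u ≠ ∞) (j : Site js) :
    u j ≠ ∞ := by
  intro htop
  unfold wNorm at hu
  have h1 := ((ENNReal.rpow_lt_top_iff_of_pos (by norm_num)).1 hu.lt_top).ne
  refine ENNReal.ne_top_of_tsum_ne_top h1 j ?_
  rw [htop, ENNReal.top_pow (by norm_num), ENNReal.top_mul]
  simp only [ne_eq, ENNReal.ofReal_eq_zero, not_le]
  positivity

/-- The supremum over complex points is one over their moduli, as the points with nonnegative real
coordinates already attain all of them. -/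
lemma majorantNorm_hamVF (a p s r : ℝ) (f : Series js) :
    (hamVF f).majorantNorm a p s r = mNorm a p s r (maj f) := by
  have key : ∀ y z, (⨆ h, majorantSum s ((hamVF f).x h) y z) / ENNReal.ofReal s +
      (∑ h, majorantSum s ((hamVF f).y h) y z) / ENNReal.ofReal (r ^ 2) +
      ∑ σ, wNorm a p (fun j => majorantSum s ((hamVF f).z σ j) y z) / ENNReal.ofReal r =
      vecNorm a p s r (majVF s (maj f) (modulus y z)) := by
    intro y z
    have hy : ∀ h, maj (fun q => -f.dX h q) = dM (Sum.inl h) (maj f) := by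
      intro h
      rw [← maj_der, ← dX_eq]
      funext q
      simp [maj]
    have hz : ∀ (σ : ℤˣ) j, maj (fun q => -((σ : ℤ) : ℂ) * Complex.I * f.dZ (-σ) j q) =
        dM (Sum.inr (Sum.inr (-σ, j))) (maj f) := by
      intro σ j
      rw [← maj_der, ← dZ_eq]
      funext q
      simp only [maj, enorm_mul, enorm_neg, enorm_unit, enorm_I, one_mul]
    simp only [vecNorm, majVF, majorantSum_eq, hamVF, dY_eq, maj_der, hy, hz, conjV]
  unfold VectorField.majorantNorm mNorm
  simp only [key]
  refine le_antisymm (iSup_le fun y => iSup_le fun z => iSup_le fun h =>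
    le_iSup₂_of_le _ (actionBall_iff.1 h) le_rfl) (iSup₂_le fun X hX => ?_)
  have hfin : ∀ c, X c ≠ ∞ := by
    rintro (h | ⟨σ, j⟩)
    · exact ((Finset.single_le_sum (f := fun h => X (Sum.inl h)) (fun _ _ => zero_le)
        (Finset.mem_univ h)).trans_lt (hX.1.trans ENNReal.ofReal_lt_top)).ne
    · exact wNorm_apply_ne_top ((hX.2 σ).trans ENNReal.ofReal_lt_top).ne j
  have hmod : modulus (fun h => ((X (Sum.inl h)).toReal : ℂ))
      (fun σ j => ((X (Sum.inr (σ, j))).toReal : ℂ)) = X := by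
    funext c
    rcases c with h | ⟨σ, j⟩ <;>
    · simp only [modulus, Sum.elim_inl, Sum.elim_inr]
      rw [← ofReal_norm, Complex.norm_real, Real.norm_of_nonneg ENNReal.toReal_nonneg,
        ENNReal.ofReal_toReal (hfin _)]
  refine le_iSup_of_le (fun h => ((X (Sum.inl h)).toReal : ℂ)) (le_iSup_of_le
    (fun σ j => ((X (Sum.inr (σ, j))).toReal : ℂ)) (le_iSup_of_le ?_ ?_))
  · rw [actionBall_iff, hmod]; exact hX
  · rw [hmod]

/-- The factor, of modulus `1`, with which `∂_v f ∂_{v̄} g` enters the Poisson bracket. -/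
def poissonSign : Var js → ℂ
  | Sum.inl _ => 1
  | Sum.inr (Sum.inl _) => -1
  | Sum.inr (Sum.inr c) => Complex.I * ((c.1 : ℤ) : ℂ)

lemma enorm_poissonSign (v : Var js) : ‖poissonSign v‖ₑ = 1 := by
  rcases v with h | h | c <;> simp [poissonSign, enorm_unit, enorm_I]

/-- The contribution to the Poisson bracket of a pair of monomials and a pair of conjugate
coordinates. -/
def bracketCoef (f g : Series js) (p : Idx js × Idx js) (v : Var js) : ℂ :=
  poissonSign v * der v f p.1 * der (conjV v) g p.2

/-- The Poisson bracket of two series. -/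
def bracket (f g : Series js) : Series js :=
  fun q => ∑' t : Fib q × Var js, bracketCoef f g t.1.1 t.2

lemma enorm_bracketCoef (f g : Series js) (p : Idx js × Idx js) (v : Var js) :
    ‖bracketCoef f g p v‖ₑ = dM v (maj f) p.1 * dM (conjV v) (maj g) p.2 := by
  simp only [bracketCoef, enorm_mul, enorm_poissonSign, one_mul, ← maj_der, maj]

lemma tsum_enorm_bracketCoef (f g : Series js) (q : Idx js) :
    ∑' t : Fib q × Var js, ‖bracketCoef f g t.1.1 t.2‖ₑ = majBracket (maj f) (maj g) q := by
  rw [ENNReal.tsum_prod (f := fun (p : Fib q) v => ‖bracketCoef f g p.1 v‖ₑ), ENNReal.tsum_comm]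
  simp only [enorm_bracketCoef, majBracket, conv]

lemma enorm_tsum_le {ι : Type*} (f : ι → ℂ) : ‖∑' i, f i‖ₑ ≤ ∑' i, ‖f i‖ₑ := by
  by_cases h : Summable f
  · exact h.hasSum.enorm_le_of_bounded ENNReal.summable.hasSum fun _ => le_rfl
  · simp [tsum_eq_zero_of_not_summable h]

lemma maj_bracket_le (f g : Series js) : maj (bracket f g) ≤ majBracket (maj f) (maj g) :=
  fun q => (enorm_tsum_le _).trans (tsum_enorm_bracketCoef f g q).le

/-- Two series whose Poisson bracket converges absolutely, coefficient by coefficient. -/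
def Bracketable (f g : Series js) : Prop := ∀ q, majBracket (maj f) (maj g) q ≠ ∞

lemma summable_of_tsum_enorm_ne_top {ι : Type*} {f : ι → ℂ} (h : ∑' i, ‖f i‖ₑ ≠ ∞) :
    Summable f := by
  have h2 : Summable fun i => ‖f i‖₊ := ENNReal.tsum_coe_ne_top_iff_summable.1 h
  exact Summable.of_nnnorm h2

lemma Bracketable.summable {f g : Series js} (h : Bracketable f g) (q : Idx js) :
    Summable fun t : Fib q × Var js => bracketCoef f g t.1.1 t.2 :=
  summable_of_tsum_enorm_ne_top (by rw [tsum_enorm_bracketCoef]; exact h q)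

lemma der_sub (v : Var js) (f g : Series js) : der v (f - g) = der v f - der v g := by
  funext q; simp [der, mul_sub]

lemma der_const_mul (v : Var js) (c : ℂ) (f : Series js) :
    der v (fun q => c * f q) = fun q => c * der v f q := by
  funext q; simp only [der]; ring

/-- The bracket is bilinear; this is the resulting expansion of the difference of two brackets. -/
lemma const_mul_bracket_sub {f g f' g' : Series js} (h : Bracketable f g) (h' : Bracketable f' g')
    (h1 : Bracketable (f - f') g) (h2 : Bracketable f' (g - g')) (c : ℂ) (q : Idx js) :
    c * (bracket f g q - bracket f' g' q) =
      bracket (fun q => c * (f - f') q) g q + bracket f' (fun q => c * (g - g') q) q := by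
  have e1 : ∀ t : Fib q × Var js, bracketCoef (fun q => c * (f - f') q) g t.1.1 t.2 =
      c * bracketCoef (f - f') g t.1.1 t.2 := by
    intro t; simp only [bracketCoef, der_const_mul]; ring
  have e2 : ∀ t : Fib q × Var js, bracketCoef f' (fun q => c * (g - g') q) t.1.1 t.2 =
      c * bracketCoef f' (g - g') t.1.1 t.2 := by
    intro t; simp only [bracketCoef, der_const_mul]; ring
  simp only [bracket, e1, e2, tsum_mul_left]
  rw [← mul_add, ← (h.summable q).tsum_sub (h'.summable q),
    ← (h1.summable q).tsum_add (h2.summable q)]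
  congr 1
  refine tsum_congr fun t => ?_
  simp only [bracketCoef, der_sub, Pi.sub_apply]
  ring

section Finiteness

variable {a p s r : ℝ}

lemma exists_ball_lt {X : Coord js → ℝ≥0∞} (hr : 0 < r) (hX : ball a p r X) :
    ∃ r', 0 < r' ∧ r' < r ∧ ball a p r' X := by
  have h1 : ∀ᶠ t in nhds r, ∑ h, X (Sum.inl h) < ENNReal.ofReal (t ^ 2) :=
    (ENNReal.continuous_ofReal.comp (continuous_pow 2)).continuousAt.eventually_const_lt hX.1
  have h2 : ∀ᶠ t in nhds r, ∀ σ, wNorm a p (fun j => X (Sum.inr (σ, j))) < ENNReal.ofReal t :=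
    Filter.eventually_all.2 fun σ =>
      ENNReal.continuous_ofReal.continuousAt.eventually_const_lt (hX.2 σ)
  have h3 := ((h1.and h2).and (eventually_gt_nhds hr)).filter_mono
    (nhdsWithin_le_nhds (s := Set.Iio r))
  obtain ⟨t, ht, htr⟩ := (h3.and self_mem_nhdsWithin).exists
  exact ⟨t, ht.2, htr, ht.1⟩

lemma ball_add {r₁ r₂ : ℝ} (h₁ : 0 ≤ r₁) (h₂ : 0 ≤ r₂) {X Y : Coord js → ℝ≥0∞}
    (hX : ball a p r₁ X) (hY : ball a p r₂ Y) : ball a p (r₁ + r₂) fun c => X c + Y c := by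
  refine ⟨?_, fun σ => (wNorm_add_le _ _ _ _).trans_lt ?_⟩
  · rw [Finset.sum_add_distrib]
    calc _ < ENNReal.ofReal (r₁ ^ 2) + ENNReal.ofReal (r₂ ^ 2) :=
          ENNReal.add_lt_add hX.1 hY.1
      _ = ENNReal.ofReal (r₁ ^ 2 + r₂ ^ 2) :=
          (ENNReal.ofReal_add (by positivity) (by positivity)).symm
      _ ≤ _ := ENNReal.ofReal_le_ofReal (by nlinarith)
  · rw [ENNReal.ofReal_add h₁ h₂]
    exact ENNReal.add_lt_add (hX.2 σ) (hY.2 σ)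

open Classical in
/-- The sequence of moduli that is `η` on the finite set `S` of coordinates and `0` elsewhere. -/
def bump (S : Finset (Coord js)) (η : ℝ≥0∞) (c : Coord js) : ℝ≥0∞ := if c ∈ S then η else 0

/-- Small sequences with given finite support lie in every ball. -/
lemma exists_ball_bump (a p : ℝ) (S : Finset (Coord js)) {ρ : ℝ} (hρ : 0 < ρ) :
    ∃ η : ℝ, 0 < η ∧ ball a p ρ (bump S (ENNReal.ofReal η)) := by
  classical
  have hw : ∀ σ, wNorm a p (fun j => bump S 1 (Sum.inr (σ, j))) ≠ ∞ := by
    intro σ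
    unfold wNorm
    refine ENNReal.rpow_ne_top_of_nonneg (by norm_num) ?_
    have hinj : Function.Injective fun j : Site js => (Sum.inr (σ, j) : Coord js) := by
      intro j j' h
      simpa using h
    rw [tsum_eq_sum (s := S.preimage _ hinj.injOn)]
    · refine (ENNReal.sum_lt_top.2 fun j _ => ENNReal.mul_lt_top ?_ ENNReal.ofReal_lt_top).ne
      simp only [bump]
      split_ifs <;> simp
    · intro j hj
      have : (Sum.inr (σ, j) : Coord js) ∉ S := by simpa using hj
      simp [bump, this]
  set M : ℝ≥0∞ := ∑ h, bump S 1 (Sum.inl h) + ∑ σ, wNorm a p (fun j => bump S 1 (Sum.inr (σ, j)))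
    with hM
  have hMtop : M ≠ ∞ := by
    refine ENNReal.add_ne_top.2 ⟨(ENNReal.sum_lt_top.2 fun h _ => ?_).ne,
      (ENNReal.sum_lt_top.2 fun σ _ => (hw σ).lt_top).ne⟩
    unfold bump
    split_ifs <;> simp
  set m := min ρ (ρ ^ 2) with hm
  have hm0 : 0 < m := lt_min hρ (by positivity)
  have hM1 : 0 < M.toReal + 1 := by positivity
  refine ⟨m / (M.toReal + 1), by positivity, ?_⟩
  set η := m / (M.toReal + 1)
  have hη : 0 < η := by positivity
  have hlt : ENNReal.ofReal η * M < ENNReal.ofReal m := by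
    rw [← ENNReal.ofReal_toReal hMtop, ← ENNReal.ofReal_mul hη.le,
      ENNReal.ofReal_lt_ofReal_iff hm0]
    calc η * M.toReal < η * (M.toReal + 1) := by nlinarith
      _ = m := by simp only [η]; field_simp
  have hb : ∀ c, bump S (ENNReal.ofReal η) c = ENNReal.ofReal η * bump S 1 c := by
    intro c; simp [bump]
  simp only [ball, hb]
  refine ⟨?_, fun σ => ?_⟩
  · rw [← Finset.mul_sum]
    calc _ ≤ ENNReal.ofReal η * M := by gcongr; exact le_self_add
      _ < _ := hlt
      _ ≤ _ := ENNReal.ofReal_le_ofReal (min_le_right _ _)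
  · rw [wNorm_const_mul]
    calc _ ≤ ENNReal.ofReal η * M := by
          gcongr
          exact (Finset.single_le_sum (f := fun σ => wNorm a p (fun j => bump S 1 (Sum.inr (σ, j))))
            (fun _ _ => zero_le) (Finset.mem_univ σ)).trans le_add_self
      _ < _ := hlt
      _ ≤ _ := ENNReal.ofReal_le_ofReal (min_le_left _ _)

lemma vecNorm_ne_top {U : Var js → ℝ≥0∞} (hU : vecNorm a p s r U ≠ ∞) :
    (∀ h, U (Sum.inl h) ≠ ∞) ∧ (∀ h, U (Sum.inr (Sum.inl h)) ≠ ∞) ∧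
      ∀ σ, wNorm a p (fun j => U (Sum.inr (Sum.inr (σ, j)))) ≠ ∞ := by
  have key : ∀ {x : ℝ≥0∞} {t : ℝ}, x / ENNReal.ofReal t ≠ ∞ → x ≠ ∞ := by
    intro x t h hx
    rw [hx] at h
    exact h (ENNReal.top_div_of_ne_top ENNReal.ofReal_ne_top)
  unfold vecNorm at hU
  rw [ENNReal.add_ne_top, ENNReal.add_ne_top] at hU
  obtain ⟨⟨h1, h2⟩, h3⟩ := hU
  refine ⟨fun h => ne_top_of_le_ne_top (key h1) (le_iSup (fun h => U (Sum.inl h)) h),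
    fun h => ne_top_of_le_ne_top (key h2) (Finset.single_le_sum
      (f := fun h => U (Sum.inr (Sum.inl h))) (fun _ _ => zero_le) (Finset.mem_univ h)),
    fun σ => key (ENNReal.sum_ne_top.1 h3 σ (Finset.mem_univ _))⟩

lemma tsum_sq_ne_top (ha : 0 ≤ a) (hp : 0 ≤ p) {u : Site js → ℝ≥0∞} (hu : wNorm a p u ≠ ∞) :
    ∑' j, u j ^ 2 ≠ ∞ := by
  unfold wNorm at hu
  have h1 := ((ENNReal.rpow_lt_top_iff_of_pos (by norm_num)).1 hu.lt_top).ne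
  refine ne_top_of_le_ne_top h1 (ENNReal.tsum_le_tsum fun j => ?_)
  refine le_mul_of_one_le_right zero_le ?_
  rw [ENNReal.one_le_ofReal]
  have e1 : 1 ≤ Real.exp (2 * a * |((j : ℤ) : ℝ)|) := Real.one_le_exp (by positivity)
  have e2 : 1 ≤ (max 1 |((j : ℤ) : ℝ)|) ^ (2 * p) :=
    Real.one_le_rpow (le_max_left _ _) (by positivity)
  nlinarith

/-- The components of two vector fields can be paired: the weights of `‖·‖_{a,p}` are at least
`1`. -/
lemma tsum_conj_mul_ne_top (ha : 0 ≤ a) (hp : 0 ≤ p) {U V : Var js → ℝ≥0∞}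
    (hU : vecNorm a p s r U ≠ ∞) (hV : vecNorm a p s r V ≠ ∞) :
    ∑' v, U (conjV v) * V v ≠ ∞ := by
  obtain ⟨u1, u2, u3⟩ := vecNorm_ne_top hU
  obtain ⟨v1, v2, v3⟩ := vecNorm_ne_top hV
  rw [Summable.tsum_sum ENNReal.summable ENNReal.summable,
    Summable.tsum_sum ENNReal.summable ENNReal.summable, tsum_fintype, tsum_fintype]
  refine ENNReal.add_ne_top.2 ⟨?_, ENNReal.add_ne_top.2 ⟨?_, ?_⟩⟩
  · exact ENNReal.sum_ne_top.2 fun h _ => ENNReal.mul_ne_top (u2 h) (v1 h)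
  · exact ENNReal.sum_ne_top.2 fun h _ => ENNReal.mul_ne_top (u1 h) (v2 h)
  · rw [ENNReal.tsum_prod', tsum_fintype]
    refine ENNReal.sum_ne_top.2 fun σ _ => ?_
    refine ne_top_of_le_ne_top (ENNReal.add_ne_top.2 ⟨tsum_sq_ne_top ha hp (u3 (-σ)),
      tsum_sq_ne_top ha hp (v3 σ)⟩) ?_
    rw [← ENNReal.tsum_add]
    refine ENNReal.tsum_le_tsum fun j => ?_
    simp only [conjV]
    set x := U (Sum.inr (Sum.inr (-σ, j)))
    set y := V (Sum.inr (Sum.inr (σ, j)))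
    rcases le_total x y with h | h
    · exact (mul_le_mul' h le_rfl).trans (by rw [sq y]; exact le_add_self)
    · exact (mul_le_mul' le_rfl h).trans (by rw [sq x]; exact le_self_add)

lemma tsum_mSum_mul_mSum_ne_top (ha : 0 ≤ a) (hp : 0 ≤ p) {P Q : Idx js → ℝ≥0∞}
    (hP : mNorm a p s r P ≠ ∞) (hQ : mNorm a p s r Q ≠ ∞) {X : Coord js → ℝ≥0∞}
    (hX : ball a p r X) : ∑' v, mSum s (dM v P) X * mSum s (dM (conjV v) Q) X ≠ ∞ := by
  have h := tsum_conj_mul_ne_top ha hp (ne_top_of_le_ne_top hP (le_mNorm P hX))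
    (ne_top_of_le_ne_top hQ (le_mNorm Q hX))
  simpa only [majVF, conjV_conjV] using h

lemma mSum_dM_ne_top {P : Idx js → ℝ≥0∞} (hP : mNorm a p s r P ≠ ∞)
    {X : Coord js → ℝ≥0∞} (hX : ball a p r X) (v : Var js) : mSum s (dM v P) X ≠ ∞ := by
  obtain ⟨h1, h2, h3⟩ := vecNorm_ne_top (ne_top_of_le_ne_top hP (le_mNorm P hX))
  rcases v with h | h | ⟨σ, j⟩
  · exact h2 h
  · exact h1 h
  · have h := wNorm_apply_ne_top (h3 (-σ)) j
    simpa only [majVF, conjV, neg_neg] using h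

lemma mSum_majBracket_le (hs : 0 ≤ s) (P Q : Idx js → ℝ≥0∞) (X : Coord js → ℝ≥0∞) :
    mSum s (majBracket P Q) X ≤ ∑' v, mSum s (dM v P) X * mSum s (dM (conjV v) Q) X := by
  unfold majBracket
  rw [mSum_tsum]
  exact ENNReal.tsum_le_tsum fun v => mSum_conv_le _ hs _ _ _

/-- Finite norms give a convergent bracket, as is seen at one point of the ball at which all the
coordinates that occur in the given monomial are nonzero. -/
lemma bracketable_of_mNorm (ha : 0 ≤ a) (hp : 0 ≤ p) (hs : 0 ≤ s) (hr : 0 < r) {f g : Series js}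
    (hf : mNorm a p s r (maj f) ≠ ∞) (hg : mNorm a p s r (maj g) ≠ ∞) : Bracketable f g := by
  classical
  intro q
  obtain ⟨η, hη, hb⟩ := exists_ball_bump a p q.expo.support hr
  have h1 := ne_top_of_le_ne_top (tsum_mSum_mul_mSum_ne_top ha hp hf hg hb)
    (mSum_majBracket_le hs _ _ _)
  have h2 := ENNReal.ne_top_of_tsum_ne_top h1 q
  intro htop
  refine h2 ?_
  rw [htop, ENNReal.top_mul]
  refine mul_ne_zero (by simpa using Real.exp_pos _) (Finset.prod_ne_zero_iff.2 fun c hc => ?_)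
  simp only [bump, hc, if_true]
  exact pow_ne_zero _ (by simpa using hη)

end Finiteness

/-! ### Derivatives and the bracket of sums of series -/

/-- The coordinates of a point other than the angles. -/
def Point.val (v : Point js) : Coord js → ℂ := Sum.elim v.y fun c => v.z c.1 c.2

/-- Replacement of one coordinate of a point. -/
def Point.upd (v : Point js) : Var js → ℂ → Point js
  | Sum.inl h, t => { v with x := Function.update v.x h t }
  | Sum.inr (Sum.inl h), t => { v with y := Function.update v.y h t }
  | Sum.inr (Sum.inr c), t =>
      { v with z := Function.update v.z c.1 (Function.update (v.z c.1) c.2 t) }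

/-- One coordinate of a point. -/
def Point.coord (v : Point js) : Var js → ℂ
  | Sum.inl h => v.x h
  | Sum.inr c => v.val c

/-- The partial derivative of a function along one coordinate. -/
def partialV (F : Point js → ℂ) (w : Var js) (v : Point js) : ℂ :=
  deriv (fun t => F (v.upd w t)) (v.coord w)

lemma Point.upd_inr_x (v : Point js) (c : Coord js) (t : ℂ) : (v.upd (Sum.inr c) t).x = v.x := by
  rcases c with h | c <;> rfl

lemma Point.upd_inl_val (v : Point js) (h : Fin n) (t : ℂ) :
    (v.upd (Sum.inl h) t).val = v.val := rfl

lemma Point.upd_inr_val (v : Point js) (c : Coord js) (t : ℂ) :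
    (v.upd (Sum.inr c) t).val = Function.update v.val c t := by
  rcases c with h | ⟨σ, j⟩
  · funext c'
    rcases c' with h' | c'
    · by_cases hh : h' = h
      · subst hh; simp [Point.upd, Point.val]
      · simp [Point.upd, Point.val, hh]
    · simp [Point.upd, Point.val]
  · funext c'
    rcases c' with h' | ⟨σ', j'⟩
    · simp [Point.upd, Point.val]
    · by_cases hσ : σ' = σ
      · subst hσ
        by_cases hj : j' = j
        · subst hj; simp [Point.upd, Point.val]
        · simp [Point.upd, Point.val, hj]
      · simp [Point.upd, Point.val, hσ]

lemma Point.upd_coord (v : Point js) (w : Var js) : v.upd w (v.coord w) = v := by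
  rcases w with h | h | ⟨σ, j⟩ <;> simp [Point.upd, Point.coord, Point.val]

lemma Idx.monomial_eq (q : Idx js) (v : Point js) :
    q.monomial v = Complex.exp (Complex.I * ∑ h, (q.k h : ℂ) * v.x h) *
      q.expo.prod fun c e => v.val c ^ e := by
  rw [Idx.expo_prod, Idx.monomial, mul_assoc]
  rfl

lemma Idx.monomial_add (p q : Idx js) (v : Point js) :
    (p + q).monomial v = p.monomial v * q.monomial v := by
  simp only [Idx.monomial_eq, Idx.expo_add]
  rw [Finsupp.prod_add_index' (fun _ => pow_zero _) fun _ _ _ => pow_add _ _ _]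
  have : ∑ h, ((p + q).k h : ℂ) * v.x h = ∑ h, (p.k h : ℂ) * v.x h + ∑ h, (q.k h : ℂ) * v.x h := by
    rw [← Finset.sum_add_distrib]
    exact Finset.sum_congr rfl fun h _ => by simp [add_mul]
  rw [this, mul_add, Complex.exp_add]
  ring

lemma modulus_eq (v : Point js) : modulus v.y v.z = fun c => ‖v.val c‖ₑ := by
  funext c
  rcases c with h | c <;> rfl

lemma mem_domain_iff {a p s r : ℝ} {v : Point js} : v ∈ domain js a p s r ↔
    (∀ h, |(v.x h).im| < s) ∧ ball a p r fun c => ‖v.val c‖ₑ := by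
  rw [← modulus_eq, ← actionBall_iff]
  rfl

lemma enorm_exp_le {s : ℝ} (k : Fin n → ℤ) {x : Fin n → ℂ} (hx : ∀ h, |(x h).im| ≤ s) :
    ‖Complex.exp (Complex.I * ∑ h, (k h : ℂ) * x h)‖ₑ ≤
      ENNReal.ofReal (Real.exp ((∑ h, |(k h : ℝ)|) * s)) := by
  rw [← ofReal_norm, Complex.norm_exp]
  refine ENNReal.ofReal_le_ofReal (Real.exp_le_exp.2 ?_)
  simp only [Complex.mul_re, Complex.I_re, zero_mul, Complex.I_im, one_mul, zero_sub,
    Complex.im_sum, Complex.mul_im, Complex.intCast_re, Complex.intCast_im, add_zero]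
  rw [← Finset.sum_neg_distrib, Finset.sum_mul]
  refine Finset.sum_le_sum fun h _ => ?_
  calc -((k h : ℝ) * (x h).im) ≤ |(k h : ℝ) * (x h).im| := neg_le_abs _
    _ = |(k h : ℝ)| * |(x h).im| := abs_mul _ _
    _ ≤ _ := mul_le_mul_of_nonneg_left (hx h) (abs_nonneg _)

lemma enorm_prod_le {X : Coord js → ℝ≥0∞} {u : Coord js → ℂ} (hu : ∀ c, ‖u c‖ₑ ≤ X c)
    (m : Coord js →₀ ℕ) : ‖m.prod fun c e => u c ^ e‖ₑ ≤ m.prod fun c e => X c ^ e := by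
  rw [Finsupp.prod, Finsupp.prod, ← ofReal_norm, norm_prod,
    ENNReal.ofReal_prod_of_nonneg fun _ _ => norm_nonneg _]
  refine Finset.prod_le_prod' fun c _ => ?_
  rw [ofReal_norm, enorm_pow]
  exact pow_le_pow_left' (hu c) _

lemma enorm_monomial_le {s : ℝ} {X : Coord js → ℝ≥0∞} {v : Point js}
    (hx : ∀ h, |(v.x h).im| ≤ s) (hX : ∀ c, ‖v.val c‖ₑ ≤ X c) (q : Idx js) :
    ‖q.monomial v‖ₑ ≤ wt s X q := by
  rw [Idx.monomial_eq, enorm_mul]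
  exact mul_le_mul' (enorm_exp_le _ hx) (enorm_prod_le hX _)

/-- The partial derivative `∂_w` of a monomial. -/
def dmon (w : Var js) (q : Idx js) (v : Point js) : ℂ :=
  match w with
  | Sum.inl h => Complex.I * (q.k h : ℂ) * q.monomial v
  | Sum.inr c => q.expo c * (Complex.exp (Complex.I * ∑ h, (q.k h : ℂ) * v.x h) *
      (q.expo - Finsupp.single c 1).prod fun c e => v.val c ^ e)

lemma enorm_dmon_le {s : ℝ} {X : Coord js → ℝ≥0∞} {v : Point js}
    (hx : ∀ h, |(v.x h).im| ≤ s) (hX : ∀ c, ‖v.val c‖ₑ ≤ X c) (w : Var js) (q : Idx js) :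
    ‖dmon w q v‖ₑ ≤ dwt w s X q := by
  rcases w with h | c
  · simp only [dmon, dwt]
    rw [enorm_mul]
    have : ‖Complex.I * (q.k h : ℂ)‖ₑ = ((q.k h).natAbs : ℝ≥0∞) := enorm_cCoef (Sum.inl h) q
    rw [this]
    exact mul_le_mul' le_rfl (enorm_monomial_le hx hX q)
  · simp only [dmon, dwt]
    rw [enorm_mul, enorm_mul]
    refine mul_le_mul' ?_ (mul_le_mul' (enorm_exp_le _ hx) (enorm_prod_le hX _))
    rw [← ofReal_norm, Complex.norm_natCast, ENNReal.ofReal_natCast]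

/-- Transposition: differentiating the monomials is differentiating the coefficients. -/
lemma tsum_mul_dmon (f : Series js) (w : Var js) (v : Point js) :
    ∑' q, f q * dmon w q v = ∑' q, der w f q * q.monomial v := by
  rcases w with h | c
  · refine tsum_congr fun q => ?_
    simp only [dmon, der, cCoef, unit_inl, add_zero]
    ring
  · rw [← Function.Injective.tsum_eq (g := fun q : Idx js => q + unit (Sum.inr c))
      (add_left_injective _)]
    · refine tsum_congr fun q => ?_
      simp only [dmon, der, cCoef, Idx.monomial_eq, Idx.expo_add, expo_unit, Idx.add_k, unit_k,
        add_zero, add_tsub_cancel_right, Finsupp.add_apply, Finsupp.single_eq_same]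
      push_cast
      ring
    · intro q hq
      refine exists_add_unit fun h0 => hq ?_
      simp [dmon, h0]

lemma hasDerivAt_monomial (q : Idx js) (w : Var js) (v : Point js) (t : ℂ) :
    HasDerivAt (fun t => q.monomial (v.upd w t)) (dmon w q (v.upd w t)) t := by
  rcases w with h | c
  · simp only [dmon, Idx.monomial_eq, Point.upd_inl_val]
    have h1 : ∀ t, ∑ l, (q.k l : ℂ) * (v.upd (Sum.inl h) t).x l =
        (q.k h : ℂ) * t + ∑ l ∈ Finset.univ.erase h, (q.k l : ℂ) * v.x l := by
      intro t
      rw [← Finset.add_sum_erase _ _ (Finset.mem_univ h)]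
      congr 1
      · simp [Point.upd]
      · refine Finset.sum_congr rfl fun l hl => ?_
        simp [Point.upd, Finset.ne_of_mem_erase hl]
    simp only [h1]
    have h2 := ((((hasDerivAt_id t).const_mul (q.k h : ℂ)).add_const
      (∑ l ∈ Finset.univ.erase h, (q.k l : ℂ) * v.x l)).const_mul Complex.I).cexp.mul_const
        (q.expo.prod fun c e => v.val c ^ e)
    refine h2.congr_deriv ?_
    simp only [id]
    ring
  · simp only [dmon, Idx.monomial_eq, Point.upd_inr_x, Point.upd_inr_val]
    have h1 : ∀ (m : Coord js →₀ ℕ) (t : ℂ), (m.prod fun d e => Function.update v.val c t d ^ e) =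
        t ^ m c * (m.erase c).prod fun d e => v.val d ^ e := by
      intro m t
      rw [← Finsupp.mul_prod_erase' m c _ fun _ => pow_zero _, Function.update_self]
      congr 1
      refine Finsupp.prod_congr fun d hd => ?_
      have : d ≠ c := by
        rintro rfl
        simp at hd
      rw [Function.update_of_ne this]
    have h2 : (q.expo - Finsupp.single c 1).erase c = q.expo.erase c := by
      ext d
      by_cases hd : d = c
      · subst hd; simp
      · simp [Finsupp.erase_ne hd, Ne.symm hd]
    simp only [h1, h2]
    have h3 := ((hasDerivAt_pow (q.expo c) t).mul_const
      ((q.expo.erase c).prod fun d e => v.val d ^ e)).const_mul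
        (Complex.exp (Complex.I * ∑ h, (q.k h : ℂ) * v.x h))
    refine h3.congr_deriv ?_
    simp only [Finsupp.tsub_apply, Finsupp.single_eq_same]
    ring

section

variable {a p s r : ℝ}

/-- Moving one coordinate a little, one remains in the domain, with uniform bounds. -/
lemma exists_upd_bound {v : Point js} (hr : 0 < r) (hv : v ∈ domain js a p s r) (w : Var js) :
    ∃ ρ > 0, ∃ X : Coord js → ℝ≥0∞, ball a p r X ∧ ∀ t ∈ Metric.ball (v.coord w) ρ,
      (∀ h, |((v.upd w t).x h).im| < s) ∧ ∀ c, ‖(v.upd w t).val c‖ₑ ≤ X c := by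
  classical
  obtain ⟨hx, hb⟩ := mem_domain_iff.1 hv
  rcases w with h | c
  · refine ⟨s - |(v.x h).im|, by linarith [hx h], _, hb, fun t ht => ⟨fun l => ?_, fun c => le_rfl⟩⟩
    by_cases hl : l = h
    · subst hl
      simp only [Point.upd, Function.update_self]
      rw [mem_ball_iff_norm] at ht
      have h1 := (Complex.abs_im_le_norm (t - v.x l)).trans_lt ht
      rw [Complex.sub_im] at h1
      have h2 := abs_sub_abs_le_abs_sub t.im (v.x l).im
      linarith
    · simpa [Point.upd, hl] using hx l
  · obtain ⟨r', hr', hlt, hb'⟩ := exists_ball_lt hr hb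
    obtain ⟨η, hη, hbη⟩ := exists_ball_bump a p {c} (sub_pos.2 hlt)
    have h1 := ball_add hr'.le (sub_pos.2 hlt).le hb' hbη
    rw [add_sub_cancel] at h1
    refine ⟨η, hη, _, h1, fun t ht => ⟨fun l => ?_, fun d => ?_⟩⟩
    · rw [Point.upd_inr_x]; exact hx l
    · rw [Point.upd_inr_val]
      by_cases hd : d = c
      · subst hd
        simp only [Function.update_self, bump, Finset.mem_singleton, if_true]
        rw [mem_ball_iff_norm] at ht
        calc ‖t‖ₑ = ‖v.val d + (t - v.val d)‖ₑ := by ring_nf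
          _ ≤ ‖v.val d‖ₑ + ‖t - v.val d‖ₑ := enorm_add_le _ _
          _ ≤ _ := by
            gcongr
            rw [← ofReal_norm]
            exact ENNReal.ofReal_le_ofReal ht.le
      · rw [Function.update_of_ne hd]
        exact le_self_add

lemma enorm_summable_of_le {f : Series js} {P F : Idx js → ℝ≥0∞} {G : Idx js → ℂ}
    (h : ∑' q, P q * F q ≠ ∞) (hf : maj f ≤ P) (hG : ∀ q, ‖G q‖ₑ ≤ F q) :
    Summable fun q => f q * G q := by
  refine summable_of_tsum_enorm_ne_top (ne_top_of_le_ne_top h (ENNReal.tsum_le_tsum fun q => ?_))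
  rw [enorm_mul]
  exact mul_le_mul' (hf q) (hG q)

lemma summable_der_mul_monomial {f : Series js} (hf : mNorm a p s r (maj f) ≠ ∞) {v : Point js}
    (hv : v ∈ domain js a p s r) (w : Var js) : Summable fun q => der w f q * q.monomial v := by
  obtain ⟨hx, hb⟩ := mem_domain_iff.1 hv
  exact enorm_summable_of_le (mSum_dM_ne_top hf hb w) (maj_der w f).le
    (enorm_monomial_le (fun h => (hx h).le) fun c => le_rfl)

/-- Expansions may be differentiated term by term. -/
lemma partialV_eq {F : Point js → ℂ} {f : Series js} (hr : 0 < r)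
    (hF : HasExpansion a p s r F f)
    (hf : mNorm a p s r (maj f) ≠ ∞) {v : Point js} (hv : v ∈ domain js a p s r) (w : Var js) :
    partialV F w v = ∑' q, der w f q * q.monomial v := by
  obtain ⟨ρ, hρ, X, hX, hbd⟩ := exists_upd_bound hr hv w
  have hdom : ∀ t ∈ Metric.ball (v.coord w) ρ, v.upd w t ∈ domain js a p s r := by
    intro t ht
    obtain ⟨h1, h2⟩ := hbd t ht
    rw [mem_domain_iff]
    exact ⟨h1, hX.1.trans_le' (Finset.sum_le_sum fun h _ => h2 _),
      fun σ => (hX.2 σ).trans_le' (wNorm_mono fun j => h2 _)⟩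
  have hfin : ∑' q, maj f q * dwt w s X q ≠ ∞ := by
    rw [← mSum_dM]; exact mSum_dM_ne_top hf hX w
  have hsum : Summable fun q => (maj f q * dwt w s X q).toReal :=
    ENNReal.summable_toReal hfin
  have hc : v.coord w ∈ Metric.ball (v.coord w) ρ := Metric.mem_ball_self hρ
  have key := hasDerivAt_tsum_of_isPreconnected (𝕜 := ℂ)
    (g := fun q t => f q * Idx.monomial q (v.upd w t))
    (g' := fun q t => f q * dmon w q (v.upd w t)) hsum Metric.isOpen_ball
    (convex_ball _ _).isPreconnected
    (fun q t _ => (hasDerivAt_monomial q w v t).const_mul (f q))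
    (fun q t ht => by
      obtain ⟨h1, h2⟩ := hbd t ht
      rw [← toReal_enorm]
      refine ENNReal.toReal_mono (ENNReal.ne_top_of_tsum_ne_top hfin q) ?_
      rw [enorm_mul]
      exact mul_le_mul' le_rfl (enorm_dmon_le (fun h => (h1 h).le) h2 w q))
    hc (hF _ (hdom _ hc)).summable hc
  rw [Point.upd_coord, tsum_mul_dmon] at key
  rw [partialV, ← key.deriv]
  refine Filter.EventuallyEq.deriv_eq ?_
  filter_upwards [Metric.ball_mem_nhds _ hρ] with t ht
  exact (hF _ (hdom t ht)).tsum_eq.symm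

/-- The terms of the Poisson bracket of two functions, indexed by all coordinates. -/
def bracketTermV (F G : Point js → ℂ) (v : Point js) (w : Var js) : ℂ :=
  poissonSign w * partialV F w v * partialV G (conjV w) v

lemma bracketTermV_inr_inr (F G : Point js → ℂ) (v : Point js) (c : ℤˣ × Site js) :
    bracketTermV F G v (Sum.inr (Sum.inr c)) = Complex.I * bracketTerm F G v c := by
  have h1 : partialV F (Sum.inr (Sum.inr c)) v = partialZ F c.1 c.2 v := rfl
  have h2 : partialV G (Sum.inr (Sum.inr (-c.1, c.2))) v = partialZ G (-c.1) c.2 v := rfl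
  simp only [bracketTermV, bracketTerm, poissonSign, conjV, h1, h2]
  ring

lemma poissonBracket_eq {F G : Point js → ℂ} {v : Point js} (h : Summable (bracketTermV F G v)) :
    poissonBracket F G v = ∑' w, bracketTermV F G v w := by
  have h1 : Summable (bracketTermV F G v ∘ Sum.inl) := h.comp_injective Sum.inl_injective
  have h2 : Summable (bracketTermV F G v ∘ Sum.inr) := h.comp_injective Sum.inr_injective
  have h3 : Summable ((bracketTermV F G v ∘ Sum.inr) ∘ Sum.inl) :=
    h2.comp_injective Sum.inl_injective
  have h4 : Summable ((bracketTermV F G v ∘ Sum.inr) ∘ Sum.inr) :=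
    h2.comp_injective Sum.inr_injective
  rw [Summable.tsum_sum h1 h2]
  have h5 := Summable.tsum_sum h3 h4
  simp only [Function.comp_apply] at h5
  rw [h5, tsum_fintype, tsum_fintype]
  simp only [bracketTermV_inr_inr, tsum_mul_left]
  rw [poissonBracket, Finset.sum_sub_distrib, ← add_assoc, sub_eq_add_neg,
    ← Finset.sum_neg_distrib]
  congr 2
  · refine Finset.sum_congr rfl fun h _ => ?_
    have e1 : partialV F (Sum.inl h) v = partialX F h v := rfl
    have e2 : partialV G (Sum.inr (Sum.inl h)) v = partialY G h v := rfl
    simp [bracketTermV, poissonSign, conjV, e1, e2]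
  · refine Finset.sum_congr rfl fun h _ => ?_
    have e1 : partialV G (Sum.inl h) v = partialX G h v := rfl
    have e2 : partialV F (Sum.inr (Sum.inl h)) v = partialY F h v := rfl
    simp only [bracketTermV, poissonSign, conjV, e1, e2]
    ring

/-- Both assertions follow from the absolute convergence of the family of all products of terms of
`∂_w F` and `∂_w̄ G`. -/
lemma summable_bracketTermV_and_hasSum {F G : Point js → ℂ} {f g : Series js}
    (ha : 0 ≤ a) (hp : 0 ≤ p) (hr : 0 < r)
    (hF : HasExpansion a p s r F f) (hG : HasExpansion a p s r G g)
    (hf : mNorm a p s r (maj f) ≠ ∞) (hg : mNorm a p s r (maj g) ≠ ∞)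
    {v : Point js} (hv : v ∈ domain js a p s r) :
    Summable (bracketTermV F G v) ∧
      HasSum (fun q => bracket f g q * q.monomial v) (∑' w, bracketTermV F G v w) := by
  obtain ⟨hx, hb⟩ := mem_domain_iff.1 hv
  set X : Coord js → ℝ≥0∞ := fun c => ‖v.val c‖ₑ
  -- the family of all products of a term of `∂_w F` and a term of `∂_w̄ G`
  set T : Var js × (Idx js × Idx js) → ℂ := fun t =>
    bracketCoef f g t.2 t.1 * (t.2.1 + t.2.2).monomial v with hT
  have hTs : Summable T := by
    refine summable_of_tsum_enorm_ne_top (ne_top_of_le_ne_top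
      (tsum_mSum_mul_mSum_ne_top ha hp hf hg hb) ?_)
    rw [ENNReal.tsum_prod']
    refine ENNReal.tsum_le_tsum fun w => ?_
    rw [ENNReal.tsum_prod', mSum, mSum, ← tsum_tsum_mul_mul]
    refine ENNReal.tsum_le_tsum fun q₁ => ENNReal.tsum_le_tsum fun q₂ => ?_
    rw [hT, enorm_mul, enorm_bracketCoef, Idx.monomial_add, enorm_mul]
    exact mul_le_mul' le_rfl (mul_le_mul' (enorm_monomial_le (fun h => (hx h).le)
      (fun c => le_rfl) _) (enorm_monomial_le (fun h => (hx h).le) (fun c => le_rfl) _))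
  have hinner : ∀ w, HasSum (fun t => T (w, t)) (bracketTermV F G v w) := by
    intro w
    have h1 := (summable_der_mul_monomial hf hv w).hasSum
    have h2 := (summable_der_mul_monomial hg hv (conjV w)).hasSum
    rw [← partialV_eq hr hF hf hv] at h1
    rw [← partialV_eq hr hG hg hv] at h2
    have h3 : Summable fun t => T (w, t) := hTs.comp_injective (Prod.mk_right_injective w)
    have h4 : ∀ t : Idx js × Idx js, T (w, t) = (poissonSign w * (der w f t.1 * t.1.monomial v)) *
        (der (conjV w) g t.2 * t.2.monomial v) := by
      intro t
      simp only [hT, bracketCoef, Idx.monomial_add]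
      ring
    have h5 := HasSum.mul (h1.mul_left (poissonSign w)) h2 (h3.congr h4)
    exact h5.congr_fun h4
  have htot : HasSum (bracketTermV F G v) (∑' t, T t) :=
    HasSum.prod_fiberwise (f := T) hTs.hasSum hinner
  refine ⟨htot.summable, ?_⟩
  rw [htot.tsum_eq]
  have hfib := HasSum.tsum_fiberwise (f := T) hTs.hasSum
    fun t : Var js × (Idx js × Idx js) => t.2.1 + t.2.2
  refine hfib.congr_fun fun q => ?_
  let e : (Fib q × Var js) ≃ ((fun t : Var js × (Idx js × Idx js) => t.2.1 + t.2.2) ⁻¹' {q}) :=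
    { toFun := fun t => ⟨(t.2, t.1.1), t.1.2⟩
      invFun := fun t => (⟨t.1.2, t.2⟩, t.1.1)
      left_inv := fun _ => rfl
      right_inv := fun _ => rfl }
  rw [← Equiv.tsum_eq e, bracket, ← tsum_mul_right]
  refine tsum_congr fun t => ?_
  change _ = bracketCoef f g t.1.1 t.2 * (t.1.1.1 + t.1.1.2).monomial v
  rw [t.1.2]

lemma hasExpansion_poissonBracket {F G : Point js → ℂ} {f g : Series js}
    (ha : 0 ≤ a) (hp : 0 ≤ p) (hr : 0 < r)
    (hF : HasExpansion a p s r F f) (hG : HasExpansion a p s r G g)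
    (hf : mNorm a p s r (maj f) ≠ ∞) (hg : mNorm a p s r (maj g) ≠ ∞) :
    HasExpansion a p s r (poissonBracket F G) (bracket f g) := by
  intro v hv
  obtain ⟨h1, h2⟩ := summable_bracketTermV_and_hasSum ha hp hr hF hG hf hg hv
  rwa [poissonBracket_eq h1]

lemma summable_bracketTerm {F G : Point js → ℂ} {f g : Series js}
    (ha : 0 ≤ a) (hp : 0 ≤ p) (hr : 0 < r)
    (hF : HasExpansion a p s r F f) (hG : HasExpansion a p s r G g)
    (hf : mNorm a p s r (maj f) ≠ ∞) (hg : mNorm a p s r (maj g) ≠ ∞)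
    {v : Point js} (hv : v ∈ domain js a p s r) : Summable (bracketTerm F G v) := by
  obtain ⟨h1, -⟩ := summable_bracketTermV_and_hasSum ha hp hr hF hG hf hg hv
  have h2 := (h1.comp_injective (Sum.inr_injective.comp Sum.inr_injective)).mul_left (-Complex.I)
  refine h2.congr fun c => ?_
  simp only [Function.comp_apply, bracketTermV_inr_inr]
  rw [← mul_assoc, neg_mul, Complex.I_mul_I]
  ring

lemma domain_mono {s₁ r₁ : ℝ} (hs : s₁ ≤ s) (hr₁ : 0 ≤ r₁) (hr : r₁ ≤ r) :
    domain js a p s₁ r₁ ⊆ domain js a p s r := by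
  intro v hv
  rw [mem_domain_iff] at hv ⊢
  exact ⟨fun h => (hv.1 h).trans_le hs, ball_mono hr₁ hr le_rfl hv.2⟩

end

/-! ### Uniqueness of expansions -/

lemma integral_exp_int (m : ℤ) :
    ∫ t in (0 : ℝ)..2 * Real.pi, Complex.exp (Complex.I * m * t) =
      if m = 0 then 2 * Real.pi else 0 := by
  split_ifs with h
  · subst h; simp
  · have hm : Complex.I * (m : ℂ) ≠ 0 := mul_ne_zero Complex.I_ne_zero (by exact_mod_cast h)
    rw [integral_exp_mul_complex hm]
    have : Complex.exp (Complex.I * m * ((2 * Real.pi : ℝ) : ℂ)) = 1 := by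
      rw [Complex.exp_eq_one_iff]
      exact ⟨m, by push_cast; ring⟩
    rw [this]
    simp

/-- An absolutely convergent trigonometric series that vanishes has vanishing coefficients. -/
lemma tsum_fiber_eq_zero {ι : Type*} [Countable ι] (A : ι → ℂ) (m : ι → ℤ)
    (hA : Summable A)
    (h : ∀ t : ℝ, ∑' q, A q * Complex.exp (Complex.I * m q * t) = 0) (m₀ : ℤ) :
    ∑' q, (if m q = m₀ then A q else 0) = 0 := by
  have hn : ∀ (k : ℤ) (t : ℝ), ‖Complex.exp (Complex.I * k * t)‖ = 1 := by
    intro k t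
    rw [Complex.norm_exp]
    simp
  have key := intervalIntegral.hasSum_integral_of_dominated_convergence (μ := MeasureTheory.volume)
    (a := 0) (b := 2 * Real.pi)
    (F := fun q (t : ℝ) => A q * Complex.exp (Complex.I * ((m q - m₀ : ℤ) : ℂ) * t))
    (f := fun _ => 0) (fun q _ => ‖A q‖)
    (fun q => by
      have : Continuous fun t : ℝ => A q * Complex.exp (Complex.I * ((m q - m₀ : ℤ) : ℂ) * t) := by
        fun_prop
      exact this.aestronglyMeasurable)
    (fun q => Filter.Eventually.of_forall fun t _ => by
      rw [norm_mul, hn, mul_one])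
    (Filter.Eventually.of_forall fun t _ => hA.norm)
    (by simp)
    (Filter.Eventually.of_forall fun t _ => by
      have hs : Summable fun q => A q * Complex.exp (Complex.I * m q * t) := by
        refine Summable.of_norm ?_
        simpa only [norm_mul, hn, mul_one] using hA.norm
      have h1 := hs.hasSum.mul_right (Complex.exp (-(Complex.I * m₀ * t)))
      rw [h t, zero_mul] at h1
      refine h1.congr_fun fun q => ?_
      rw [mul_assoc (A q) (Complex.exp _), ← Complex.exp_add]
      push_cast
      ring_nf)
  have h2 : ∀ q, ∫ t in (0 : ℝ)..2 * Real.pi,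
      A q * Complex.exp (Complex.I * ((m q - m₀ : ℤ) : ℂ) * t) =
        (2 * Real.pi) * if m q = m₀ then A q else 0 := by
    intro q
    rw [intervalIntegral.integral_const_mul, integral_exp_int]
    simp only [sub_eq_zero]
    split_ifs
    · push_cast; ring
    · simp
  simp only [h2] at key
  have h3 := key.tsum_eq
  rw [tsum_mul_left] at h3
  simpa [Real.pi_ne_zero] using h3

instance : Countable (Idx js) :=
  Function.Injective.countable (f := fun q : Idx js => (q.k, q.expo)) fun p q h => by
    simp only [Prod.mk.injEq] at h
    exact Idx.expo_ext h.1 h.2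

/-- The point with angles `φ` and moduli `ρ`. -/
def anglePoint (ρ : Coord js → ℝ) (φ : Var js → ℝ) : Point js where
  x h := φ (Sum.inl h)
  y h := ρ (Sum.inl h) * Complex.exp (Complex.I * φ (Sum.inr (Sum.inl h)))
  z σ j := ρ (Sum.inr (σ, j)) * Complex.exp (Complex.I * φ (Sum.inr (Sum.inr (σ, j))))

lemma anglePoint_val (ρ : Coord js → ℝ) (φ : Var js → ℝ) (c : Coord js) :
    (anglePoint ρ φ).val c = ρ c * Complex.exp (Complex.I * φ (Sum.inr c)) := by
  rcases c with h | c <;> rfl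

/-- The frequency of a monomial with respect to the angle of a coordinate. -/
def freq (q : Idx js) : Var js → ℤ
  | Sum.inl h => q.k h
  | Sum.inr c => q.expo c

/-- The phase of a monomial, as a function of all angles. -/
def phase (q : Idx js) (φ : Var js → ℝ) : ℝ :=
  ∑ h, q.k h * φ (Sum.inl h) + q.expo.sum fun c e => e * φ (Sum.inr c)

open Classical in
lemma phase_add_single (q : Idx js) (φ : Var js → ℝ) (w : Var js) (t : ℝ) :
    phase q (φ + Pi.single w t) = phase q φ + freq q w * t := by
  unfold phase
  simp only [Pi.add_apply, mul_add, Finset.sum_add_distrib, Finsupp.sum]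
  rcases w with h | c
  · have h1 : ∑ l, (q.k l : ℝ) * (Pi.single (Sum.inl h) t : Var js → ℝ) (Sum.inl l) =
        q.k h * t := by
      rw [Finset.sum_eq_single h (fun l _ hl => by simp [hl]) (by simp)]
      simp
    rw [h1]
    simp [freq]
    ring
  · have h1 : ∑ d ∈ q.expo.support, (q.expo d : ℝ) *
        (Pi.single (Sum.inr c) t : Var js → ℝ) (Sum.inr d) = q.expo c * t := by
      rw [Finset.sum_eq_single c (fun l _ hl => by simp [hl])
        (fun hc => by simp [Finsupp.notMem_support_iff.1 hc])]
      simp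
    rw [h1]
    simp [freq]
    ring

lemma monomial_anglePoint (ρ : Coord js → ℝ) (φ : Var js → ℝ) (q : Idx js) :
    q.monomial (anglePoint ρ φ) =
      (q.expo.prod fun c e => (ρ c : ℂ) ^ e) * Complex.exp (Complex.I * phase q φ) := by
  rw [Idx.monomial_eq]
  simp only [anglePoint_val, mul_pow, phase, Finsupp.prod_mul]
  have : q.expo.prod (fun c e => Complex.exp (Complex.I * φ (Sum.inr c)) ^ e) =
      Complex.exp (Complex.I * ((q.expo.sum fun c e => (e : ℝ) * φ (Sum.inr c) : ℝ) : ℂ)) := by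
    rw [Finsupp.prod, Finsupp.sum, Complex.ofReal_sum, Finset.mul_sum, Complex.exp_sum]
    refine Finset.prod_congr rfl fun c _ => ?_
    rw [← Complex.exp_nat_mul]
    push_cast
    ring_nf
  rw [this, Complex.ofReal_add, mul_add, Complex.exp_add]
  simp only [anglePoint, Complex.ofReal_sum, Complex.ofReal_mul, Complex.ofReal_intCast]
  ring

open Classical in
/-- A vanishing series has vanishing subseries of given frequencies. -/
lemma tsum_freq_eq_zero (A : Idx js → ℂ) (hA : Summable A)
    (h : ∀ φ : Var js → ℝ, ∑' q, A q * Complex.exp (Complex.I * phase q φ) = 0) (q₀ : Idx js)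
    (W : Finset (Var js)) (φ : Var js → ℝ) :
    ∑' q, (if ∀ w ∈ W, freq q w = freq q₀ w then A q * Complex.exp (Complex.I * phase q φ)
      else 0) = 0 := by
  induction W using Finset.induction_on generalizing φ with
  | empty => simpa using h φ
  | insert w W _ ih =>
    have hn : ∀ x : ℝ, ‖Complex.exp (Complex.I * x)‖ = 1 := by
      intro x
      rw [Complex.norm_exp]
      simp
    have key := tsum_fiber_eq_zero (fun q => if ∀ w ∈ W, freq q w = freq q₀ w then
        A q * Complex.exp (Complex.I * phase q φ) else 0) (fun q => freq q w)
      (Summable.of_norm_bounded hA.norm fun q => by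
        split_ifs
        · rw [norm_mul, hn, mul_one]
        · simp)
      (fun t => by
        refine (tsum_congr fun q => ?_).trans (ih (φ + Pi.single w t))
        split_ifs
        · rw [phase_add_single, mul_assoc, ← Complex.exp_add]
          push_cast
          ring_nf
        · simp) (freq q₀ w)
    refine (tsum_congr fun q => ?_).trans key
    rw [← ite_and]
    simp only [Finset.forall_mem_insert]

/-- The coefficients of an expansion are determined by the function. -/
lemma HasExpansion.unique {a p s r : ℝ} {F : Point js → ℂ} {f g : Series js} (hs : 0 < s)
    (hr : 0 < r) (hf : HasExpansion a p s r F f) (hg : HasExpansion a p s r F g) : f = g := by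
  classical
  funext q₀
  obtain ⟨η, hη, hb⟩ := exists_ball_bump a p q₀.expo.support hr
  set ρ : Coord js → ℝ := fun c => if c ∈ q₀.expo.support then η else 0 with hρ
  have hdom : ∀ φ, anglePoint ρ φ ∈ domain js a p s r := by
    intro φ
    rw [mem_domain_iff]
    refine ⟨fun h => by simpa [anglePoint] using hs, ?_⟩
    convert hb using 2 with c
    rw [anglePoint_val, enorm_mul, ← ofReal_norm (Complex.exp _), Complex.norm_exp]
    simp only [hρ, bump]
    split_ifs
    · rw [← ofReal_norm, Complex.norm_real, Real.norm_of_nonneg hη.le]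
      simp
    · simp
  set R : Idx js → ℂ := fun q => q.expo.prod fun c e => (ρ c : ℂ) ^ e with hR
  have hsum : ∀ φ, HasSum (fun q => (f q - g q) * R q * Complex.exp (Complex.I * phase q φ)) 0 := by
    intro φ
    have h1 := (hf _ (hdom φ)).sub (hg _ (hdom φ))
    rw [sub_self] at h1
    refine h1.congr_fun fun q => ?_
    rw [monomial_anglePoint]
    ring
  have hA : Summable fun q => (f q - g q) * R q := by
    refine (hsum 0).summable.congr fun q => ?_
    simp [phase]
  have key := tsum_freq_eq_zero _ hA (fun φ => (hsum φ).tsum_eq) q₀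
    (Finset.univ.map ⟨Sum.inl, Sum.inl_injective⟩ ∪
      q₀.expo.support.map ⟨Sum.inr, Sum.inr_injective⟩) 0
  rw [tsum_eq_single q₀] at key
  · have hR0 : R q₀ ≠ 0 := by
      refine Finset.prod_ne_zero_iff.2 fun c hc => pow_ne_zero _ ?_
      simp only [hρ, hc, if_true]
      exact_mod_cast hη.ne'
    have h2 : (f q₀ - g q₀) * R q₀ = 0 := by simpa [phase] using key
    exact sub_eq_zero.1 ((mul_eq_zero.1 h2).resolve_right hR0)
  · intro q hq
    split_ifs with hcond
    · have hk : q.k = q₀.k := by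
        funext h
        exact hcond (Sum.inl h) (by simp)
      have he : ∀ c ∈ q₀.expo.support, q.expo c = q₀.expo c := by
        intro c hc
        have := hcond (Sum.inr c) (by simpa using hc)
        simpa [freq] using this
      -- another multi-index with these frequencies involves a coordinate of modulus zero
      obtain ⟨c, hc⟩ : ∃ c, q.expo c ≠ q₀.expo c := by
        by_contra hcon
        push Not at hcon
        exact hq (Idx.expo_ext hk (Finsupp.ext hcon))
      have hc0 : c ∉ q₀.expo.support := fun h => hc (he c h)
      have hcq : c ∈ q.expo.support := by
        rw [Finsupp.notMem_support_iff] at hc0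
        rw [Finsupp.mem_support_iff]
        rwa [hc0] at hc
      have : R q = 0 := by
        refine Finset.prod_eq_zero hcq ?_
        simp only [hρ, hc0, if_false, Complex.ofReal_zero]
        exact zero_pow (Finsupp.mem_support_iff.1 hcq)
      rw [this]
      simp
    · rfl

/-! ### Low momentum and Töplitz series -/

/-- The multi-index of the single variable `z_m^σ`. -/
def uz (σ : ℤˣ) (m : Site js) : Idx js := unit (Sum.inr (Sum.inr (σ, m)))

/-- The quantity `∑_j |j| (α_j + β_j)` that low momentum bounds. -/
def Idx.lowSum (q : Idx js) : ℝ :=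
  ∑ σ : ℤˣ, (q.γ σ).sum fun j e => |((j : ℤ) : ℝ)| * (e : ℝ)

/-- The quantity `|k|` that low momentum bounds. -/
def Idx.kSum (q : Idx js) : ℝ := ∑ h, |(q.k h : ℝ)|

lemma isLow_iff {L b : ℝ} {N : ℕ} {μ : ℝ} {q : Idx js} :
    q.IsLow L b N μ ↔ q.lowSum < μ * (N : ℝ) ^ L ∧ q.kSum < (N : ℝ) ^ b := Iff.rfl

lemma Idx.lowSum_add (p q : Idx js) : (p + q).lowSum = p.lowSum + q.lowSum := by
  unfold Idx.lowSum
  rw [← Finset.sum_add_distrib]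
  refine Finset.sum_congr rfl fun σ _ => ?_
  exact Finsupp.sum_add_index' (by simp) fun j e e' => by push_cast; ring

lemma Idx.momentum_add (p q : Idx js) : (p + q).momentum = p.momentum + q.momentum := by
  unfold Idx.momentum
  have : ∀ σ, ((p + q).γ σ).sum (fun j e => (j : ℤ) * (e : ℤ)) =
      (p.γ σ).sum (fun j e => (j : ℤ) * (e : ℤ)) + (q.γ σ).sum fun j e => (j : ℤ) * (e : ℤ) :=
    fun σ => Finsupp.sum_add_index' (by simp) fun j e e' => by push_cast; ring
  simp only [this, Idx.add_k, Pi.add_apply, mul_add, Finset.sum_add_distrib]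
  ring

lemma Idx.kSum_add_of_k_eq_zero (p q : Idx js) (hq : q.k = 0) : (p + q).kSum = p.kSum := by
  simp [Idx.kSum, hq]

@[simp] lemma kSum_add_unit (p : Idx js) (v : Var js) : (p + unit v).kSum = p.kSum :=
  Idx.kSum_add_of_k_eq_zero _ _ (unit_k v)

@[simp] lemma kSum_add_uz (p : Idx js) (σ : ℤˣ) (m : Site js) : (p + uz σ m).kSum = p.kSum :=
  kSum_add_unit _ _

lemma Idx.lowSum_nonneg (q : Idx js) : 0 ≤ q.lowSum :=
  Finset.sum_nonneg fun _ _ => Finset.sum_nonneg fun _ _ => by positivity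

lemma lowSum_uz (σ : ℤˣ) (m : Site js) : (uz σ m).lowSum = |((m : ℤ) : ℝ)| := by
  unfold Idx.lowSum
  rw [Finset.sum_eq_single σ]
  · simp [uz, unit, unitZ]
  · intro σ' _ h
    simp [uz, unit, unitZ, h]
  · exact fun h => absurd (Finset.mem_univ σ) h

lemma momentum_uz (σ : ℤˣ) (m : Site js) : (uz σ m).momentum = (σ : ℤ) * (m : ℤ) := by
  unfold Idx.momentum
  rw [Finset.sum_eq_single (a := σ)]
  · simp [uz, unit, unitZ]
  · intro σ' _ h
    simp [uz, unit, unitZ, h]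
  · exact fun h => absurd (Finset.mem_univ σ) h

lemma lowSum_le_of_ne_zero {q : Idx js} {σ : ℤˣ} {m : Site js} (h : q.γ σ m ≠ 0) :
    |((m : ℤ) : ℝ)| ≤ q.lowSum := by
  obtain ⟨p, hp⟩ := exists_add_unit (q := q) (c := Sum.inr (σ, m)) h
  rw [← hp, Idx.lowSum_add, ← uz, lowSum_uz]
  linarith [p.lowSum_nonneg]

lemma abs_momentum_le (q : Idx js) : |(q.momentum : ℝ)| ≤ kappa js * q.kSum + q.lowSum := by
  unfold Idx.momentum Idx.kSum Idx.lowSum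
  push_cast
  refine (abs_add_le _ _).trans (add_le_add ?_ ?_)
  · rw [Finset.mul_sum]
    refine (Finset.abs_sum_le_sum_abs _ _).trans (Finset.sum_le_sum fun h _ => ?_)
    rw [abs_mul]
    refine mul_le_mul_of_nonneg_right ?_ (abs_nonneg _)
    have : (js h).natAbs ≤ kappa js :=
      Finset.le_sup (f := fun l => (js l).natAbs) (Finset.mem_univ h)
    rw [← Int.cast_abs, Int.abs_eq_natAbs, Int.cast_natCast]
    exact_mod_cast this
  · refine (Finset.abs_sum_le_sum_abs _ _).trans (Finset.sum_le_sum fun σ _ => ?_)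
    rw [abs_mul]
    have : |((σ : ℤ) : ℝ)| = 1 := by
      rcases Int.units_eq_one_or σ with h | h <;> simp [h]
    rw [this, one_mul, Finsupp.sum, Finsupp.sum]
    refine (Finset.abs_sum_le_sum_abs _ _).trans (Finset.sum_le_sum fun j _ => ?_)
    rw [abs_mul, Nat.abs_cast]

lemma isBilinear_iff {L b : ℝ} {N : ℕ} {θ μ : ℝ} {q : Idx js} :
    q.IsBilinear L b N θ μ ↔ q.momentum = 0 ∧ ∃ (σ σ' : ℤˣ) (m m' : Site js) (q₀ : Idx js),
      θ * N < |((m : ℤ) : ℝ)| ∧ θ * N < |((m' : ℤ) : ℝ)| ∧ q = q₀ + uz σ m + uz σ' m' ∧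
        q₀.IsLow L b N μ := by
  refine and_congr_right fun _ => ⟨?_, ?_⟩
  · rintro ⟨σ, σ', m, m', γ₀, h1, h2, h3, h4⟩
    exact ⟨σ, σ', m, m', { q with γ := γ₀ }, h1, h2,
      Idx.ext (by simp [uz]) (by simp [uz, unit]) (by simpa [uz, unit] using h3), h4⟩
  · rintro ⟨σ, σ', m, m', q₀, h1, h2, rfl, h4⟩
    exact ⟨σ, σ', m, m', q₀.γ, h1, h2, by simp [uz, unit], h4.1, by simpa [uz] using h4.2⟩

/-- The cut-off `N` is large compared with the momentum of low momentum monomials. -/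
def LargeCutoff (js : Fin n ↪ ℤ) (L b : ℝ) (N : ℕ) : Prop :=
  12 * (N : ℝ) ^ L + 2 * kappa js * (N : ℝ) ^ b < N

/-- High momentum sites, above `θ N`. -/
abbrev IsHigh (N : ℕ) (θ : ℝ) (m : ℤ) : Prop := θ * N < |(m : ℝ)|

section Low

variable {L b : ℝ} {N : ℕ} {θ μ : ℝ}

lemma IsHigh.natCast_lt (hθ : 1 < θ) {m : ℤ} (h : IsHigh N θ m) : (N : ℤ) < |m| := by
  have : (N : ℝ) < |(m : ℝ)| := by
    refine lt_of_le_of_lt ?_ h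
    nlinarith [Nat.cast_nonneg (α := ℝ) N]
  exact_mod_cast this

lemma two_mul_momentum_lt (hN : LargeCutoff js L b N) (hμ : μ < 6) {q : Idx js}
    (hq : q.IsLow L b N μ) : 2 * |q.momentum| < N := by
  have h1 := abs_momentum_le q
  obtain ⟨h2, h3⟩ := isLow_iff.1 hq
  have h4 : (0 : ℝ) ≤ (N : ℝ) ^ L := Real.rpow_nonneg (Nat.cast_nonneg _) _
  have h5 : (kappa js : ℝ) * q.kSum ≤ kappa js * (N : ℝ) ^ b :=
    mul_le_mul_of_nonneg_left h3.le (Nat.cast_nonneg _)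
  have h6 : 2 * |(q.momentum : ℝ)| < N := by
    unfold LargeCutoff at hN
    nlinarith
  exact_mod_cast h6

lemma not_isHigh_of_ne_zero (hN : LargeCutoff js L b N) (hμ : μ < 6) (hθ : 1 < θ) {q : Idx js}
    (hq : q.IsLow L b N μ) {σ : ℤˣ} {m : Site js} (h : q.γ σ m ≠ 0) : ¬ IsHigh N θ m := by
  intro hm
  have h1 := lowSum_le_of_ne_zero h
  obtain ⟨h2, h3⟩ := isLow_iff.1 hq
  have h4 : (0 : ℝ) ≤ (N : ℝ) ^ L := Real.rpow_nonneg (Nat.cast_nonneg _) _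
  have h5 : (0 : ℝ) ≤ kappa js * (N : ℝ) ^ b := by positivity
  unfold LargeCutoff at hN
  have h6 : (N : ℝ) ≤ θ * N := by nlinarith [Nat.cast_nonneg (α := ℝ) N]
  unfold IsHigh at hm
  nlinarith

lemma momentum_add_uz_add_uz (q : Idx js) (σ σ' : ℤˣ) (m m' : Site js) :
    (q + uz σ m + uz σ' m').momentum = q.momentum + ((σ : ℤ) * m + (σ' : ℤ) * m') := by
  rw [Idx.momentum_add, Idx.momentum_add, momentum_uz, momentum_uz, add_assoc]

/-- In a bilinear monomial of zero momentum the sign of one high site determines the other. -/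
lemma sgn_eq_of_momentum (hN : LargeCutoff js L b N) (hμ : μ < 6) (hθ : 1 < θ) {q : Idx js}
    (hq : q.IsLow L b N μ) {σ σ' : ℤˣ} {m m' : Site js} (hm : IsHigh N θ m) (hm' : IsHigh N θ m')
    (h0 : (q + uz σ m + uz σ' m').momentum = 0) : sgn m' = -(σ * σ') * sgn m := by
  have h1 := two_mul_momentum_lt hN hμ hq
  have h2 := hm.natCast_lt hθ
  have h3 := hm'.natCast_lt hθ
  rw [momentum_add_uz_add_uz] at h0
  unfold sgn
  rcases Int.units_eq_one_or σ with h | h <;> rcases Int.units_eq_one_or σ' with h' | h' <;>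
    subst h <;> subst h' <;> simp only [Units.val_one, Units.val_neg, one_mul, neg_mul] at h0 <;>
    split_ifs <;> first | rfl | (exfalso; grind)

lemma ne_of_momentum (hN : LargeCutoff js L b N) (hμ : μ < 6) (hθ : 1 < θ) {q : Idx js}
    (hq : q.IsLow L b N μ) {σ σ' : ℤˣ} {m m' : Site js} (hm : IsHigh N θ m)
    (h0 : (q + uz σ m + uz σ' m').momentum = 0) : (σ, m) ≠ (σ', m') := by
  intro h
  obtain ⟨rfl, rfl⟩ := Prod.mk.inj h
  have h1 := two_mul_momentum_lt hN hμ hq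
  have h2 := hm.natCast_lt hθ
  rw [momentum_add_uz_add_uz] at h0
  rcases Int.units_eq_one_or σ with h | h <;> subst h <;>
    simp only [Units.val_one, Units.val_neg, one_mul, neg_mul] at h0 <;> grind

end Low

/-- Momentum conservation for one series. -/
def NullSeries (f : Series js) : Prop := ∀ q, f q ≠ 0 → q.momentum = 0

/-- The coefficients of the bilinear monomials do not change when the two high sites `m`, `m'` move
with `σ m + σ' m'` and the sign of `m` fixed: this is the Töplitz property, in terms of the
coefficients. -/
def ShiftInvariant (L b : ℝ) (N : ℕ) (θ μ : ℝ) (f : Series js) : Prop :=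
  ∀ q : Idx js, q.IsLow L b N μ → ∀ (σ σ' : ℤˣ) (m m' l l' : Site js), IsHigh N θ m →
    IsHigh N θ m' → IsHigh N θ l → IsHigh N θ l' → sgn m = sgn l →
    (σ : ℤ) * (m : ℤ) + (σ' : ℤ) * (m' : ℤ) = (σ : ℤ) * (l : ℤ) + (σ' : ℤ) * (l' : ℤ) →
    f (q + uz σ m + uz σ' m') = f (q + uz σ l + uz σ' l')

@[simp] lemma uz_γ_self (σ : ℤˣ) (m : Site js) : (uz σ m).γ σ m = 1 := by simp [uz, unit, unitZ]

lemma uz_γ_of_ne {σ τ : ℤˣ} {m j : Site js} (h : (τ, j) ≠ (σ, m)) : (uz σ m).γ τ j = 0 := by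
  by_cases hσ : τ = σ
  · subst hσ
    have hj : j ≠ m := fun e => h (by rw [e])
    simp [uz, unit, unitZ, Ne.symm hj]
  · simp [uz, unit, unitZ, hσ]

lemma mulZ_add_uz (σ : ℤˣ) (m : Site js) (g : Series js) (p : Idx js) :
    mulZ σ m g (p + uz σ m) = g p := by
  unfold mulZ
  rw [if_neg (by simp)]
  congr 1
  exact Idx.ext (by simp [uz]) (by simp [uz, unit]) (by simp [uz, unit])

lemma exists_of_mulZ_ne_zero {σ : ℤˣ} {m : Site js} {g : Series js} {q : Idx js}
    (h : mulZ σ m g q ≠ 0) : ∃ p, q = p + uz σ m ∧ g p ≠ 0 := by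
  have h1 : q.γ σ m ≠ 0 := by
    intro h0
    exact h (by simp [mulZ, h0])
  obtain ⟨p, hp⟩ := exists_add_unit (q := q) (c := Sum.inr (σ, m)) h1
  have hp : p + uz σ m = q := hp
  refine ⟨p, hp.symm, ?_⟩
  rwa [← hp, mulZ_add_uz] at h

section Bilinear

variable {L b : ℝ} {N : ℕ} {θ μ : ℝ} {g : ℤˣ → ℤˣ → Site js → Site js → Series js}

lemma exists_of_bilinearSeries_ne_zero {q : Idx js} (h : bilinearSeries N θ g q ≠ 0) :
    ∃ (σ σ' : ℤˣ) (m m' : Site js) (q₀ : Idx js), IsHigh N θ m ∧ IsHigh N θ m' ∧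
      q = q₀ + uz σ m + uz σ' m' ∧ g σ σ' m m' q₀ ≠ 0 := by
  unfold bilinearSeries at h
  obtain ⟨σ, -, h⟩ := Finset.exists_ne_zero_of_sum_ne_zero h
  obtain ⟨σ', -, h⟩ := Finset.exists_ne_zero_of_sum_ne_zero h
  obtain ⟨m, -, h⟩ := Finset.exists_ne_zero_of_sum_ne_zero h
  obtain ⟨m', -, h⟩ := Finset.exists_ne_zero_of_sum_ne_zero h
  split_ifs at h with hh
  · obtain ⟨p, rfl, hp⟩ := exists_of_mulZ_ne_zero h
    obtain ⟨q₀, rfl, hq⟩ := exists_of_mulZ_ne_zero hp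
    exact ⟨σ, σ', m, m', q₀, hh.1, hh.2, add_right_comm _ _ _, hq⟩
  · exact absurd rfl h

/-- The sum defining a bilinear series, over ordered pairs of variables. -/
lemma exists_bilinearSeries_eq (q : Idx js) : ∃ S : Finset (ℤˣ × Site js),
    (∀ σ m, q.γ σ m ≠ 0 → (σ, m) ∈ S) ∧
    bilinearSeries N θ g q = ∑ t ∈ S ×ˢ S, if IsHigh N θ t.1.2 ∧ IsHigh N θ t.2.2 then
      mulZ t.1.1 t.1.2 (mulZ t.2.1 t.2.2 (g t.1.1 t.2.1 t.1.2 t.2.2)) q else 0 := by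
  classical
  set B : Finset (Site js) := Finset.univ.biUnion fun σ => (q.γ σ).support with hB
  have hsub : ∀ σ, (q.γ σ).support ⊆ B := fun σ =>
    Finset.subset_biUnion_of_mem (fun σ => (q.γ σ).support) (Finset.mem_univ σ)
  refine ⟨Finset.univ ×ˢ B, fun σ m h => ?_, ?_⟩
  · simp only [Finset.mem_product, Finset.mem_univ, true_and]
    exact hsub σ (Finsupp.mem_support_iff.2 h)
  · rw [Finset.sum_product, Finset.sum_product]
    simp only [Finset.sum_product]
    unfold bilinearSeries
    refine Finset.sum_congr rfl fun σ _ => ?_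
    rw [Finset.sum_comm (s := B)]
    refine Finset.sum_congr rfl fun σ' _ => ?_
    have h0 : ∀ m m', mulZ σ m (mulZ σ' m' (g σ σ' m m')) q ≠ 0 →
        q.γ σ m ≠ 0 ∧ q.γ σ' m' ≠ 0 := by
      intro m m' h
      obtain ⟨p, rfl, hp⟩ := exists_of_mulZ_ne_zero h
      obtain ⟨q₀, rfl, -⟩ := exists_of_mulZ_ne_zero hp
      simp
    refine (Finset.sum_congr rfl fun m _ => ?_).trans (Finset.sum_subset (hsub σ) fun m _ hm => ?_)
    · refine Finset.sum_subset (hsub σ') fun m' _ hm' => ?_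
      rw [Finsupp.notMem_support_iff] at hm'
      by_contra hne
      refine (h0 m m' fun h => hne ?_).2 hm'
      simp [h]
    · rw [Finsupp.notMem_support_iff] at hm
      refine Finset.sum_eq_zero fun m' _ => ?_
      by_contra hne
      refine (h0 m m' fun h => hne ?_).1 hm
      simp [h]

/-- A coefficient of a bilinear series: the two high variables can be taken in both orders. -/
lemma bilinearSeries_apply (hN : LargeCutoff js L b N) (hμ : μ < 6) (hθ : 1 < θ) {q : Idx js}
    (hq : q.IsLow L b N μ) {σ σ' : ℤˣ} {m m' : Site js} (hm : IsHigh N θ m) (hm' : IsHigh N θ m')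
    (hne : (σ, m) ≠ (σ', m')) :
    bilinearSeries N θ g (q + uz σ m + uz σ' m') = g σ σ' m m' q + g σ' σ m' m q := by
  classical
  obtain ⟨S, hS, hsum⟩ :=
    exists_bilinearSeries_eq (N := N) (θ := θ) (g := g) (q + uz σ m + uz σ' m')
  have h1 : (σ, m) ∈ S := hS _ _ (by simp)
  have h2 : (σ', m') ∈ S := hS _ _ (by simp)
  have hlow : ∀ {τ : ℤˣ} {j : Site js}, IsHigh N θ j → q.γ τ j = 0 := by
    intro τ j hj
    by_contra h0
    exact not_isHigh_of_ne_zero hN hμ hθ hq h0 hj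
  rw [hsum, Finset.sum_eq_add ((σ, m), (σ', m')) ((σ', m'), (σ, m))]
  · rw [if_pos ⟨hm, hm'⟩, if_pos ⟨hm', hm⟩, mulZ_add_uz, add_right_comm, mulZ_add_uz, mulZ_add_uz,
      mulZ_add_uz]
  · intro h
    exact hne (Prod.mk.inj h).1
  · rintro ⟨⟨τ, j⟩, ⟨τ', j'⟩⟩ - ⟨ha, hb⟩
    split_ifs with hh
    · by_contra h
      obtain ⟨p, hp, hp'⟩ := exists_of_mulZ_ne_zero h
      obtain ⟨q₁, rfl, -⟩ := exists_of_mulZ_ne_zero hp'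
      -- the high variables of the monomial are exactly `z_m^σ` and `z_{m'}^{σ'}`
      have hj : (τ, j) = (σ, m) ∨ (τ, j) = (σ', m') := by
        by_contra hcon
        push Not at hcon
        have := congrArg (fun q : Idx js => q.γ τ j) hp
        simp [hlow hh.1, uz_γ_of_ne hcon.1, uz_γ_of_ne hcon.2] at this
      rcases hj with hj | hj
      · obtain ⟨rfl, rfl⟩ := Prod.mk.inj hj
        rw [add_right_comm] at hp
        have hp := add_right_cancel hp
        have : (τ', j') = (σ', m') := by
          by_contra hcon
          have := congrArg (fun q : Idx js => q.γ τ' j') hp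
          simp [hlow hh.2, uz_γ_of_ne hcon] at this
        exact ha (by rw [this])
      · obtain ⟨rfl, rfl⟩ := Prod.mk.inj hj
        have hp := add_right_cancel hp
        have : (τ', j') = (σ, m) := by
          by_contra hcon
          have := congrArg (fun q : Idx js => q.γ τ' j') hp
          simp [hlow hh.2, uz_γ_of_ne hcon] at this
        exact hb (by rw [this])
    · rfl
  · intro h
    exact absurd (Finset.mk_mem_product h1 h2) h
  · intro h
    exact absurd (Finset.mk_mem_product h2 h1) h

end Bilinear

section Toplitz

variable {𝒪 : Set (Fin n → ℝ)} {a p L b s r : ℝ} {N : ℕ} {θ μ : ℝ} {f : 𝒪 → Series js}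

lemma IsToplitz.isBilinear (hf : IsToplitz a p L b s r N θ μ f) {ξ : 𝒪} {q : Idx js}
    (h : f ξ q ≠ 0) : q.IsBilinear L b N θ μ := by
  obtain ⟨-, hnull, φ, hφ, heq⟩ := hf
  refine isBilinear_iff.2 ⟨hnull ξ q h, ?_⟩
  rw [heq] at h
  obtain ⟨σ, σ', m, m', q₀, h1, h2, h3, h4⟩ := exists_of_bilinearSeries_ne_zero h
  exact ⟨σ, σ', m, m', q₀, h1, h2, h3, ((hφ _ _ _ _).2 ξ q₀ h4).1⟩

/-- In a Töplitz series the coefficient of `z_m^σ z_{m'}^{σ'}` is the sum of two values of `φ`, one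
for each order of the variables. The second involves `sign m'`, which `sign m` determines. -/
lemma IsToplitz.shiftInvariant (hN : LargeCutoff js L b N) (hμ : μ < 6) (hθ : 1 < θ)
    (hf : IsToplitz a p L b s r N θ μ f) (ξ : 𝒪) : ShiftInvariant L b N θ μ (f ξ) := by
  obtain ⟨-, hnull, φ, hφ, heq⟩ := hf
  intro q hq σ σ' m m' l l' hm hm' hl hl' hs hh
  have hmom : (q + uz σ l + uz σ' l').momentum = (q + uz σ m + uz σ' m').momentum := by
    rw [momentum_add_uz_add_uz, momentum_add_uz_add_uz, hh]
  by_cases h0 : (q + uz σ m + uz σ' m').momentum = 0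
  · have h0' := hmom.trans h0
    have hs' : sgn m' = sgn l' := by
      rw [sgn_eq_of_momentum hN hμ hθ hq hm hm' h0, sgn_eq_of_momentum hN hμ hθ hq hl hl' h0', hs]
    rw [heq, bilinearSeries_apply hN hμ hθ hq hm hm' (ne_of_momentum hN hμ hθ hq hm h0),
      bilinearSeries_apply hN hμ hθ hq hl hl' (ne_of_momentum hN hμ hθ hq hl h0'), hs, hs', hh,
      add_comm ((σ' : ℤ) * (m' : ℤ)), add_comm ((σ' : ℤ) * (l' : ℤ)), hh]
  · have e1 : f ξ (q + uz σ m + uz σ' m') = 0 := by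
      by_contra h
      exact h0 (hnull ξ _ h)
    have e2 : f ξ (q + uz σ l + uz σ' l') = 0 := by
      by_contra h
      exact h0 (hmom ▸ hnull ξ _ h)
    rw [e1, e2]

end Toplitz

/-! ### Töplitz series as shift invariant series -/

lemma hamNorm_eq {𝒪 : Set (Fin n → ℝ)} (a p s r : ℝ) (f : 𝒪 → Series js) :
    hamNorm a p s r f = ⨆ ξ, mNorm a p s r (maj (f ξ)) := by
  simp only [hamNorm, majorantNorm_hamVF]

/-- If the coefficients of `P` are dominated by those of the multiples by `z_l^σ z_{l'}^{σ'}` of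
the same monomials in `Q`, then the norm of `P` is controlled by that of `Q` on a larger ball. -/
lemma exists_mNorm_le_of_shift {a p s r r' : ℝ} (hs : 0 < s) (hr : 0 < r) (hrr : r < r')
    (σ σ' : ℤˣ) (l l' : Site js) : ∃ K ≠ ∞, ∀ P Q : Idx js → ℝ≥0∞,
      (∀ q, P q ≤ Q (q + uz σ l + uz σ' l')) → mNorm a p s r P ≤ K * mNorm a p s r' Q := by
  classical
  set c : Coord js := Sum.inr (σ, l)
  set c' : Coord js := Sum.inr (σ', l')
  obtain ⟨η, hη, hb⟩ := exists_ball_bump a p {c, c'} (sub_pos.2 hrr)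
  set ε := ENNReal.ofReal η with hε
  have hε0 : ε ≠ 0 := by simpa [hε] using hη
  have hε2 : ε * ε ≠ 0 := mul_ne_zero hε0 hε0
  have hε2' : ε * ε ≠ ∞ := ENNReal.mul_ne_top ENNReal.ofReal_ne_top ENNReal.ofReal_ne_top
  have hr' : 0 < r' := hr.trans hrr
  have hq1 : 1 ≤ r' / r := (one_le_div hr).2 hrr.le
  have hq2 : r' = r' / r * r := by field_simp
  have hq3 : 1 ≤ (r' / r) ^ 2 := one_le_pow₀ hq1
  refine ⟨ENNReal.ofReal ((r' / r) ^ 2) * (ε * ε)⁻¹,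
    ENNReal.mul_ne_top ENNReal.ofReal_ne_top (ENNReal.inv_ne_top.2 hε2),
    fun P Q hPQ => iSup₂_le fun X hX => ?_⟩
  set Y : Coord js → ℝ≥0∞ := fun d => X d + bump {c, c'} ε d
  have hY : ball a p r' Y := by
    have := ball_add hr.le (sub_pos.2 hrr).le hX hb
    rwa [add_sub_cancel] at this
  have hXY : X ≤ Y := fun d => le_self_add
  have hc : ε ≤ Y c := by
    simp only [Y, bump, Finset.mem_insert, true_or, if_true]
    exact le_add_self
  have hc' : ε ≤ Y c' := by
    simp only [Y, bump, Finset.mem_insert, Finset.mem_singleton, or_true, if_true]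
    exact le_add_self
  have hwt : ∀ q, wt s X q * (ε * ε) ≤ wt s Y (q + uz σ l + uz σ' l') := by
    intro q
    have e1 : (uz σ l).expo.prod (fun c e => Y c ^ e) = Y c := by
      rw [uz, expo_unit, Finsupp.prod_single_index (by simp), pow_one]
    have e2 : (uz σ' l').expo.prod (fun c e => Y c ^ e) = Y c' := by
      rw [uz, expo_unit, Finsupp.prod_single_index (by simp), pow_one]
    rw [wt_add_of_k_eq_zero _ _ _ (uz σ' l') (unit_k _),
      wt_add_of_k_eq_zero _ _ q (uz σ l) (unit_k _), e1, e2,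
      mul_assoc]
    refine mul_le_mul' ?_ (mul_le_mul' hc hc')
    exact mul_le_mul' le_rfl (Finset.prod_le_prod' fun d _ => pow_le_pow_left' (hXY d) _)
  have hVF : majVF s P X ≤ fun v => (ε * ε)⁻¹ * majVF s Q Y v := by
    intro v
    have h1 : ε * ε * majVF s P X v ≤ majVF s Q Y v := by
      have hinj : Function.Injective fun q : Idx js => q + (uz σ l + uz σ' l') :=
        add_left_injective _
      unfold majVF mSum
      rw [← ENNReal.tsum_mul_left]
      refine (ENNReal.tsum_le_tsum fun q => ?_).trans (ENNReal.tsum_comp_le_tsum_of_injective hinj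
        (fun q => dM (conjV v) Q q * wt s Y q))
      rw [← add_assoc]
      calc ε * ε * (dM (conjV v) P q * wt s X q) = dM (conjV v) P q * (wt s X q * (ε * ε)) := by
            ring
        _ ≤ _ := by
          refine mul_le_mul' (mul_le_mul' ?_ ?_) (hwt q)
          · rw [add_assoc]
            exact_mod_cast derCoef_le_add (conjV v) q (uz σ l + uz σ' l') (by simp [uz])
          · refine (hPQ _).trans_eq ?_
            congr 1
            abel
    calc majVF s P X v = (ε * ε)⁻¹ * (ε * ε * majVF s P X v) := by
          rw [← mul_assoc, ENNReal.inv_mul_cancel hε2 hε2', one_mul]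
      _ ≤ _ := mul_le_mul' le_rfl h1
  calc vecNorm a p s r (majVF s P X)
      ≤ ENNReal.ofReal ((r' / r) ^ 2) * vecNorm a p s r' (majVF s P X) := by
        refine vecNorm_le_mul hs hr' hs hr (by nlinarith) ?_ ?_ _
        · nlinarith
        · rw [← mul_pow, ← hq2]
    _ ≤ ENNReal.ofReal ((r' / r) ^ 2) * ((ε * ε)⁻¹ * mNorm a p s r' Q) := by
        refine mul_le_mul' le_rfl ((vecNorm_mono hVF).trans ?_)
        rw [vecNorm_const_mul]
        exact mul_le_mul' le_rfl (le_mNorm Q hY)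
    _ = _ := by ring

lemma notMem_range_of_kappa_lt {j : ℤ} (h : (kappa js : ℤ) < |j|) : j ∉ Set.range js := by
  rintro ⟨l, rfl⟩
  have : (js l).natAbs ≤ kappa js :=
    Finset.le_sup (f := fun l => (js l).natAbs) (Finset.mem_univ l)
  rw [Int.abs_eq_natAbs] at h
  omega

/-- Given signs and given `h`, there are high sites with `σ l + σ' l' = h`. -/
lemma exists_high_sites (js : Fin n ↪ ℤ) (N : ℕ) (θ : ℝ) (σ σ' ς : ℤˣ) (h : ℤ) :
    ∃ l l' : Site js, IsHigh N θ l ∧ IsHigh N θ l' ∧ sgn l = ς ∧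
      (σ : ℤ) * (l : ℤ) + (σ' : ℤ) * (l' : ℤ) = h := by
  obtain ⟨M₀, hM₀⟩ := exists_nat_gt (θ * N)
  set M : ℤ := M₀ + |h| + kappa js + 1 with hM
  have hh := abs_nonneg h
  have key : ∀ {j : ℤ}, M₀ + kappa js + 1 ≤ |j| → j ∉ Set.range js ∧ IsHigh N θ j := by
    intro j hj
    refine ⟨notMem_range_of_kappa_lt (by omega), hM₀.trans ?_⟩
    have : (M₀ : ℤ) < |j| := by omega
    exact_mod_cast this
  have h1 : M₀ + kappa js + 1 ≤ |(ς : ℤ) * M| := by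
    rcases Int.units_eq_one_or ς with e | e <;> subst e <;>
      simp only [Units.val_one, Units.val_neg, one_mul, neg_mul] <;> grind
  have h2 : M₀ + kappa js + 1 ≤ |(σ' : ℤ) * (h - σ * (ς * M))| := by
    rcases Int.units_eq_one_or ς with e | e <;> rcases Int.units_eq_one_or σ with e' | e' <;>
      rcases Int.units_eq_one_or σ' with e'' | e'' <;> subst e <;> subst e' <;> subst e'' <;>
      simp only [Units.val_one, Units.val_neg, one_mul, neg_mul] <;> grind
  refine ⟨⟨(ς : ℤ) * M, (key h1).1⟩, ⟨(σ' : ℤ) * (h - σ * (ς * M)), (key h2).1⟩, (key h1).2,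
    (key h2).2, ?_, ?_⟩
  · rcases Int.units_eq_one_or ς with e | e <;> subst e <;>
      simp only [sgn, Units.val_one, Units.val_neg, one_mul, neg_mul]
    · rw [if_pos (by omega)]
    · rw [if_neg (by omega)]
  · rcases Int.units_eq_one_or σ' with e'' | e'' <;> subst e'' <;> simp

section Toplitz

variable {𝒪 : Set (Fin n → ℝ)} {a p L b s r r' : ℝ} {N : ℕ} {θ μ : ℝ} {f : 𝒪 → Series js}

/-- Conversely, a shift invariant series of bilinear monomials is Töplitz: the coefficient
`φ^{σ,σ'}(ς, h)` is read off at some pair of high sites. Its M-regularity is lost on the boundary,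
whence the larger radius. -/
lemma isToplitz_of_shiftInvariant (hN : LargeCutoff js L b N) (hμ : μ < 6) (hθ : 1 < θ)
    (hs : 0 < s) (hr : 0 < r) (hrr : r < r') (hreg : IsMRegular a p s r f)
    (hreg' : IsMRegular a p s r' f) (hbil : ∀ ξ q, f ξ q ≠ 0 → q.IsBilinear L b N θ μ)
    (hinv : ∀ ξ, ShiftInvariant L b N θ μ (f ξ)) : IsToplitz a p L b s r N θ μ f := by
  classical
  choose l l' hl hl' hsgn hsum using exists_high_sites js N θ
  set φ : ℤˣ → ℤˣ → ℤˣ → ℤ → 𝒪 → Series js := fun σ σ' ς h ξ q =>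
    if q.IsLow L b N μ ∧ q.momentum + h = 0 then
      (1 / 2) * f ξ (q + uz σ (l σ σ' ς h) + uz σ' (l' σ σ' ς h)) else 0 with hφ
  refine ⟨hreg, fun ξ q hq => (isBilinear_iff.1 (hbil ξ q hq)).1, φ, fun σ σ' ς h => ⟨?_, ?_⟩, ?_⟩
  · obtain ⟨K, hK, hKb⟩ := exists_mNorm_le_of_shift (a := a) (p := p) hs hr hrr σ σ'
      (l σ σ' ς h) (l' σ σ' ς h)
    unfold IsMRegular at hreg' ⊢
    rw [hamNorm_eq] at hreg' ⊢
    refine lt_of_le_of_lt (iSup_le fun ξ => ?_) (ENNReal.mul_lt_top hK.lt_top hreg')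
    refine (hKb (maj (φ σ σ' ς h ξ)) (maj (f ξ)) fun q => ?_).trans
      (mul_le_mul' le_rfl (le_iSup (fun ξ => mNorm a p s r' (maj (f ξ))) ξ))
    simp only [maj, hφ]
    split_ifs
    · rw [enorm_mul]
      refine mul_le_of_le_one_left zero_le ?_
      rw [← ofReal_norm]
      norm_num
    · simp
  · intro ξ q hq
    by_contra hcon
    exact hq (by simp only [hφ, if_neg hcon])
  · intro ξ
    funext q
    by_cases hq : q.IsBilinear L b N θ μ
    · obtain ⟨hmom, σ, σ', m, m', q₀, hm, hm', rfl, hlow⟩ := isBilinear_iff.1 hq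
      rw [bilinearSeries_apply hN hμ hθ hlow hm hm' (ne_of_momentum hN hμ hθ hlow hm hmom)]
      rw [momentum_add_uz_add_uz] at hmom
      have hmom' : q₀.momentum + ((σ' : ℤ) * (m' : ℤ) + (σ : ℤ) * (m : ℤ)) = 0 := by
        rw [← hmom]; ring
      simp only [hφ, if_pos (And.intro hlow hmom), if_pos (And.intro hlow hmom')]
      have e1 := hinv ξ q₀ hlow σ σ' m m' _ _ hm hm' (hl σ σ' (sgn m) _) (hl' σ σ' (sgn m) _)
        (hsgn σ σ' (sgn m) _).symm (hsum σ σ' (sgn m) ((σ : ℤ) * m + (σ' : ℤ) * m')).symm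
      have e2 := hinv ξ q₀ hlow σ' σ m' m _ _ hm' hm (hl σ' σ (sgn m') _) (hl' σ' σ (sgn m') _)
        (hsgn σ' σ (sgn m') _).symm (hsum σ' σ (sgn m') ((σ' : ℤ) * m' + (σ : ℤ) * m)).symm
      rw [← e1, ← e2, add_right_comm q₀ (uz σ' m')]
      ring
    · have h1 : f ξ q = 0 := by
        by_contra h
        exact hq (hbil ξ q h)
      rw [h1]
      by_contra h
      obtain ⟨σ, σ', m, m', q₀, hm, hm', rfl, hne⟩ := exists_of_bilinearSeries_ne_zero (Ne.symm h)
      have hcond : q₀.IsLow L b N μ ∧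
          q₀.momentum + ((σ : ℤ) * (m : ℤ) + (σ' : ℤ) * (m' : ℤ)) = 0 := by
        by_contra hcon
        exact hne (by simp only [hφ, if_neg hcon])
      refine hq (isBilinear_iff.2 ⟨?_, σ, σ', m, m', q₀, hm, hm', rfl, hcond.1⟩)
      rw [momentum_add_uz_add_uz]
      exact hcond.2

end Toplitz

/-! ### The bracket of Töplitz series -/

/-- Multiplication of the first factor by a new variable `c`. -/
def Fib.addLeft (q : Idx js) (c : Coord js) (p : Fib q) : Fib (q + unit (Sum.inr c)) :=
  ⟨(p.1.1 + unit (Sum.inr c), p.1.2),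
    (add_right_comm _ _ _).trans (congrArg (· + unit (Sum.inr c)) p.2)⟩

/-- Multiplication of the second factor by a new variable `c`. -/
def Fib.addRight (q : Idx js) (c : Coord js) (p : Fib q) : Fib (q + unit (Sum.inr c)) :=
  ⟨(p.1.1, p.1.2 + unit (Sum.inr c)),
    (add_assoc _ _ _).symm.trans (congrArg (· + unit (Sum.inr c)) p.2)⟩

/-- If `c` does not occur in `q`, it goes to exactly one factor in a factorization of `q + c`. -/
lemma Fib.bijective_addLeft_addRight {q : Idx js} {c : Coord js} (hc : q.expo c = 0) :
    Function.Bijective (Sum.elim (Fib.addLeft q c) (Fib.addRight q c)) := by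
  have hexp : ∀ p : Fib q, p.1.1.expo c = 0 ∧ p.1.2.expo c = 0 := by
    intro p
    have := congrArg (fun q : Idx js => q.expo c) p.2
    simp only [Idx.expo_add, Finsupp.add_apply, hc] at this
    omega
  constructor
  · rintro (p | p) (p' | p') h
    all_goals
      have h1 := congrArg (fun t => t.1.1) h
      have h2 := congrArg (fun t => t.1.2) h
      simp only [Fib.addLeft, Fib.addRight, Sum.elim_inl, Sum.elim_inr] at h1 h2
    · exact congrArg Sum.inl (Subtype.ext (Prod.ext (add_right_cancel h1) h2))
    · have h3 := (hexp p').1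
      rw [← h1] at h3
      simp at h3
    · have h3 := (hexp p).1
      rw [h1] at h3
      simp at h3
    · exact congrArg Sum.inr (Subtype.ext (Prod.ext h1 (add_right_cancel h2)))
  · rintro ⟨⟨p₁, p₂⟩, hp⟩
    have hp : p₁ + p₂ = q + unit (Sum.inr c) := hp
    have h1 := congrArg (fun q : Idx js => q.expo c) hp
    simp only [Idx.expo_add, Finsupp.add_apply, hc, expo_unit, Finsupp.single_eq_same] at h1
    by_cases h2 : p₁.expo c = 0
    · obtain ⟨r, hr⟩ := exists_add_unit (q := p₂) (c := c) (by omega)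
      subst hr
      refine ⟨Sum.inr ⟨(p₁, r), ?_⟩, rfl⟩
      rw [← add_assoc] at hp
      exact add_right_cancel hp
    · obtain ⟨r, hr⟩ := exists_add_unit h2
      subst hr
      refine ⟨Sum.inl ⟨(r, p₂), ?_⟩, rfl⟩
      rw [add_right_comm] at hp
      exact add_right_cancel hp

lemma tsum_eq_add_of_bijective {A B : Type*} {e₁ e₂ : A → B}
    (h : Function.Bijective (Sum.elim e₁ e₂)) {G : B → ℂ} (hG : Summable G) :
    Summable (fun x => G (e₁ x)) ∧ Summable (fun x => G (e₂ x)) ∧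
      ∑' y, G y = ∑' x, G (e₁ x) + ∑' x, G (e₂ x) := by
  have hs : Summable fun x => G (Sum.elim e₁ e₂ x) := hG.comp_injective h.1
  have h1 : Summable fun x => G (e₁ x) := hs.comp_injective Sum.inl_injective
  have h2 : Summable fun x => G (e₂ x) := hs.comp_injective Sum.inr_injective
  refine ⟨h1, h2, ?_⟩
  rw [← (Equiv.ofBijective _ h).tsum_eq]
  exact Summable.tsum_sum (f := fun x => G (Sum.elim e₁ e₂ x)) h1 h2

lemma tsum_Fib_add_unit {q : Idx js} {c : Coord js} (hc : q.expo c = 0) {H : Idx js × Idx js → ℂ}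
    (hH : Summable fun p : Fib (q + unit (Sum.inr c)) => H p.1) :
    Summable (fun p : Fib q => H (p.1.1 + unit (Sum.inr c), p.1.2)) ∧
    Summable (fun p : Fib q => H (p.1.1, p.1.2 + unit (Sum.inr c))) ∧
    ∑' p : Fib (q + unit (Sum.inr c)), H p.1 =
      ∑' p : Fib q, H (p.1.1 + unit (Sum.inr c), p.1.2) +
        ∑' p : Fib q, H (p.1.1, p.1.2 + unit (Sum.inr c)) :=
  tsum_eq_add_of_bijective (Fib.bijective_addLeft_addRight hc) hH

/-- The four ways to distribute two new variables over the factors. -/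
lemma tsum_Fib_add_add {q : Idx js} {c d : Coord js} (hc : q.expo c = 0) (hd : q.expo d = 0)
    (hcd : c ≠ d) {H : Idx js × Idx js → ℂ}
    (hH : Summable fun p : Fib (q + unit (Sum.inr c) + unit (Sum.inr d)) => H p.1) :
    ∑' p : Fib (q + unit (Sum.inr c) + unit (Sum.inr d)), H p.1 =
      (∑' p : Fib q, H (p.1.1 + unit (Sum.inr c) + unit (Sum.inr d), p.1.2) +
        ∑' p : Fib q, H (p.1.1 + unit (Sum.inr d), p.1.2 + unit (Sum.inr c))) +
      (∑' p : Fib q, H (p.1.1 + unit (Sum.inr c), p.1.2 + unit (Sum.inr d)) +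
        ∑' p : Fib q, H (p.1.1, p.1.2 + unit (Sum.inr c) + unit (Sum.inr d))) := by
  have hd' : (q + unit (Sum.inr c)).expo d = 0 := by
    simp [hd, hcd]
  obtain ⟨h1, h2, h3⟩ := tsum_Fib_add_unit hd' hH
  obtain ⟨-, -, h4⟩ := tsum_Fib_add_unit hc
    (H := fun p => H (p.1 + unit (Sum.inr d), p.2)) h1
  obtain ⟨-, -, h5⟩ := tsum_Fib_add_unit hc
    (H := fun p => H (p.1, p.2 + unit (Sum.inr d))) h2
  rw [h3, h4, h5]

lemma momentum_unit_add_conjV (w : Var js) :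
    (unit w).momentum + (unit (conjV w)).momentum = 0 := by
  have h0 : ∀ h, (unit (js := js) (Sum.inr (Sum.inl h))).momentum = 0 := by
    intro h; simp [Idx.momentum, unit]
  have h1 : (0 : Idx js).momentum = 0 := by simp [Idx.momentum]
  rcases w with h | h | ⟨σ, m⟩
  · simp [conjV, h0, h1]
  · simp [conjV, h0, h1]
  · have e1 : (unit (Sum.inr (Sum.inr (σ, m)))).momentum = _ := momentum_uz σ m
    have e2 : (unit (Sum.inr (Sum.inr (-σ, m)))).momentum = _ := momentum_uz (-σ) m
    rw [conjV, e1, e2]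
    simp

lemma lowSum_unit_conjV (w : Var js) : (unit (conjV w)).lowSum = (unit w).lowSum := by
  have h0 : ∀ h, (unit (js := js) (Sum.inr (Sum.inl h))).lowSum = 0 := by
    intro h; simp [Idx.lowSum, unit]
  have h1 : (0 : Idx js).lowSum = 0 := by simp [Idx.lowSum]
  rcases w with h | h | ⟨σ, m⟩
  · simp [conjV, h0, h1]
  · simp [conjV, h0, h1]
  · exact (lowSum_uz (-σ) m).trans (lowSum_uz σ m).symm

lemma lowSum_unit_le (w : Var js) : (unit w).lowSum ≤ |((unit w).momentum : ℝ)| := by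
  rcases w with h | h | ⟨σ, m⟩
  · simp [Idx.lowSum]
  · simp [Idx.lowSum, unit]
  · have e1 : (unit (Sum.inr (Sum.inr (σ, m)))).momentum = _ := momentum_uz σ m
    have e2 : (unit (Sum.inr (Sum.inr (σ, m)))).lowSum = _ := lowSum_uz σ m
    rw [e1, e2]
    rcases Int.units_eq_one_or σ with h | h <;> subst h <;> simp

lemma momentum_eq_of_der_ne_zero {f : Series js} (hf : NullSeries f) {w : Var js} {q : Idx js}
    (h : der w f q ≠ 0) : (q + unit w).momentum = 0 :=
  hf _ (right_ne_zero_of_mul h)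

lemma bracket_null {f g : Series js} (hf : NullSeries f) (hg : NullSeries g) :
    NullSeries (bracket f g) := by
  intro q hq
  obtain ⟨⟨p, w⟩, hpw⟩ : ∃ t : Fib q × Var js, bracketCoef f g t.1.1 t.2 ≠ 0 := by
    by_contra hcon
    push Not at hcon
    exact hq (by simp only [bracket, hcon, tsum_zero])
  have h1 := momentum_eq_of_der_ne_zero hf (right_ne_zero_of_mul (left_ne_zero_of_mul hpw))
  have h2 := momentum_eq_of_der_ne_zero hg (right_ne_zero_of_mul hpw)
  rw [← p.2, Idx.momentum_add]
  rw [Idx.momentum_add] at h1 h2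
  linarith [momentum_unit_add_conjV w]

section Shift

variable {L b : ℝ} {N : ℕ} {θ μ θ₁ μ₁ : ℝ} {f g : Series js}

/-- All monomials satisfy `|k| < N^b`. -/
def LowFreq (b : ℝ) (N : ℕ) (f : Series js) : Prop := ∀ q, f q ≠ 0 → q.kSum < (N : ℝ) ^ b

lemma LowFreq.of_der (hf : LowFreq b N f) {w : Var js} {q : Idx js} (h : der w f q ≠ 0) :
    q.kSum < (N : ℝ) ^ b := by
  have := hf _ (right_ne_zero_of_mul h)
  rwa [kSum_add_unit] at this

lemma cCoef_add_uz {w : Var js} {σ : ℤˣ} {m : Site js} (h : w ≠ Sum.inr (Sum.inr (σ, m)))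
    (q : Idx js) : cCoef w (q + uz σ m) = cCoef w q := by
  rcases w with h' | h' | ⟨τ, j⟩
  · simp [cCoef, uz]
  · simp [cCoef, uz, unit]
  · have : (uz σ m).γ τ j = 0 := uz_γ_of_ne fun e => h (by rw [e])
    simp [cCoef, this]

/-- Contraction of a bilinear factor, which contains both high variables, with a factor of low
momentum: conservation of momentum forces the contracted variable to be low. -/
lemma der_shift_eq (hN : LargeCutoff js L b N) (hμ : μ < 6) (hθ : 1 < θ)
    (hμμ : μ₁ * (N : ℝ) ^ L + kappa js * (N : ℝ) ^ b ≤ μ * (N : ℝ) ^ L)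
    (hf : ShiftInvariant L b N θ μ f) (hfk : LowFreq b N f)
    (hg : NullSeries g) (hgk : LowFreq b N g) {p q : Idx js}
    (hpq : p.lowSum + q.lowSum < μ₁ * (N : ℝ) ^ L) {w : Var js}
    (hne : der (conjV w) g q ≠ 0) {σ σ' : ℤˣ} {m m' l l' : Site js}
    (hm : IsHigh N θ m) (hm' : IsHigh N θ m') (hl : IsHigh N θ l) (hl' : IsHigh N θ l')
    (hs : sgn m = sgn l)
    (hh : (σ : ℤ) * (m : ℤ) + (σ' : ℤ) * (m' : ℤ) = (σ : ℤ) * (l : ℤ) + (σ' : ℤ) * (l' : ℤ)) :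
    der w f (p + uz σ m + uz σ' m') = der w f (p + uz σ l + uz σ' l') := by
  by_cases hk : p.kSum < (N : ℝ) ^ b
  swap
  · have key : ∀ m m' : Site js, der w f (p + uz σ m + uz σ' m') = 0 := by
      intro m m'
      by_contra h
      exact hk (by simpa using hfk.of_der h)
    rw [key, key]
  have hmom := momentum_eq_of_der_ne_zero hg hne
  have hqk := hgk.of_der hne
  have hw : (unit w).lowSum ≤ kappa js * (N : ℝ) ^ b + q.lowSum := by
    rw [← lowSum_unit_conjV]
    refine (lowSum_unit_le _).trans ?_
    rw [Idx.momentum_add] at hmom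
    have : ((unit (conjV w)).momentum : ℝ) = -(q.momentum : ℝ) := by
      have : (unit (conjV w)).momentum = -q.momentum := by linarith
      exact_mod_cast this
    rw [this, abs_neg]
    refine (abs_momentum_le q).trans ?_
    gcongr
  have hlow : (p + unit w).IsLow L b N μ := by
    rw [isLow_iff, Idx.lowSum_add, kSum_add_unit]
    exact ⟨by linarith, hk⟩
  have hne_high : ∀ {τ : ℤˣ} {j : Site js}, IsHigh N θ j → w ≠ Sum.inr (Sum.inr (τ, j)) := by
    rintro τ j hj rfl
    refine not_isHigh_of_ne_zero hN hμ hθ hlow (σ := τ) (m := j) ?_ hj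
    have : (unit (Sum.inr (Sum.inr (τ, j)))).γ τ j = 1 := uz_γ_self τ j
    simp [this]
  have hcoef : ∀ m m' : Site js, IsHigh N θ m → IsHigh N θ m' →
      cCoef w (p + uz σ m + uz σ' m') = cCoef w p := by
    intro m m' hm hm'
    rw [cCoef_add_uz (hne_high hm'), cCoef_add_uz (hne_high hm)]
  have hidx : ∀ m m' : Site js, p + uz σ m + uz σ' m' + unit w =
      p + unit w + uz σ m + uz σ' m' := by
    intro m m'; abel
  unfold der
  rw [hcoef m m' hm hm', hcoef l l' hl hl', hidx, hidx,
    hf _ hlow σ σ' m m' l l' hm hm' hl hl' hs hh]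

lemma cCoef_eq_one (hN : LargeCutoff js L b N) (hμ : μ < 6) (hθ : 1 < θ) {p : Idx js}
    (hp : p.IsLow L b N μ) {σ τ : ℤˣ} {m j : Site js} (hj : IsHigh N θ j)
    (hne : (τ, j) ≠ (σ, m)) : cCoef (Sum.inr (Sum.inr (τ, j))) (p + uz σ m) = 1 := by
  have h1 : p.γ τ j = 0 := by
    by_contra h
    exact not_isHigh_of_ne_zero hN hμ hθ hp h hj
  rw [cCoef_add_uz (by simpa using hne)]
  simp [cCoef, h1]

/-- Contraction of two bilinear factors, each of which contains one of the high variables: the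
contracted variable is high, and determined by its sign `τ` and by conservation of momentum. -/
lemma tsum_bracketCoef_mixed (hN : LargeCutoff js L b N) (hμ : μ < 6) (hθ : 1 < θ)
    (hf : NullSeries f) {p q : Idx js} (hp : p.IsLow L b N μ)
    (hq : q.IsLow L b N μ) {σ σ' : ℤˣ} {m m' : Site js} (hm' : IsHigh N θ m')
    (hmN : (N : ℤ) < |(m : ℤ)|)
    (hmom : p.momentum + q.momentum + ((σ : ℤ) * (m : ℤ) + (σ' : ℤ) * (m' : ℤ)) = 0)
    (j : ℤˣ → Site js) (hj : ∀ τ, IsHigh N θ (j τ))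
    (hjm : ∀ τ : ℤˣ, (τ : ℤ) * (j τ : ℤ) = -(p.momentum + (σ : ℤ) * (m : ℤ))) :
    ∑' w, bracketCoef f g (p + uz σ m, q + uz σ' m') w =
      ∑ τ : ℤˣ, Complex.I * ((τ : ℤ) : ℂ) * f (p + uz σ m + uz τ (j τ)) *
        g (q + uz σ' m' + uz (-τ) (j τ)) := by
  classical
  have hinj : Function.Injective fun τ : ℤˣ => (Sum.inr (Sum.inr (τ, j τ)) : Var js) := by
    intro τ τ' h
    simp only [Sum.inr.injEq, Prod.mk.injEq] at h
    exact h.1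
  rw [tsum_eq_sum (s := Finset.univ.image fun τ : ℤˣ => (Sum.inr (Sum.inr (τ, j τ)) : Var js)),
    Finset.sum_image fun x _ y _ h => hinj h]
  · refine Finset.sum_congr rfl fun τ _ => ?_
    have h1 : (p + uz σ m + uz τ (j τ)).momentum = 0 := by
      rw [momentum_add_uz_add_uz, hjm]; ring
    have h2 : (q + uz σ' m' + uz (-τ) (j τ)).momentum = 0 := by
      have := hjm τ
      rw [momentum_add_uz_add_uz, Units.val_neg]
      linarith
    have n1 : (τ, j τ) ≠ (σ, m) := by
      intro h
      obtain ⟨rfl, h'⟩ := Prod.mk.inj h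
      rw [h', momentum_add_uz_add_uz] at h1
      have h3 := two_mul_momentum_lt hN hμ hp
      rcases Int.units_eq_one_or τ with e | e <;> subst e <;>
        simp only [Units.val_one, Units.val_neg, one_mul, neg_mul] at h1 <;> grind
    have n2 : (-τ, j τ) ≠ (σ', m') := (ne_of_momentum hN hμ hθ hq hm' h2).symm
    have e1 := cCoef_eq_one hN hμ hθ hp (hj τ) n1
    have e2 := cCoef_eq_one hN hμ hθ hq (hj τ) n2
    simp only [bracketCoef, der, conjV, poissonSign, e1, e2, one_mul]
    rfl
  · intro w hw
    by_contra hne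
    have h1 := momentum_eq_of_der_ne_zero hf (right_ne_zero_of_mul (left_ne_zero_of_mul hne))
    have h3 := two_mul_momentum_lt hN hμ hp
    -- otherwise the first factor would have only one high variable
    have hxy : (unit w).momentum ≠ 0 := by
      intro h0
      rw [Idx.momentum_add, Idx.momentum_add, momentum_uz, h0] at h1
      rcases Int.units_eq_one_or σ with e | e <;> subst e <;>
        simp only [Units.val_one, Units.val_neg, one_mul, neg_mul] at h1 <;> grind
    rcases w with h | h | ⟨τ, i⟩
    · exact hxy (by simp [Idx.momentum])
    · exact hxy (by simp [Idx.momentum, unit])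
    · have h1 : (p + uz σ m + uz τ i).momentum = 0 := h1
      rw [momentum_add_uz_add_uz] at h1
      have h4 : (τ : ℤ) * (i : ℤ) = (τ : ℤ) * (j τ : ℤ) := by rw [hjm]; linarith
      have h5 : i = j τ := by
        refine Subtype.ext ?_
        rcases Int.units_eq_one_or τ with e | e <;> subst e <;> simpa using h4
      refine hw (Finset.mem_image.2 ⟨τ, Finset.mem_univ _, ?_⟩)
      rw [h5]

lemma LowFreq.bracketCoef_eq_zero (hf : LowFreq b N f) (hg : LowFreq b N g) {p q : Idx js}
    (h : ¬ (p.kSum < (N : ℝ) ^ b ∧ q.kSum < (N : ℝ) ^ b)) (w : Var js) :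
    bracketCoef f g (p, q) w = 0 := by
  by_contra hne
  exact h ⟨hf.of_der (right_ne_zero_of_mul (left_ne_zero_of_mul hne)),
    hg.of_der (right_ne_zero_of_mul hne)⟩

/-- The sites that can be contracted with a high site: they are slightly less high. -/
lemma exists_contracted_site (hb : 0 ≤ b) (hN : LargeCutoff js L b N) (hθ : 1 < θ)
    (hθθ : θ * N + μ * (N : ℝ) ^ L + kappa js * (N : ℝ) ^ b ≤ θ₁ * N) {p : Idx js}
    (hp : p.IsLow L b N μ) {σ : ℤˣ} {m : Site js} (hm : IsHigh N θ₁ m) (τ : ℤˣ) :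
    ∃ j : Site js, IsHigh N θ j ∧ (τ : ℤ) * (j : ℤ) = -(p.momentum + (σ : ℤ) * (m : ℤ)) := by
  set i : ℤ := (τ : ℤ) * -(p.momentum + (σ : ℤ) * (m : ℤ)) with hi
  have hhigh : IsHigh N θ i := by
    have h1 := abs_momentum_le p
    obtain ⟨h2, h3⟩ := isLow_iff.1 hp
    have h4 : (kappa js : ℝ) * p.kSum ≤ kappa js * (N : ℝ) ^ b :=
      mul_le_mul_of_nonneg_left h3.le (Nat.cast_nonneg _)
    have h5 : |(m : ℝ)| ≤ |(p.momentum : ℝ)| + |(i : ℝ)| := by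
      have : |(m : ℤ)| ≤ |p.momentum| + |i| := by
        rw [hi]
        rcases Int.units_eq_one_or τ with e | e <;> rcases Int.units_eq_one_or σ with e' | e' <;>
          subst e <;> subst e' <;>
          simp only [Units.val_one, Units.val_neg, one_mul, neg_mul] <;> grind
      exact_mod_cast this
    unfold IsHigh at hm ⊢
    linarith
  have hN0 : (1 : ℝ) ≤ N := by
    have h1 : (0 : ℝ) ≤ (N : ℝ) ^ L := Real.rpow_nonneg (Nat.cast_nonneg _) _
    have h2 : (0 : ℝ) ≤ kappa js * (N : ℝ) ^ b := by positivity
    have h3 : (0 : ℝ) < N := by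
      unfold LargeCutoff at hN
      linarith
    exact_mod_cast h3
  have hκ : (kappa js : ℤ) < |i| := by
    refine lt_trans ?_ (hhigh.natCast_lt hθ)
    have h1 : (0 : ℝ) ≤ (N : ℝ) ^ L := Real.rpow_nonneg (Nat.cast_nonneg _) _
    have h2 : (1 : ℝ) ≤ (N : ℝ) ^ b := Real.one_le_rpow hN0 hb
    have h3 : (kappa js : ℝ) < N := by
      unfold LargeCutoff at hN
      nlinarith [Nat.cast_nonneg (α := ℝ) (kappa js)]
    exact_mod_cast h3
  refine ⟨⟨i, notMem_range_of_kappa_lt hκ⟩, hhigh, ?_⟩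
  simp only [hi, ← mul_assoc]
  rcases Int.units_eq_one_or τ with e | e <;> subst e <;> simp

/-- The contracted variable moves along with the high variables, so both factors are shifted in an
admissible way. -/
lemma tsum_bracketCoef_mixed_shift_eq (hb : 0 ≤ b) (hN : LargeCutoff js L b N) (hμ : μ < 6)
    (hθ : 1 < θ)
    (hθθ : θ * N + μ * (N : ℝ) ^ L + kappa js * (N : ℝ) ^ b ≤ θ₁ * N)
    (hf : NullSeries f) (hfk : LowFreq b N f) (hfs : ShiftInvariant L b N θ μ f)
    (hgk : LowFreq b N g) (hgs : ShiftInvariant L b N θ μ g) {p q : Idx js}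
    (hpq : p.lowSum + q.lowSum < μ * (N : ℝ) ^ L) {σ σ' : ℤˣ} {m m' l l' : Site js}
    (hm : IsHigh N θ₁ m) (hm' : IsHigh N θ m') (hl : IsHigh N θ₁ l) (hl' : IsHigh N θ l')
    (hmθ : IsHigh N θ m) (hlθ : IsHigh N θ l)
    (hs : sgn m = sgn l) (hs' : sgn m' = sgn l')
    (hh : (σ : ℤ) * (m : ℤ) + (σ' : ℤ) * (m' : ℤ) = (σ : ℤ) * (l : ℤ) + (σ' : ℤ) * (l' : ℤ))
    (hmom : p.momentum + q.momentum + ((σ : ℤ) * (m : ℤ) + (σ' : ℤ) * (m' : ℤ)) = 0) :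
    ∑' w, bracketCoef f g (p + uz σ m, q + uz σ' m') w =
      ∑' w, bracketCoef f g (p + uz σ l, q + uz σ' l') w := by
  by_cases hk : p.kSum < (N : ℝ) ^ b ∧ q.kSum < (N : ℝ) ^ b
  swap
  · have key : ∀ m m' : Site js, ∑' w, bracketCoef f g (p + uz σ m, q + uz σ' m') w = 0 := by
      intro m m'
      have := hfk.bracketCoef_eq_zero hgk (p := p + uz σ m) (q := q + uz σ' m') (by simpa using hk)
      simp only [this, tsum_zero]
    rw [key, key]
  have hp : p.IsLow L b N μ := isLow_iff.2 ⟨by linarith [q.lowSum_nonneg], hk.1⟩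
  have hq : q.IsLow L b N μ := isLow_iff.2 ⟨by linarith [p.lowSum_nonneg], hk.2⟩
  choose j hj hjm using fun τ => exists_contracted_site hb hN hθ hθθ hp (σ := σ) hm τ
  choose i hi him using fun τ => exists_contracted_site hb hN hθ hθθ hp (σ := σ) hl τ
  rw [tsum_bracketCoef_mixed hN hμ hθ hf hp hq hm' (hmθ.natCast_lt hθ) hmom j hj hjm,
    tsum_bracketCoef_mixed hN hμ hθ hf hp hq hl' (hlθ.natCast_lt hθ) (hh ▸ hmom) i hi him]
  refine Finset.sum_congr rfl fun τ _ => ?_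
  have e1 := hjm τ
  have e2 := him τ
  rw [hfs p hp σ τ m (j τ) l (i τ) hmθ (hj τ) hlθ (hi τ) hs (by linarith),
    hgs q hq σ' (-τ) m' (j τ) l' (i τ) hm' (hj τ) hl' (hi τ) hs'
      (by rw [Units.val_neg]; linarith)]

lemma bracket_eq_tsum (h : Bracketable f g) (q : Idx js) :
    Summable (fun p : Fib q => ∑' w, bracketCoef f g p.1 w) ∧
      bracket f g q = ∑' p : Fib q, ∑' w, bracketCoef f g p.1 w :=
  ⟨(h.summable q).prod, (h.summable q).tsum_prod⟩

/-- The bracket of two Töplitz functions is Töplitz, for slightly smaller low momentum and slightly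
larger high momentum. -/
lemma bracket_shiftInvariant (hb : 0 ≤ b) (hN : LargeCutoff js L b N) (hμ : μ < 6) (hθ : 1 < θ)
    (hμμ : μ₁ * (N : ℝ) ^ L + kappa js * (N : ℝ) ^ b ≤ μ * (N : ℝ) ^ L)
    (hθθ : θ * N + μ * (N : ℝ) ^ L + kappa js * (N : ℝ) ^ b ≤ θ₁ * N) (hθ₁ : θ ≤ θ₁)
    (hfg : Bracketable f g)
    (hf : NullSeries f) (hfk : LowFreq b N f) (hfs : ShiftInvariant L b N θ μ f)
    (hg : NullSeries g) (hgk : LowFreq b N g) (hgs : ShiftInvariant L b N θ μ g) :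
    ShiftInvariant L b N θ₁ μ₁ (bracket f g) := by
  intro q hq σ σ' m m' l l' hm hm' hl hl' hs hh
  have hκ : (0 : ℝ) ≤ kappa js * (N : ℝ) ^ b := by positivity
  have hqμ : q.IsLow L b N μ := isLow_iff.2
    ⟨lt_of_lt_of_le (isLow_iff.1 hq).1 (by linarith), (isLow_iff.1 hq).2⟩
  have hθhigh : ∀ {j : ℤ}, IsHigh N θ₁ j → IsHigh N θ j := fun h =>
    lt_of_le_of_lt (mul_le_mul_of_nonneg_right hθ₁ (Nat.cast_nonneg _)) h
  have hmom : (q + uz σ l + uz σ' l').momentum = (q + uz σ m + uz σ' m').momentum := by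
    rw [momentum_add_uz_add_uz, momentum_add_uz_add_uz, hh]
  by_cases h0 : (q + uz σ m + uz σ' m').momentum = 0
  swap
  · have e1 : bracket f g (q + uz σ m + uz σ' m') = 0 := by
      by_contra h
      exact h0 (bracket_null hf hg _ h)
    have e2 : bracket f g (q + uz σ l + uz σ' l') = 0 := by
      by_contra h
      exact h0 (hmom ▸ bracket_null hf hg _ h)
    rw [e1, e2]
  have h0' := hmom.trans h0
  have hs' : sgn m' = sgn l' := by
    rw [sgn_eq_of_momentum hN hμ hθ hqμ (hθhigh hm) (hθhigh hm') h0,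
      sgn_eq_of_momentum hN hμ hθ hqμ (hθhigh hl) (hθhigh hl') h0', hs]
  have hexp : ∀ {τ : ℤˣ} {j : Site js}, IsHigh N θ₁ j → q.expo (Sum.inr (τ, j)) = 0 := by
    intro τ j hj
    rw [Idx.expo_inr]
    by_contra h
    exact not_isHigh_of_ne_zero hN hμ hθ hqμ h (hθhigh hj)
  have hsplit : ∀ m m' : Site js, IsHigh N θ₁ m → IsHigh N θ₁ m' →
      (q + uz σ m + uz σ' m').momentum = 0 → bracket f g (q + uz σ m + uz σ' m') =
      (∑' p : Fib q, ∑' w, bracketCoef f g (p.1.1 + uz σ m + uz σ' m', p.1.2) w +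
        ∑' p : Fib q, ∑' w, bracketCoef f g (p.1.1 + uz σ' m', p.1.2 + uz σ m) w) +
      (∑' p : Fib q, ∑' w, bracketCoef f g (p.1.1 + uz σ m, p.1.2 + uz σ' m') w +
        ∑' p : Fib q, ∑' w, bracketCoef f g (p.1.1, p.1.2 + uz σ m + uz σ' m') w) := by
    intro m m' hm hm' h0
    obtain ⟨h1, h2⟩ := bracket_eq_tsum hfg (q + uz σ m + uz σ' m')
    rw [h2]
    refine tsum_Fib_add_add (H := fun p => ∑' w, bracketCoef f g p w) (hexp hm) (hexp hm') ?_ h1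
    exact fun h => ne_of_momentum hN hμ hθ hqμ (hθhigh hm) h0 (Sum.inr_injective h)
  have hlow : ∀ p : Fib q, p.1.1.lowSum + p.1.2.lowSum < μ₁ * (N : ℝ) ^ L := by
    intro p
    rw [← Idx.lowSum_add, p.2]
    exact (isLow_iff.1 hq).1
  have hlowμ : ∀ p : Fib q, p.1.1.lowSum + p.1.2.lowSum < μ * (N : ℝ) ^ L := fun p =>
    lt_of_lt_of_le (hlow p) (by linarith)
  have hpmom : ∀ p : Fib q, p.1.1.momentum + p.1.2.momentum +
      ((σ : ℤ) * (m : ℤ) + (σ' : ℤ) * (m' : ℤ)) = 0 := by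
    intro p
    rw [← Idx.momentum_add, p.2, ← momentum_add_uz_add_uz]
    exact h0
  rw [hsplit m m' hm hm' h0, hsplit l l' hl hl' h0']
  congr 2
  · refine tsum_congr fun p => tsum_congr fun w => ?_
    unfold bracketCoef
    by_cases hne : der (conjV w) g p.1.2 = 0
    · simp only [hne, mul_zero]
    · rw [der_shift_eq hN hμ hθ hμμ hfs hfk hg hgk (hlow p) hne (hθhigh hm) (hθhigh hm')
        (hθhigh hl) (hθhigh hl') hs hh]
  · refine tsum_congr fun p => ?_
    refine tsum_bracketCoef_mixed_shift_eq hb hN hμ hθ hθθ hf hfk hfs hgk hgs (hlowμ p) hm'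
      (hθhigh hm) hl' (hθhigh hl) (hθhigh hm') (hθhigh hl') hs' hs (by linarith) ?_
    rw [add_comm ((σ' : ℤ) * (m' : ℤ))]
    exact hpmom p
  · refine tsum_congr fun p => ?_
    exact tsum_bracketCoef_mixed_shift_eq hb hN hμ hθ hθθ hf hfk hfs hgk hgs (hlowμ p) hm
      (hθhigh hm') hl (hθhigh hl') (hθhigh hm) (hθhigh hl) hs hs' hh (hpmom p)
  · refine tsum_congr fun p => tsum_congr fun w => ?_
    unfold bracketCoef
    by_cases hne : der w f p.1.1 = 0
    · simp only [hne, mul_zero, zero_mul]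
    · have hlow' := hlow p
      rw [add_comm] at hlow'
      rw [der_shift_eq hN hμ hθ hμμ hgs hgk hf hfk hlow' (by rwa [conjV_conjV]) (hθhigh hm)
        (hθhigh hm') (hθhigh hl) (hθhigh hl') hs hh]

end Shift

/-! ### Cut-offs and Töplitz approximants -/

/-- Monomials of high frequency gain an exponentially small factor when the strip shrinks. -/
lemma mNorm_le_exp_mul {a p s s' r K : ℝ} (hs' : 0 < s') (hss : s' ≤ s) (h2 : s ≤ 2 * s')
    (hr : 0 < r) {P : Idx js → ℝ≥0∞} (hP : ∀ q, P q ≠ 0 → K ≤ q.kSum) :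
    mNorm a p s' r P ≤ ENNReal.ofReal (2 * Real.exp (-(K * (s - s')))) * mNorm a p s r P := by
  refine iSup₂_le fun X hX => ?_
  set e := ENNReal.ofReal (Real.exp (-(K * (s - s')))) with he
  have hVF : majVF s' P X ≤ fun v => e * majVF s P X v := by
    intro v
    refine le_of_le_of_eq (ENNReal.tsum_le_tsum fun q => ?_) ENNReal.tsum_mul_left
    by_cases h0 : dM (conjV v) P q = 0
    · simp [h0]
    have hq : K ≤ q.kSum := by
      have := hP _ (right_ne_zero_of_mul h0)
      rwa [kSum_add_unit] at this
    rw [mul_left_comm]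
    refine mul_le_mul' le_rfl ?_
    unfold wt
    rw [← mul_assoc, he, ← ENNReal.ofReal_mul (Real.exp_pos _).le, ← Real.exp_add]
    refine mul_le_mul' (ENNReal.ofReal_le_ofReal (Real.exp_le_exp.2 ?_)) le_rfl
    change q.kSum * s' ≤ -(K * (s - s')) + q.kSum * s
    nlinarith
  calc vecNorm a p s' r (majVF s' P X) ≤ ENNReal.ofReal 2 * vecNorm a p s r (majVF s' P X) :=
        vecNorm_le_mul (hs'.trans_le hss) hr hs' hr h2 (by linarith) (by nlinarith) _
    _ ≤ ENNReal.ofReal 2 * (e * mNorm a p s r P) := by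
        refine mul_le_mul' le_rfl ((vecNorm_mono hVF).trans ?_)
        rw [vecNorm_const_mul]
        exact mul_le_mul' le_rfl (le_mNorm P hX)
    _ = _ := by rw [ENNReal.ofReal_mul (by norm_num), mul_assoc]

/-- The function `x ↦ x e^{-c x^b}` decreases where `b c x^b ≥ 1`. -/
lemma mul_exp_neg_rpow_le {b c x y : ℝ} (hb : 0 < b) (hx : 0 < x) (hxy : x ≤ y)
    (h : 1 ≤ b * c * x ^ b) : y * Real.exp (-(y ^ b * c)) ≤ x * Real.exp (-(x ^ b * c)) := by
  have hy : 0 < y := hx.trans_le hxy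
  have hlog : 0 ≤ Real.log (y / x) := Real.log_nonneg ((one_le_div hx).2 hxy)
  have h1 : y ^ b = x ^ b * Real.exp (Real.log (y / x) * b) := by
    rw [← Real.rpow_def_of_pos (by positivity), ← Real.mul_rpow hx.le (by positivity)]
    congr 1
    field_simp
  have h2 : Real.log (y / x) * b + 1 ≤ Real.exp (Real.log (y / x) * b) := Real.add_one_le_exp _
  have hxb : 0 < x ^ b := Real.rpow_pos_of_pos hx b
  have hc : 0 < c := by
    by_contra hc
    nlinarith [mul_nonneg hb.le hxb.le]
  have h3 : Real.log (y / x) ≤ c * (y ^ b - x ^ b) := by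
    rw [h1]
    have h4 : 0 ≤ c * x ^ b * (Real.exp (Real.log (y / x) * b) - (Real.log (y / x) * b + 1)) :=
      mul_nonneg (by positivity) (by linarith)
    nlinarith
  have h5 : y = x * Real.exp (Real.log (y / x)) := by
    rw [Real.exp_log (by positivity)]
    field_simp
  calc y * Real.exp (-(y ^ b * c))
      = x * Real.exp (Real.log (y / x) + -(y ^ b * c)) := by
        rw [Real.exp_add, ← mul_assoc, ← h5]
    _ ≤ _ := mul_le_mul_of_nonneg_left (Real.exp_le_exp.2 (by linarith)) hx.le

section Cutoff

variable {L b : ℝ} {N₀ N : ℕ} {θ μ θ₁ μ₁ : ℝ}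

lemma largeCutoff_of_le (hL : L < 1) (hb : b < 1) (hN₀ : 0 < N₀) (hN : N₀ ≤ N)
    (h : 12 * (N₀ : ℝ) ^ (L - 1) + 2 * kappa js * (N₀ : ℝ) ^ (b - 1) < 1) :
    LargeCutoff js L b N := by
  have h0 : (0 : ℝ) < N₀ := by exact_mod_cast hN₀
  have h1 : (N₀ : ℝ) ≤ N := by exact_mod_cast hN
  have hpos : (0 : ℝ) < N := h0.trans_le h1
  have e1 := Real.rpow_le_rpow_of_nonpos h0 h1 (show L - 1 ≤ 0 by linarith)
  have e2 := Real.rpow_le_rpow_of_nonpos h0 h1 (show b - 1 ≤ 0 by linarith)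
  have e3 : (kappa js : ℝ) * (N : ℝ) ^ (b - 1) ≤ kappa js * (N₀ : ℝ) ^ (b - 1) :=
    mul_le_mul_of_nonneg_left e2 (Nat.cast_nonneg _)
  have e4 : 12 * (N : ℝ) ^ (L - 1) + 2 * kappa js * (N : ℝ) ^ (b - 1) < 1 := by nlinarith
  rw [Real.rpow_sub_one hpos.ne', Real.rpow_sub_one hpos.ne'] at e4
  unfold LargeCutoff
  have e5 : 12 * ((N : ℝ) ^ L / N) + 2 * kappa js * ((N : ℝ) ^ b / N) =
      (12 * (N : ℝ) ^ L + 2 * kappa js * (N : ℝ) ^ b) / N := by ring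
  rwa [e5, div_lt_one hpos] at e4

lemma lowMomentum_cutoff_le (hbL : b < L) (hN₀ : 0 < N₀) (hN : N₀ ≤ N)
    (h : kappa js * (N₀ : ℝ) ^ (b - L) < μ - μ₁) :
    μ₁ * (N : ℝ) ^ L + kappa js * (N : ℝ) ^ b ≤ μ * (N : ℝ) ^ L := by
  have h0 : (0 : ℝ) < N₀ := by exact_mod_cast hN₀
  have h1 : (N₀ : ℝ) ≤ N := by exact_mod_cast hN
  have hpos : (0 : ℝ) < N := h0.trans_le h1
  have e2 := Real.rpow_le_rpow_of_nonpos h0 h1 (show b - L ≤ 0 by linarith)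
  have e3 : (kappa js : ℝ) * (N : ℝ) ^ (b - L) ≤ kappa js * (N₀ : ℝ) ^ (b - L) :=
    mul_le_mul_of_nonneg_left e2 (Nat.cast_nonneg _)
  have e4 : (N : ℝ) ^ b = (N : ℝ) ^ (b - L) * (N : ℝ) ^ L := by
    rw [← Real.rpow_add hpos, sub_add_cancel]
  have e5 : 0 < (N : ℝ) ^ L := Real.rpow_pos_of_pos hpos L
  rw [e4]
  nlinarith

lemma highMomentum_cutoff_le (hL : L < 1) (hb : b < 1) (hμ : 0 ≤ μ) (hN₀ : 0 < N₀) (hN : N₀ ≤ N)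
    (h : μ * (N₀ : ℝ) ^ (L - 1) + kappa js * (N₀ : ℝ) ^ (b - 1) < θ₁ - θ) :
    θ * N + μ * (N : ℝ) ^ L + kappa js * (N : ℝ) ^ b ≤ θ₁ * N := by
  have h0 : (0 : ℝ) < N₀ := by exact_mod_cast hN₀
  have h1 : (N₀ : ℝ) ≤ N := by exact_mod_cast hN
  have hpos : (0 : ℝ) < N := h0.trans_le h1
  have e1 := mul_le_mul_of_nonneg_left
    (Real.rpow_le_rpow_of_nonpos h0 h1 (show L - 1 ≤ 0 by linarith)) hμ
  have e2 := Real.rpow_le_rpow_of_nonpos h0 h1 (show b - 1 ≤ 0 by linarith)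
  have e3 : (kappa js : ℝ) * (N : ℝ) ^ (b - 1) ≤ kappa js * (N₀ : ℝ) ^ (b - 1) :=
    mul_le_mul_of_nonneg_left e2 (Nat.cast_nonneg _)
  have e4 : (N : ℝ) ^ b = (N : ℝ) ^ (b - 1) * N := by
    rw [Real.rpow_sub_one hpos.ne', div_mul_cancel₀ _ hpos.ne']
  have e5 : (N : ℝ) ^ L = (N : ℝ) ^ (L - 1) * N := by
    rw [Real.rpow_sub_one hpos.ne', div_mul_cancel₀ _ hpos.ne']
  rw [e4, e5]
  nlinarith

end Cutoff

section Approximant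

variable {L b : ℝ} {N : ℕ} {θ μ : ℝ}

/-- The projection on bilinear monomials, for one series. -/
def bil (L b : ℝ) (N : ℕ) (θ μ : ℝ) (f : Series js) : Series js :=
  Set.indicator {q | q.IsBilinear L b N θ μ} f

lemma maj_bil_le (f : Series js) : maj (bil L b N θ μ f) ≤ maj f := by
  intro q
  unfold maj bil
  by_cases h : q ∈ {q : Idx js | q.IsBilinear L b N θ μ}
  · rw [Set.indicator_of_mem h]
  · rw [Set.indicator_of_notMem h]
    simp

/-- The series `f` with its bilinear part replaced by a Töplitz series `h`, and with the frequencies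
`|k| ≥ N^b` cut off. -/
def approximant (L b : ℝ) (N : ℕ) (θ μ : ℝ) (f h : Series js) : Series js := fun q =>
  if q.kSum < (N : ℝ) ^ b then f q - bil L b N θ μ f q + h q else 0

/-- The part of frequencies `|k| ≥ N^b`. -/
def highFreq (b : ℝ) (N : ℕ) (f : Series js) : Series js := fun q =>
  if q.kSum < (N : ℝ) ^ b then 0 else f q

variable {f h : Series js}

lemma approximant_lowFreq : LowFreq b N (approximant L b N θ μ f h) := by
  intro q hq
  by_contra hk
  exact hq (by simp only [approximant, if_neg hk])

lemma approximant_null (hf : NullSeries f) (hh : ∀ q, h q ≠ 0 → q.IsBilinear L b N θ μ) :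
    NullSeries (approximant L b N θ μ f h) := by
  intro q hq
  by_contra hmom
  refine hq ?_
  have h1 : f q = 0 := by
    by_contra h1
    exact hmom (hf q h1)
  have h2 : h q = 0 := by
    by_contra h2
    exact hmom (hh q h2).1
  have h3 : bil L b N θ μ f q = 0 := by
    unfold bil
    by_cases h : q ∈ {q : Idx js | q.IsBilinear L b N θ μ}
    · rwa [Set.indicator_of_mem h]
    · rw [Set.indicator_of_notMem h]
  simp [approximant, h1, h2, h3]

/-- On bilinear monomials the approximant is the Töplitz series `h`. -/
lemma approximant_shiftInvariant (hf : NullSeries f)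
    (hh : ∀ q, h q ≠ 0 → q.IsBilinear L b N θ μ) (hinv : ShiftInvariant L b N θ μ h) :
    ShiftInvariant L b N θ μ (approximant L b N θ μ f h) := by
  have key : ∀ q : Idx js, q.IsLow L b N μ → ∀ (σ σ' : ℤˣ) (m m' : Site js), IsHigh N θ m →
      IsHigh N θ m' → approximant L b N θ μ f h (q + uz σ m + uz σ' m') =
        h (q + uz σ m + uz σ' m') := by
    intro q hq σ σ' m m' hm hm'
    by_cases h0 : (q + uz σ m + uz σ' m').momentum = 0
    · have hbil : (q + uz σ m + uz σ' m') ∈ {q : Idx js | q.IsBilinear L b N θ μ} :=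
        isBilinear_iff.2 ⟨h0, σ, σ', m, m', q, hm, hm', rfl, hq⟩
      have hk : (q + uz σ m + uz σ' m').kSum < (N : ℝ) ^ b := by
        simpa using (isLow_iff.1 hq).2
      simp only [approximant, if_pos hk, bil, Set.indicator_of_mem hbil, sub_self, zero_add]
    · have h1 : approximant L b N θ μ f h (q + uz σ m + uz σ' m') = 0 := by
        by_contra h1
        exact h0 (approximant_null hf hh _ h1)
      have h2 : h (q + uz σ m + uz σ' m') = 0 := by
        by_contra h2
        exact h0 (hh _ h2).1
      rw [h1, h2]
  intro q hq σ σ' m m' l l' hm hm' hl hl' hs heq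
  rw [key q hq σ σ' m m' hm hm', key q hq σ σ' l l' hl hl']
  exact hinv q hq σ σ' m m' l l' hm hm' hl hl' hs heq

lemma maj_approximant_le (hh : ∀ q, h q ≠ 0 → q.IsBilinear L b N θ μ) :
    maj (approximant L b N θ μ f h) ≤ maj f + maj h := by
  intro q
  simp only [maj, approximant, Pi.add_apply]
  split_ifs
  · by_cases hq : q ∈ {q : Idx js | q.IsBilinear L b N θ μ}
    · simp [bil, Set.indicator_of_mem hq]
    · have h1 : h q = 0 := by
        by_contra h1
        exact hq (hh q h1)
      simp [bil, Set.indicator_of_notMem hq, h1]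
  · simp

/-- The error of the approximant consists of high frequencies and of the Töplitz defect. -/
lemma maj_sub_approximant_le (f h : Series js) :
    maj (fun q => (N : ℂ) * (f - approximant L b N θ μ f h) q) ≤
      (fun q => ENNReal.ofReal N * maj (highFreq b N f) q) +
        maj (fun q => (N : ℂ) * (bil L b N θ μ f q - h q)) := by
  intro q
  simp only [maj, approximant, highFreq, Pi.add_apply, Pi.sub_apply]
  split_ifs
  · refine le_trans (le_of_eq ?_) le_add_self
    congr 2
    ring
  · rw [sub_zero, enorm_mul, ← ofReal_norm (N : ℂ), Complex.norm_natCast]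
    exact le_self_add

lemma maj_highFreq_le (f : Series js) : maj (highFreq b N f) ≤ maj f := by
  intro q
  simp only [maj, highFreq]
  split_ifs <;> simp

end Approximant

lemma maj_sub_le (f g : Series js) : maj (f - g) ≤ maj f + maj g := fun _ => enorm_sub_le

lemma maj_add_le (f g : Series js) : maj (f + g) ≤ maj f + maj g := fun _ => enorm_add_le _ _

section Estimate

variable {a p s s₁ s' r : ℝ} {L b : ℝ} {N : ℕ} {θ μ : ℝ}

/-- The sizes of a quasi-Töplitz series, of its approximant and of the rescaled error. -/
lemma mNorm_approximant_le (hs' : 0 < s') (hss : s' ≤ s) (h2 : s ≤ 2 * s') (hr : 0 < r)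
    (hN : 2 * N * Real.exp (-((N : ℝ) ^ b * (s - s'))) ≤ 1) {f h : Series js}
    (hh : ∀ q, h q ≠ 0 → q.IsBilinear L b N θ μ) {A : ℝ≥0∞} (h1 : mNorm a p s r (maj f) ≤ A)
    (h3 : mNorm a p s r (maj h) ≤ A)
    (h4 : mNorm a p s r (maj fun q => (N : ℂ) * (bil L b N θ μ f q - h q)) ≤ A) :
    mNorm a p s' r (maj f) ≤ 2 * A ∧ mNorm a p s' r (maj (approximant L b N θ μ f h)) ≤ 4 * A ∧
    mNorm a p s' r (maj fun q => (N : ℂ) * (f - approximant L b N θ μ f h) q) ≤ 3 * A := by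
  have hdouble : ∀ {P : Idx js → ℝ≥0∞}, mNorm a p s r P ≤ A → mNorm a p s' r P ≤ 2 * A := by
    intro P hP
    refine (mNorm_le_mul (hs'.trans_le hss) hs' hr hss le_rfl h2 (by linarith) (by nlinarith)
      P).trans ?_
    rw [ENNReal.ofReal_ofNat]
    gcongr
  refine ⟨hdouble h1, ?_, ?_⟩
  · calc _ ≤ mNorm a p s' r (maj f + maj h) := mNorm_mono (maj_approximant_le hh)
      _ ≤ 2 * A + 2 * A := (mNorm_add_le _ _ _ _ _ _).trans (add_le_add (hdouble h1) (hdouble h3))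
      _ = 4 * A := by ring
  · have hU : mNorm a p s' r (fun q => ENNReal.ofReal N * maj (highFreq b N f) q) ≤ A := by
      calc _ ≤ ENNReal.ofReal N * mNorm a p s' r (maj (highFreq b N f)) :=
            mNorm_const_mul_le _ _ _ _ _ _
        _ ≤ ENNReal.ofReal N * (ENNReal.ofReal (2 * Real.exp (-((N : ℝ) ^ b * (s - s')))) *
              mNorm a p s r (maj (highFreq b N f))) := by
            refine mul_le_mul' le_rfl (mNorm_le_exp_mul hs' hss h2 hr fun q hq => ?_)
            by_contra hk
            exact hq (by simp only [maj, highFreq, if_pos (not_le.1 hk), enorm_zero])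
        _ ≤ ENNReal.ofReal N * (ENNReal.ofReal (2 * Real.exp (-((N : ℝ) ^ b * (s - s')))) * A) := by
            gcongr
            exact (mNorm_mono (maj_highFreq_le f)).trans h1
        _ = ENNReal.ofReal (2 * N * Real.exp (-((N : ℝ) ^ b * (s - s')))) * A := by
            rw [← mul_assoc, ← ENNReal.ofReal_mul (Nat.cast_nonneg _)]
            congr 2
            ring
        _ ≤ A := mul_le_of_le_one_left zero_le (ENNReal.ofReal_le_one.2 hN)
    calc _ ≤ _ := mNorm_mono (maj_sub_approximant_le f h)
      _ ≤ A + 2 * A := (mNorm_add_le _ _ _ _ _ _).trans (add_le_add hU (hdouble h4))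
      _ = 3 * A := by ring

end Estimate

/-! ### The quasi-Töplitz norm of the bracket -/

lemma ShiftInvariant.bil {L b : ℝ} {N : ℕ} {θ μ : ℝ} {f : Series js}
    (hf : ShiftInvariant L b N θ μ f) : ShiftInvariant L b N θ μ (bil L b N θ μ f) := by
  intro q hq σ σ' m m' l l' hm hm' hl hl' hs hh
  have hmom : (q + uz σ l + uz σ' l').momentum = (q + uz σ m + uz σ' m').momentum := by
    rw [momentum_add_uz_add_uz, momentum_add_uz_add_uz, hh]
  unfold QuasiToplitz.bil
  by_cases h0 : (q + uz σ m + uz σ' m').momentum = 0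
  · have h1 : (q + uz σ m + uz σ' m') ∈ {q : Idx js | q.IsBilinear L b N θ μ} :=
      isBilinear_iff.2 ⟨h0, σ, σ', m, m', q, hm, hm', rfl, hq⟩
    have h2 : (q + uz σ l + uz σ' l') ∈ {q : Idx js | q.IsBilinear L b N θ μ} :=
      isBilinear_iff.2 ⟨hmom.trans h0, σ, σ', l, l', q, hl, hl', rfl, hq⟩
    rw [Set.indicator_of_mem h1, Set.indicator_of_mem h2]
    exact hf q hq σ σ' m m' l l' hm hm' hl hl' hs hh
  · rw [Set.indicator_of_notMem fun h => h0 h.1,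
      Set.indicator_of_notMem fun h => h0 (hmom.symm.trans h.1)]

lemma mNorm_bracket_le {a p s r s₁ r₁ δ : ℝ} {A B : ℝ≥0∞} (hs : 0 < s) (hr : 0 < r)
    (hs₁ : 0 < s₁) (hr₁ : 0 < r₁) (hδ : 0 < δ)
    (h1 : s₁ + s * δ ≤ s) (h2 : r₁ + r * δ ≤ r) (h3 : s ≤ 2 * s₁) (h4 : r ≤ 2 * r₁)
    {f g : Series js} (hA : A ≠ 0) (hA' : A ≠ ∞) (hB : B ≠ 0) (hB' : B ≠ ∞)
    (hf : mNorm a p s r (maj f) ≤ A) (hg : mNorm a p s r (maj g) ≤ B) :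
    mNorm a p s₁ r₁ (maj (bracket f g)) ≤ ENNReal.ofReal (8 * δ⁻¹) * A * B :=
  (mNorm_mono (maj_bracket_le f g)).trans
    (mNorm_majBracket_le hs hr hs₁ hr₁ hδ h1 h2 h3 h4 hA hA' hB hB' hf hg)

/-- The bracket is close to the bracket of the approximants `f'`, `g'`:
`N ({f, g} - {f', g'}) = {N (f - f'), g} + {f', N (g - g')}`. -/
lemma mNorm_bracket_sub_le {a p s r s₁ r₁ δ : ℝ} {A B : ℝ≥0∞} (ha : 0 ≤ a) (hp : 0 ≤ p)
    (hs : 0 < s) (hr : 0 < r) (hs₁ : 0 < s₁) (hr₁ : 0 < r₁) (hδ : 0 < δ)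
    (h1 : s₁ + s * δ ≤ s) (h2 : r₁ + r * δ ≤ r) (h3 : s ≤ 2 * s₁) (h4 : r ≤ 2 * r₁)
    {f f' g g' : Series js} (c : ℂ) (hA : A ≠ 0) (hA' : A ≠ ∞) (hB : B ≠ 0) (hB' : B ≠ ∞)
    (hf : mNorm a p s r (maj f) ≤ 2 * A) (hf' : mNorm a p s r (maj f') ≤ 4 * A)
    (hff' : mNorm a p s r (maj fun q => c * (f - f') q) ≤ 3 * A)
    (hg : mNorm a p s r (maj g) ≤ 2 * B) (hg' : mNorm a p s r (maj g') ≤ 4 * B)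
    (hgg' : mNorm a p s r (maj fun q => c * (g - g') q) ≤ 3 * B) :
    mNorm a p s₁ r₁ (maj fun q => c * (bracket f g q - bracket f' g' q)) ≤
      18 * (ENNReal.ofReal (8 * δ⁻¹) * A * B) := by
  have fin : ∀ {C : ℝ≥0∞} (k : ℕ), C ≠ ∞ → (k : ℝ≥0∞) * C ≠ ∞ := fun k h =>
    ENNReal.mul_ne_top (ENNReal.natCast_ne_top k) h
  have pos : ∀ {C : ℝ≥0∞} (k : ℕ), k ≠ 0 → C ≠ 0 → (k : ℝ≥0∞) * C ≠ 0 := fun k hk h =>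
    mul_ne_zero (Nat.cast_ne_zero.2 hk) h
  have tf : mNorm a p s r (maj f) ≠ ∞ := ne_top_of_le_ne_top (fin 2 hA') hf
  have tf' : mNorm a p s r (maj f') ≠ ∞ := ne_top_of_le_ne_top (fin 4 hA') hf'
  have tg : mNorm a p s r (maj g) ≠ ∞ := ne_top_of_le_ne_top (fin 2 hB') hg
  have tg' : mNorm a p s r (maj g') ≠ ∞ := ne_top_of_le_ne_top (fin 4 hB') hg'
  have tsub : ∀ {f f' : Series js}, mNorm a p s r (maj f) ≠ ∞ → mNorm a p s r (maj f') ≠ ∞ →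
      mNorm a p s r (maj (f - f')) ≠ ∞ := fun h h' =>
    ne_top_of_le_ne_top (ENNReal.add_ne_top.2 ⟨h, h'⟩)
      ((mNorm_mono (maj_sub_le _ _)).trans (mNorm_add_le _ _ _ _ _ _))
  have hB1 : Bracketable f g := bracketable_of_mNorm ha hp hs.le hr tf tg
  have hB2 : Bracketable f' g' := bracketable_of_mNorm ha hp hs.le hr tf' tg'
  have hB3 : Bracketable (f - f') g := bracketable_of_mNorm ha hp hs.le hr (tsub tf tf') tg
  have hB4 : Bracketable f' (g - g') := bracketable_of_mNorm ha hp hs.le hr tf' (tsub tg tg')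
  have heq : (fun q => c * (bracket f g q - bracket f' g' q)) =
      bracket (fun q => c * (f - f') q) g + bracket f' (fun q => c * (g - g') q) :=
    funext fun q => const_mul_bracket_sub hB1 hB2 hB3 hB4 c q
  rw [heq]
  calc _ ≤ _ := (mNorm_mono (maj_add_le _ _)).trans (mNorm_add_le _ _ _ _ _ _)
    _ ≤ ENNReal.ofReal (8 * δ⁻¹) * (3 * A) * (2 * B) +
          ENNReal.ofReal (8 * δ⁻¹) * (4 * A) * (3 * B) :=
        add_le_add
          (mNorm_bracket_le hs hr hs₁ hr₁ hδ h1 h2 h3 h4 (pos 3 (by norm_num) hA) (fin 3 hA')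
            (pos 2 (by norm_num) hB) (fin 2 hB') hff' hg)
          (mNorm_bracket_le hs hr hs₁ hr₁ hδ h1 h2 h3 h4 (pos 4 (by norm_num) hA) (fin 4 hA')
            (pos 3 (by norm_num) hB) (fin 3 hB') hf' hgg')
    _ = _ := by ring

section Norm

variable {𝒪 : Set (Fin n → ℝ)} {a p L b s r s₁ r₁ : ℝ} {N₀ N₁ : ℕ} {θ μ θ₁ μ₁ : ℝ}
  {f g : 𝒪 → Series js}

lemma mNorm_le_hamNorm (f : 𝒪 → Series js) (ξ : 𝒪) :
    mNorm a p s r (maj (f ξ)) ≤ hamNorm a p s r f := by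
  rw [hamNorm_eq]
  exact le_iSup (fun ξ => mNorm a p s r (maj (f ξ))) ξ

lemma hamNorm_le {A : ℝ≥0∞} (h : ∀ ξ, mNorm a p s r (maj (f ξ)) ≤ A) : hamNorm a p s r f ≤ A := by
  rw [hamNorm_eq]
  exact iSup_le h

/-- A nearly optimal Töplitz approximation at the scale `N`. -/
lemma exists_toplitz_of_qtNorm_lt {A : ℝ≥0∞} (h : qtNorm a p L b s r N₀ θ μ f < A) {N : ℕ}
    (hN : N₀ ≤ N) : ∃ t, IsToplitz a p L b s r N θ μ t ∧ hamNorm a p s r f ≤ A ∧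
      hamNorm a p s r t ≤ A ∧ hamNorm a p s r (defect L b N θ μ f t) ≤ A := by
  have h1 := lt_of_le_of_lt (le_iSup₂ (f := fun (N : ℕ) (_ : N₀ ≤ N) =>
    ⨅ (g : 𝒪 → Series js) (_ : IsToplitz a p L b s r N θ μ g), max (hamNorm a p s r f)
      (max (hamNorm a p s r g) (hamNorm a p s r (defect L b N θ μ f g)))) N hN) h
  obtain ⟨t, h2⟩ := iInf_lt_iff.1 h1
  obtain ⟨ht, h3⟩ := iInf_lt_iff.1 h2
  exact ⟨t, ht, (le_max_left _ _).trans h3.le,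
    ((le_max_left _ _).trans (le_max_right _ _)).trans h3.le,
    ((le_max_right _ _).trans (le_max_right _ _)).trans h3.le⟩

lemma hamNorm_le_qtNorm : hamNorm a p s r f ≤ qtNorm a p L b s r N₀ θ μ f := by
  refine le_trans ?_ (le_iSup₂ N₀ le_rfl)
  exact le_iInf₂ fun _ _ => le_max_left _ _

/-- The estimate of the bracket of two series. At the scale `N`, the Töplitz approximation of the
bracket is the bilinear part of the bracket of the approximants of the factors. -/
lemma qtNorm_bracket_le_of_lt (ha : 0 ≤ a) (hp : 0 ≤ p) (hb : 0 < b) (hbL : b < L) (hL : L < 1)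
    (hN₀ : 0 < N₀) (hθ : 1 < θ) (hμ0 : 0 ≤ μ) (hμ : μ < 6)
    (hcut : 12 * (N₀ : ℝ) ^ (L - 1) + 2 * kappa js * (N₀ : ℝ) ^ (b - 1) < 1)
    (hr : 0 < r) (hs₁ : 0 < s₁) (hr₁ : 0 < r₁) (hN : N₀ ≤ N₁) (hμμ : μ₁ ≤ μ) (hθθ : θ ≤ θ₁)
    (hs2 : s ≤ 2 * s₁) (hss : s₁ < s) (hr2 : r ≤ 2 * r₁) (hrr : r₁ < r)
    (hlow : kappa js * (N₁ : ℝ) ^ (b - L) < μ - μ₁)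
    (hhigh : μ * (N₁ : ℝ) ^ (L - 1) + kappa js * (N₁ : ℝ) ^ (b - 1) < θ₁ - θ)
    (hexp : 2 * N₁ * Real.exp (-((N₁ : ℝ) ^ b * ((s - s₁) / 2))) < 1)
    (hbs : 2 < b * (s - s₁) * (N₁ : ℝ) ^ b) {δ : ℝ} (hδ : 0 < δ) (hsδ : s₁ + s * δ ≤ s)
    (hrδ : r₁ + r * δ ≤ r) (hf : IsNull f) (hg : IsNull g) {A B : ℝ≥0∞}
    (hA : qtNorm a p L b s r N₀ θ μ f < A) (hA' : A ≠ ∞)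
    (hB : qtNorm a p L b s r N₀ θ μ g < B) (hB' : B ≠ ∞) :
    qtNorm a p L b s₁ r₁ N₁ θ₁ μ₁ (fun ξ => bracket (f ξ) (g ξ)) ≤
      ENNReal.ofReal (288 * δ⁻¹) * A * B := by
  have hA0 : A ≠ 0 := (bot_le.trans_lt hA).ne'
  have hB0 : B ≠ 0 := (bot_le.trans_lt hB).ne'
  refine iSup₂_le fun N hNN => ?_
  have hN₁ : 0 < N₁ := hN₀.trans_le hN
  have hcutN : LargeCutoff js L b N := largeCutoff_of_le hL (hbL.trans hL) hN₀ (hN.trans hNN) hcut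
  have hlowN := lowMomentum_cutoff_le hbL hN₁ hNN hlow
  have hhighN := highMomentum_cutoff_le hL (hbL.trans hL) hμ0 hN₁ hNN hhigh
  -- half of the width lost damps the high frequencies, the other half serves the bracket estimate
  set s' : ℝ := (s + s₁) / 2 with hs'_def
  have hs' : 0 < s' := by rw [hs'_def]; linarith
  have hexpN : 2 * N * Real.exp (-((N : ℝ) ^ b * (s - s'))) ≤ 1 := by
    have h1 := mul_exp_neg_rpow_le (c := (s - s₁) / 2) hb (Nat.cast_pos (α := ℝ).2 hN₁)
      (Nat.cast_le (α := ℝ).2 hNN) (by linarith)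
    have h2 : s - s' = (s - s₁) / 2 := by rw [hs'_def]; ring
    rw [h2]
    linarith
  obtain ⟨u, hu, hfA, huA, hdA⟩ := exists_toplitz_of_qtNorm_lt hA (hN.trans hNN)
  obtain ⟨w, hw, hgB, hwB, hdB⟩ := exists_toplitz_of_qtNorm_lt hB (hN.trans hNN)
  set f' : 𝒪 → Series js := fun ξ => approximant L b N θ μ (f ξ) (u ξ) with hf'
  set g' : 𝒪 → Series js := fun ξ => approximant L b N θ μ (g ξ) (w ξ) with hg'
  have sizes := fun ξ => mNorm_approximant_le (a := a) (p := p) (s := s) (s' := s') hs'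
    (by rw [hs'_def]; linarith) (by rw [hs'_def]; linarith) hr hexpN
    (fun q hq => hu.isBilinear (ξ := ξ) hq) ((mNorm_le_hamNorm f ξ).trans hfA)
    ((mNorm_le_hamNorm u ξ).trans huA) ((mNorm_le_hamNorm (defect L b N θ μ f u) ξ).trans hdA)
  have sizes' := fun ξ => mNorm_approximant_le (a := a) (p := p) (s := s) (s' := s') hs'
    (by rw [hs'_def]; linarith) (by rw [hs'_def]; linarith) hr hexpN
    (fun q hq => hw.isBilinear (ξ := ξ) hq) ((mNorm_le_hamNorm g ξ).trans hgB)
    ((mNorm_le_hamNorm w ξ).trans hwB) ((mNorm_le_hamNorm (defect L b N θ μ g w) ξ).trans hdB)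
  have hsd : s₁ + s' * (δ / 2) ≤ s' := by
    rw [hs'_def]
    nlinarith
  have hs's₁ : s' ≤ 2 * s₁ := by rw [hs'_def]; linarith
  have hK : 18 * (ENNReal.ofReal (8 * (δ / 2)⁻¹) * A * B) =
      ENNReal.ofReal (288 * δ⁻¹) * A * B := by
    rw [← mul_assoc, ← mul_assoc, ← ENNReal.ofReal_ofNat 18, ← ENNReal.ofReal_mul (by norm_num)]
    congr 3
    rw [inv_div]
    ring
  have fin : ∀ {C : ℝ≥0∞} (k : ℕ), C ≠ ∞ → (k : ℝ≥0∞) * C ≠ ∞ := fun k h =>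
    ENNReal.mul_ne_top (ENNReal.natCast_ne_top k) h
  have pos : ∀ {C : ℝ≥0∞} (k : ℕ), k ≠ 0 → C ≠ 0 → (k : ℝ≥0∞) * C ≠ 0 := fun k hk h =>
    mul_ne_zero (Nat.cast_ne_zero.2 hk) h
  have hbr : ∀ ξ, mNorm a p s₁ r₁ (maj (bracket (f ξ) (g ξ))) ≤
      ENNReal.ofReal (288 * δ⁻¹) * A * B := by
    intro ξ
    refine (mNorm_bracket_le hs' hr hs₁ hr₁ (half_pos hδ) hsd (by nlinarith) hs's₁ hr2
      (pos 2 (by norm_num) hA0) (fin 2 hA') (pos 2 (by norm_num) hB0) (fin 2 hB')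
      (sizes ξ).1 (sizes' ξ).1).trans ?_
    rw [← hK]
    calc _ = 4 * (ENNReal.ofReal (8 * (δ / 2)⁻¹) * A * B) := by push_cast; ring
      _ ≤ _ := mul_le_mul' (by norm_num) le_rfl
  -- at every radius in `[r₁, (r₁ + r) / 2]`, as there is room between `r₁` and `r`
  have hbr' : ∀ (ρ : ℝ), r₁ ≤ ρ → ρ ≤ (r₁ + r) / 2 → ∀ ξ,
      mNorm a p s₁ ρ (maj (bil L b N θ₁ μ₁ (bracket (f' ξ) (g' ξ)))) ≤
        ENNReal.ofReal (288 * δ⁻¹) * A * B := by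
    intro ρ h1 h2 ξ
    refine (mNorm_mono (maj_bil_le _)).trans ((mNorm_bracket_le hs' hr hs₁ (hr₁.trans_le h1)
      (half_pos hδ) hsd (by linarith) hs's₁ (by linarith)
      (pos 4 (by norm_num) hA0) (fin 4 hA') (pos 4 (by norm_num) hB0) (fin 4 hB')
      (sizes ξ).2.1 (sizes' ξ).2.1).trans ?_)
    rw [← hK]
    calc _ = 16 * (ENNReal.ofReal (8 * (δ / 2)⁻¹) * A * B) := by push_cast; ring
      _ ≤ _ := mul_le_mul' (by norm_num) le_rfl
  have hdef : ∀ ξ, mNorm a p s₁ r₁ (maj (defect L b N θ₁ μ₁ (fun ξ => bracket (f ξ) (g ξ))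
      (fun ξ => bil L b N θ₁ μ₁ (bracket (f' ξ) (g' ξ))) ξ)) ≤
        ENNReal.ofReal (288 * δ⁻¹) * A * B := by
    intro ξ
    have heq : defect L b N θ₁ μ₁ (fun ξ => bracket (f ξ) (g ξ))
        (fun ξ => bil L b N θ₁ μ₁ (bracket (f' ξ) (g' ξ))) ξ =
        bil L b N θ₁ μ₁ fun q => (N : ℂ) * (bracket (f ξ) (g ξ) q - bracket (f' ξ) (g' ξ) q) := by
      funext q
      simp only [defect, bilinearProj, bil]
      by_cases hq : q ∈ {q : Idx js | q.IsBilinear L b N θ₁ μ₁}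
      · simp only [Set.indicator_of_mem hq]
      · simp only [Set.indicator_of_notMem hq, sub_zero, mul_zero]
    rw [heq, ← hK]
    exact (mNorm_mono (maj_bil_le _)).trans (mNorm_bracket_sub_le ha hp hs' hr hs₁ hr₁
      (half_pos hδ) hsd (by nlinarith) hs's₁ hr2 (N : ℂ) hA0 hA' hB0 hB' (sizes ξ).1
      (sizes ξ).2.1 (sizes ξ).2.2 (sizes' ξ).1 (sizes' ξ).2.1 (sizes' ξ).2.2)
  have htop : ENNReal.ofReal (288 * δ⁻¹) * A * B < ∞ :=
    ENNReal.mul_lt_top (ENNReal.mul_lt_top ENNReal.ofReal_lt_top hA'.lt_top) hB'.lt_top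
  have hToplitz : IsToplitz a p L b s₁ r₁ N θ₁ μ₁
      (fun ξ => bil L b N θ₁ μ₁ (bracket (f' ξ) (g' ξ))) := by
    refine isToplitz_of_shiftInvariant (r' := (r₁ + r) / 2) hcutN (hμμ.trans_lt hμ)
      (hθ.trans_le hθθ) hs₁ hr₁ (by linarith)
      ((hamNorm_le (hbr' r₁ le_rfl (by linarith))).trans_lt htop)
      ((hamNorm_le (hbr' _ (by linarith) le_rfl)).trans_lt htop) (fun ξ q hq => ?_) fun ξ => ?_
    · by_contra h
      exact hq (Set.indicator_of_notMem (s := {q : Idx js | q.IsBilinear L b N θ₁ μ₁}) h _)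
    · refine ShiftInvariant.bil ?_
      refine bracket_shiftInvariant hb.le hcutN hμ hθ hlowN hhighN hθθ ?_
        (approximant_null (hf ξ) fun q hq => hu.isBilinear hq) approximant_lowFreq
        (approximant_shiftInvariant (hf ξ) (fun q hq => hu.isBilinear hq)
          (hu.shiftInvariant hcutN hμ hθ ξ))
        (approximant_null (hg ξ) fun q hq => hw.isBilinear hq) approximant_lowFreq
        (approximant_shiftInvariant (hg ξ) (fun q hq => hw.isBilinear hq)
          (hw.shiftInvariant hcutN hμ hθ ξ))
      exact bracketable_of_mNorm ha hp hs'.le hr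
        (ne_top_of_le_ne_top (fin 4 hA') (sizes ξ).2.1)
        (ne_top_of_le_ne_top (fin 4 hB') (sizes' ξ).2.1)
  exact iInf₂_le_of_le _ hToplitz
    (max_le (hamNorm_le hbr) (max_le (hamNorm_le (hbr' r₁ le_rfl (by linarith))) (hamNorm_le hdef)))

lemma quasiToplitzNorm_eq {F : 𝒪 → Point js → ℂ} (hs : 0 < s) (hr : 0 < r)
    (hF : ∀ ξ, HasExpansion a p s r (F ξ) (f ξ)) :
    quasiToplitzNorm a p L b s r N₀ θ μ F = qtNorm a p L b s r N₀ θ μ f := by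
  refine le_antisymm (iInf₂_le f hF) (le_iInf₂ fun f₂ hf₂ => ?_)
  have : f₂ = f := funext fun ξ => (hf₂ ξ).unique hs hr (hF ξ)
  rw [this]

end Norm

/-- Finite factors may be approximated from above. -/
lemma le_mul_mul_of_forall_gt {X c S T : ℝ≥0∞} (hc : c ≠ ∞) (hS : S ≠ ∞) (hT : T ≠ ∞)
    (h : ∀ A B, S < A → A ≠ ∞ → T < B → B ≠ ∞ → X ≤ c * A * B) : X ≤ c * S * T := by
  have lim : Filter.Tendsto (fun ε : ℝ≥0∞ => c * (S + ε) * (T + ε)) (nhdsWithin 0 (Set.Ioi 0))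
      (nhds (c * (S + 0) * (T + 0))) := by
    refine Filter.Tendsto.mono_left ?_ nhdsWithin_le_nhds
    have h1 : ∀ U : ℝ≥0∞, Filter.Tendsto (fun ε : ℝ≥0∞ => U + ε) (nhds 0) (nhds (U + 0)) :=
      fun U => tendsto_const_nhds.add Filter.tendsto_id
    refine ENNReal.Tendsto.mul (ENNReal.Tendsto.const_mul (h1 S) (Or.inr hc)) (Or.inr ?_) (h1 T)
      (Or.inr ?_)
    · simpa using hT
    · simpa using ENNReal.mul_ne_top hc hS
  rw [add_zero, add_zero] at lim
  refine ge_of_tendsto lim ?_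
  have hfin : ∀ᶠ ε : ℝ≥0∞ in nhdsWithin 0 (Set.Ioi 0), ε < 1 :=
    nhdsWithin_le_nhds (Iio_mem_nhds one_pos)
  filter_upwards [hfin, self_mem_nhdsWithin] with ε h1 h2
  exact h _ _ (ENNReal.lt_add_right hS h2.ne') (ENNReal.add_ne_top.2 ⟨hS, h1.ne_top⟩)
    (ENNReal.lt_add_right hT h2.ne') (ENNReal.add_ne_top.2 ⟨hT, h1.ne_top⟩)

end QuasiToplitz

end

open QuasiToplitz in
/-- The Poisson bracket of two quasi-Töplitz functions is quasi-Töplitz. The constant `C` depends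
only on the number `n` of tangential sites. -/
theorem proposition3p1 (n : ℕ) :
    ∃ C : ℝ, 1 ≤ C ∧
      ∀ (js : Fin n ↪ ℤ) (𝒪 : Set (Fin n → ℝ)) (a p L b : ℝ),
        0 ≤ a → 1 / 2 < p → 0 < b → b < L → L < 1 →
      ∀ (N₀ N₁ : ℕ) (θ μ θ₁ μ₁ s r s₁ r₁ : ℝ),
        0 < N₀ → 1 < θ → θ < 6 → 1 < μ → μ < 6 →
        12 * (N₀ : ℝ) ^ (L - 1) + 2 * kappa js * (N₀ : ℝ) ^ (b - 1) < 1 →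
        1 < μ₁ → θ₁ < 6 →
        0 < s → s < 1 → 0 < r → r < 1 →
        N₀ ≤ N₁ → μ₁ ≤ μ → θ ≤ θ₁ →
        s / 2 ≤ s₁ → s₁ < s → r / 2 ≤ r₁ → r₁ < r →
        kappa js * (N₁ : ℝ) ^ (b - L) < μ - μ₁ →
        μ * (N₁ : ℝ) ^ (L - 1) + kappa js * (N₁ : ℝ) ^ (b - 1) < θ₁ - θ →
        2 * N₁ * Real.exp (-((N₁ : ℝ) ^ b * ((s - s₁) / 2))) < 1 →
        2 < b * (s - s₁) * (N₁ : ℝ) ^ b →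
      ∀ F₁ F₂ : 𝒪 → Point js → ℂ,
        IsQuasiToplitz a p L b s r N₀ θ μ F₁ →
        IsQuasiToplitz a p L b s r N₀ θ μ F₂ →
          (∀ ξ, ∀ v ∈ domain js a p s₁ r₁, Summable (bracketTerm (F₁ ξ) (F₂ ξ) v)) ∧
          IsQuasiToplitz a p L b s₁ r₁ N₁ θ₁ μ₁ (fun ξ => poissonBracket (F₁ ξ) (F₂ ξ)) ∧
          quasiToplitzNorm a p L b s₁ r₁ N₁ θ₁ μ₁ (fun ξ => poissonBracket (F₁ ξ) (F₂ ξ)) ≤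
            ENNReal.ofReal (C * (min (1 - s₁ / s) (1 - r₁ / r))⁻¹) *
              quasiToplitzNorm a p L b s r N₀ θ μ F₁ *
              quasiToplitzNorm a p L b s r N₀ θ μ F₂ := by
  refine ⟨288, by norm_num, ?_⟩
  intro js 𝒪 a p L b ha hp hb hbL hL N₀ N₁ θ μ θ₁ μ₁ s r s₁ r₁ hN₀ hθ _ hμ1 hμ hcut _ _ hs _ hr _
    hN hμμ hθθ hs2 hss hr2 hrr hlow hhigh hexp hbs F₁ F₂ hF₁ hF₂
  obtain ⟨f, hf, -, hfnull, hfT⟩ := hF₁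
  obtain ⟨g, hg, -, hgnull, hgT⟩ := hF₂
  have hs₁ : 0 < s₁ := by linarith
  have hr₁ : 0 < r₁ := by linarith
  have hp0 : 0 ≤ p := by linarith
  set δ := min (1 - s₁ / s) (1 - r₁ / r) with hδ_def
  have hδ : 0 < δ := lt_min (sub_pos.2 ((div_lt_one hs).2 hss)) (sub_pos.2 ((div_lt_one hr).2 hrr))
  have hsδ : s₁ + s * δ ≤ s := by
    have h1 := mul_le_mul_of_nonneg_left (min_le_left (1 - s₁ / s) (1 - r₁ / r)) hs.le
    rw [mul_sub, mul_div_cancel₀ _ hs.ne'] at h1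
    linarith
  have hrδ : r₁ + r * δ ≤ r := by
    have h1 := mul_le_mul_of_nonneg_left (min_le_right (1 - s₁ / s) (1 - r₁ / r)) hr.le
    rw [mul_sub, mul_div_cancel₀ _ hr.ne'] at h1
    linarith
  have hf_top : ∀ ξ, mNorm a p s r (maj (f ξ)) ≠ ∞ := fun ξ =>
    (((mNorm_le_hamNorm f ξ).trans hamNorm_le_qtNorm).trans_lt hfT).ne
  have hg_top : ∀ ξ, mNorm a p s r (maj (g ξ)) ≠ ∞ := fun ξ =>
    (((mNorm_le_hamNorm g ξ).trans hamNorm_le_qtNorm).trans_lt hgT).ne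
  have hdom := domain_mono (js := js) (a := a) (p := p) hss.le hr₁.le hrr.le
  have hexpansion : ∀ ξ, HasExpansion a p s₁ r₁ (poissonBracket (F₁ ξ) (F₂ ξ))
      (bracket (f ξ) (g ξ)) := fun ξ v hv =>
    hasExpansion_poissonBracket ha hp0 hr (hf ξ) (hg ξ) (hf_top ξ) (hg_top ξ) v (hdom hv)
  have hbound : qtNorm a p L b s₁ r₁ N₁ θ₁ μ₁ (fun ξ => bracket (f ξ) (g ξ)) ≤
      ENNReal.ofReal (288 * δ⁻¹) * qtNorm a p L b s r N₀ θ μ f * qtNorm a p L b s r N₀ θ μ g :=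
    le_mul_mul_of_forall_gt ENNReal.ofReal_ne_top hfT.ne hgT.ne fun A B hA hA' hB hB' =>
      qtNorm_bracket_le_of_lt ha hp0 hb hbL hL hN₀ hθ (by linarith) hμ hcut hr hs₁ hr₁ hN hμμ hθθ
        (by linarith) hss (by linarith) hrr hlow hhigh hexp hbs hδ hsδ hrδ hfnull hgnull hA hA' hB
        hB'
  have hfin : qtNorm a p L b s₁ r₁ N₁ θ₁ μ₁ (fun ξ => bracket (f ξ) (g ξ)) < ∞ :=
    hbound.trans_lt (ENNReal.mul_lt_top (ENNReal.mul_lt_top ENNReal.ofReal_lt_top hfT) hgT)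
  refine ⟨fun ξ v hv => summable_bracketTerm ha hp0 hr (hf ξ) (hg ξ) (hf_top ξ) (hg_top ξ)
    (hdom hv), ⟨_, hexpansion, hamNorm_le_qtNorm.trans_lt hfin,
      fun ξ => bracket_null (hfnull ξ) (hgnull ξ), hfin⟩, ?_⟩
  rw [quasiToplitzNorm_eq hs₁ hr₁ hexpansion, quasiToplitzNorm_eq hs hr hf,
    quasiToplitzNorm_eq hs hr hg]
  exact hbound
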